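/- Let $M,N\ge 1$, $\Gamma=\mathbb Z/M\mathbb Z\times\mathbb Z/N\mathbb Z$ (written additively) and $n$ a number of points. **The source.** Let $\mathfrak t_{1,n}^\Gamma$ be the complex Lie algebra with generators $x_i,y_i$ ($1\le i\le n$) and $t_{ij}^\alpha$ ($\alpha\in\Gamma$, $i\ne j$) and relations, for pairwise distinct $i,j,k,l$ and all $\alpha,\beta\in\Gamma$: $t_{ij}^\alpha=t_{ji}^{-\alpha}$; $[x_i,y_j]=[x_j,y_i]=\sum_\alpha t_{ij}^\alpha$; $[x_i,x_j]=[y_i,y_j]=0$; $[x_i,y_i]=-\sum_{j\ne i}\sum_\alpha t_{ij}^\alpha$; $[t_{ij}^\alpha,t_{kl}^\beta]=0$; $[x_i,t_{jk}^\alpha]=[y_i,t_{jk}^\alpha]=0$; $[t_{ij}^\alpha,t_{ik}^{\alpha+\beta}+t_{jk}^\beta]=0$; $[x_i+x_j,t_{ij}^\alpha]=[y_i+y_j,t_{ij}^\alpha]=0$. Let $\bar{\mathfrak t}_{1,n}^\Gamma$ be its quotient by the ideal generated by $\sum_i x_i$ and $\sum_i y_i$; a bar denotes the class of an element. **The data.**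 Let $\mathfrak g$ be a complex Lie algebra, $t_{\mathfrak g}\in S^2(\mathfrak g)^{\mathfrak g}$ nondegenerate, and $\Gamma\to\mathrm{Aut}(\mathfrak g,t_{\mathfrak g})$ a group morphism. Let $\mathfrak l=\mathfrak g^\Gamma$, and let $t_{\mathfrak l}\in S^2(\mathfrak l)^{\mathfrak l}$ be the component of $t_{\mathfrak g}$ with respect to the decomposition of $\mathfrak g$ into $\mathfrak l$ and the sum of the eigenspaces of the nontrivial characters of $\Gamma$. Let $\mathfrak l=\mathfrak h\oplus\mathfrak m$ with $\mathfrak h$ a Lie subalgebra, $\mathfrak m$ a subspace and $[\mathfrak h,\mathfrak m]\subset\mathfrak m$. Assume that $t_{\mathfrak l}=t_{\mathfrak h}+t_{\mathfrak m}$ with $t_{\mathfrak h}=\sum_\nu e_\nu\otimes e_\nu\in S^2(\mathfrak h)^{\mathfrak h}$ and $t_{\mathfrak m}\in S^2(\mathfrak m)^{\mathfrak h}$. For $\lambda\in\mathfrak h^*$ let $\lambda^\vee=(\lambda\otimes\mathrm{id})(t_{\mathfrak h})$, and assume that $P(\lambda)=\det(\mathrm{ad}(\lambda^\vee)|_{\mathfrak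 m})\in S(\mathfrak h)$ is nonzero. Let $\langle\cdot,\cdot\rangle$ be the pairing on $\mathfrak h$ inverse to $t_{\mathfrak h}$. **The target.** Let $\mathrm{Diff}(\mathfrak h^*_{reg})=\mathrm{Diff}(\mathfrak h^*)[1/P]$ be the algebra generated by the commutative algebra $S(\mathfrak h)[1/P]$, in which $h\in\mathfrak h$ is written $\bar{\mathrm x}_h$, and by elements $\bar\partial_h$, linear in $h\in\mathfrak h$, with relations $[\bar\partial_h,\bar\partial_{h'}]=0$ and $[\bar\partial_h,\bar{\mathrm x}_{h'}]=\langle h,h'\rangle$. Write $\bar{\mathrm x}_\nu=\bar{\mathrm x}_{e_\nu}$ and $\bar\partial_\nu=\bar\partial_{e_\nu}$. Let $B_n=\mathrm{Diff}(\mathfrak h^*_{reg})\otimes U(\mathfrak g)^{\otimes n}$, and write $a^{(i)}$ for $a\in\mathfrak g$ placed in the $i$-th tensor factor of $U(\mathfrak g)^{\otimes n}$. For $h\in\mathfrak h$ let $\bar Y_h=\big(\sum_\nu\bar{\mathrm x}_{[h,e_\nu]}\bar\partial_\nu\big)\otimes1+1\otimes\sum_i h^{(i)}$, let $h$ act on $B_n$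 by the commutator with $\bar Y_h$, and let $\mathfrak h^{\mathrm{diag}}=\{\bar Y_h : h\in\mathfrak h\}$. Let $H_n(\mathfrak g,\mathfrak h^*_{reg})=(B_n)^{\mathfrak h}/(B_n\mathfrak h^{\mathrm{diag}})^{\mathfrak h}$, a Lie algebra under the commutator. Finally let $r(\lambda)=(\mathrm{id}\otimes(\mathrm{ad}\,\lambda^\vee)|_{\mathfrak m}^{-1})(t_{\mathfrak m})$, written $r=\sum_\delta a_\delta\otimes b_\delta\otimes\ell_\delta\in\mathfrak m^{\otimes2}\otimes S(\mathfrak h)[1/P]$. **Proposition.** The elements of $B_n$ on the right-hand sides below are $\mathfrak h$-invariant, and there is a unique Lie algebra morphism $\rho_{\mathfrak g,\mathfrak h}:\bar{\mathfrak t}_{1,n}^\Gamma\to H_n(\mathfrak g,\mathfrak h^*_{reg})$ such that, for all $i$, all $j\neq i$ and all $\alpha\in\Gamma$ (with classes in $H_n(\mathfrak g,\mathfrak h^*_{reg})$ on the right), $$\bar x_i\mapsto M\sum_\nu\bar{\mathrm x}_\nu\otimes e_\nu^{(i)},$$ $$\bar y_i\mapsto -N\sum_\nu\bar\partial_\nu\otimes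 e_\nu^{(i)}+N\sum_{k=1}^n\sum_\delta\ell_\delta\otimes a_\delta^{(i)}b_\delta^{(k)},$$ $$\bar t_{ij}^\alpha\mapsto 1\otimes\big((\alpha\otimes\mathrm{id})(t_{\mathfrak g})\big)^{(ij)},$$ where $(a\otimes b)^{(ij)}=a^{(i)}b^{(j)}$, and the sum over $k$ includes $k=i$. -/

import Mathlib

open scoped TensorProduct

noncomputable section

/-! ### The Lie algebra of infinitesimal ellipsitomic braids -/

/-- Generators `x i`, `y i`, and `t α i j` for `i ≠ j`. -/
inductive EllGen (Γ : Type*) (n : ℕ) : Type _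
  | x (i : Fin n) : EllGen Γ n
  | y (i : Fin n) : EllGen Γ n
  | t (α : Γ) (i j : Fin n) (hij : i ≠ j) : EllGen Γ n

namespace EllGen

variable (Γ : Type*) (n : ℕ)

/-- The generator `x i` in the free Lie algebra. -/
abbrev fx (i : Fin n) : FreeLieAlgebra ℂ (EllGen Γ n) := FreeLieAlgebra.of ℂ (EllGen.x i)

/-- The generator `y i` in the free Lie algebra. -/
abbrev fy (i : Fin n) : FreeLieAlgebra ℂ (EllGen Γ n) := FreeLieAlgebra.of ℂ (EllGen.y i)

variable {Γ} {n}

/-- The generator `t α i j` in the free Lie algebra. -/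
abbrev ft (α : Γ) (i j : Fin n) (hij : i ≠ j) : FreeLieAlgebra ℂ (EllGen Γ n) :=
  FreeLieAlgebra.of ℂ (EllGen.t α i j hij)

end EllGen

open EllGen in
/-- The elements of the free Lie algebra that are set to zero in `EllBraid Γ n`. -/
inductive EllRel (Γ : Type*) [AddCommGroup Γ] [Fintype Γ] (n : ℕ) :
    FreeLieAlgebra ℂ (EllGen Γ n) → Prop
  | symm (α : Γ) (i j : Fin n) (hij : i ≠ j) :
      EllRel Γ n (ft α i j hij - ft (-α) j i hij.symm)
  | xy (i j : Fin n) (hij : i ≠ j) :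
      EllRel Γ n (⁅fx Γ n i, fy Γ n j⁆ - ∑ α : Γ, ft α i j hij)
  | xy_comm (i j : Fin n) (hij : i ≠ j) :
      EllRel Γ n (⁅fx Γ n i, fy Γ n j⁆ - ⁅fx Γ n j, fy Γ n i⁆)
  | xx (i j : Fin n) (hij : i ≠ j) : EllRel Γ n ⁅fx Γ n i, fx Γ n j⁆
  | yy (i j : Fin n) (hij : i ≠ j) : EllRel Γ n ⁅fy Γ n i, fy Γ n j⁆
  | xy_self (i : Fin n) :
      EllRel Γ n (⁅fx Γ n i, fy Γ n i⁆ +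
        ∑ j : {j : Fin n // i ≠ j}, ∑ α : Γ, ft α i j.1 j.2)
  | tt (α β : Γ) (i j k l : Fin n) (hij : i ≠ j) (hkl : k ≠ l)
      (hik : i ≠ k) (hil : i ≠ l) (hjk : j ≠ k) (hjl : j ≠ l) :
      EllRel Γ n ⁅ft α i j hij, ft β k l hkl⁆
  | xt (α : Γ) (i j k : Fin n) (hij : i ≠ j) (hik : i ≠ k) (hjk : j ≠ k) :
      EllRel Γ n ⁅fx Γ n i, ft α j k hjk⁆
  | yt (α : Γ) (i j k : Fin n) (hij : i ≠ j) (hik : i ≠ k) (hjk : j ≠ k) :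
      EllRel Γ n ⁅fy Γ n i, ft α j k hjk⁆
  | fourT (α β : Γ) (i j k : Fin n) (hij : i ≠ j) (hik : i ≠ k) (hjk : j ≠ k) :
      EllRel Γ n ⁅ft α i j hij, ft (α + β) i k hik + ft β j k hjk⁆
  | xxt (α : Γ) (i j : Fin n) (hij : i ≠ j) :
      EllRel Γ n ⁅fx Γ n i + fx Γ n j, ft α i j hij⁆
  | yyt (α : Γ) (i j : Fin n) (hij : i ≠ j) :
      EllRel Γ n ⁅fy Γ n i + fy Γ n j, ft α i j hij⁆

/-- The Lie algebra `𝔱_{1,n}^Γ` over `ℂ`. -/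
abbrev EllBraid (Γ : Type*) [AddCommGroup Γ] [Fintype Γ] (n : ℕ) : Type _ :=
  FreeLieAlgebra ℂ (EllGen Γ n) ⧸
    (LieSubmodule.lieSpan ℂ (FreeLieAlgebra ℂ (EllGen Γ n)) {u | EllRel Γ n u} :
      LieIdeal ℂ (FreeLieAlgebra ℂ (EllGen Γ n)))

namespace EllBraid

variable (Γ : Type*) [AddCommGroup Γ] [Fintype Γ] (n : ℕ)

/-- The class of a generator in `𝔱_{1,n}^Γ`. -/
def gen (a : EllGen Γ n) : EllBraid Γ n :=
  LieSubmodule.Quotient.mk (FreeLieAlgebra.of ℂ a)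

/-- The ideal of `𝔱_{1,n}^Γ` generated by `∑ x i` and `∑ y i`. -/
def sumIdeal : LieIdeal ℂ (EllBraid Γ n) :=
  LieSubmodule.lieSpan ℂ (EllBraid Γ n)
    {∑ i, gen Γ n (EllGen.x i), ∑ i, gen Γ n (EllGen.y i)}

end EllBraid

/-- The reduced Lie algebra `𝔱̄_{1,n}^Γ`. -/
abbrev EllBraidBar (Γ : Type*) [AddCommGroup Γ] [Fintype Γ] (n : ℕ) : Type _ :=
  EllBraid Γ n ⧸ EllBraid.sumIdeal Γ n

namespace EllBraidBar

variable (Γ : Type*) [AddCommGroup Γ] [Fintype Γ] (n : ℕ)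

/-- The class of a generator in `𝔱̄_{1,n}^Γ`. -/
def gen (a : EllGen Γ n) : EllBraidBar Γ n :=
  LieSubmodule.Quotient.mk (EllBraid.gen Γ n a)

end EllBraidBar

/-! ### Tensors in `V ⊗ V` -/

/-- For `t = ∑ a ⊗ b`, the map `λ ↦ (λ ⊗ id)(t) = ∑ λ(a) b`. -/
def tensorSharp {V : Type*} [AddCommGroup V] [Module ℂ V] (t : V ⊗[ℂ] V) :
    Module.Dual ℂ V →ₗ[ℂ] V :=
  (LinearMap.applyₗ t).comp
    ((LinearMap.compRight ℂ (TensorProduct.lid ℂ V).toLinearMap).comp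
      ((TensorProduct.mapBilinear (RingHom.id ℂ) V V ℂ V).flip LinearMap.id))

open Classical in
/-- The pairing on `V` inverse to a nondegenerate tensor `t` (and zero if `t` is degenerate). -/
def tensorPairing {V : Type*} [AddCommGroup V] [Module ℂ V] (t : V ⊗[ℂ] V) :
    V →ₗ[ℂ] Module.Dual ℂ V :=
  if h : Function.Bijective (tensorSharp t) then
    (LinearEquiv.ofBijective (tensorSharp t) h).symm.toLinearMap else 0

/-- For linear maps `f`, `g` into an algebra, the map `a ⊗ b ↦ f a * g b`. -/
def tensorMul {V W B : Type*} [AddCommGroup V] [Module ℂ V] [AddCommGroup W] [Module ℂ W]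
    [Ring B] [Algebra ℂ B] (f : V →ₗ[ℂ] B) (g : W →ₗ[ℂ] B) : V ⊗[ℂ] W →ₗ[ℂ] B :=
  TensorProduct.lift ((LinearMap.mul ℂ B).compl₁₂ f g)

/-! ### Lie algebras with an invariant tensor and a `Γ`-action -/

/-- A nondegenerate `t ∈ S²(𝔤)^𝔤` together with a group morphism `Γ → Aut(𝔤, t)`. -/
structure EquivariantTensor (Γ : Type*) [AddCommGroup Γ] (𝔤 : Type*) [LieRing 𝔤]
    [LieAlgebra ℂ 𝔤] where
  t : 𝔤 ⊗[ℂ] 𝔤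
  t_symm : TensorProduct.comm ℂ 𝔤 𝔤 t = t
  t_inv : ∀ a : 𝔤, ⁅a, t⁆ = 0
  t_nondeg : Function.Bijective (tensorSharp t)
  act : Γ → (𝔤 ≃ₗ⁅ℂ⁆ 𝔤)
  act_zero : ∀ a, act 0 a = a
  act_add : ∀ α β a, act (α + β) a = act α (act β a)
  act_t : ∀ α, TensorProduct.map (act α : 𝔤 →ₗ[ℂ] 𝔤) (act α : 𝔤 →ₗ[ℂ] 𝔤) t = t

namespace EquivariantTensor

variable {Γ : Type*} [AddCommGroup Γ] {𝔤 : Type*} [LieRing 𝔤] [LieAlgebra ℂ 𝔤]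
variable (E : EquivariantTensor Γ 𝔤)

/-- The Lie subalgebra `𝔩 = 𝔤^Γ`. -/
def fixed : LieSubalgebra ℂ 𝔤 where
  carrier := {a | ∀ α, E.act α a = a}
  add_mem' ha hb α := by rw [map_add, ha α, hb α]
  zero_mem' α := map_zero _
  smul_mem' c a ha α := by rw [map_smul, ha α]
  lie_mem' ha hb α := by rw [LieEquiv.map_lie, ha α, hb α]

/-- The projection of `𝔤` onto `𝔩 = 𝔤^Γ` along the sum of the eigenspaces `𝔤_χ`, `χ ≠ 0`,
that is, the average over the finite group `Γ`. -/
def proj [Fintype Γ] : 𝔤 →ₗ[ℂ] 𝔤 :=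
  ((Fintype.card Γ : ℂ)⁻¹) • ∑ α : Γ, (E.act α : 𝔤 →ₗ[ℂ] 𝔤)

/-- The component `t_𝔩 ∈ 𝔩 ⊗ 𝔩` of `t`, viewed in `𝔤 ⊗ 𝔤`. -/
def tFixed [Fintype Γ] : 𝔤 ⊗[ℂ] 𝔤 := TensorProduct.map E.proj E.proj E.t

end EquivariantTensor

/-- A decomposition `𝔩 = 𝔥 ⊕ 𝔪` with `𝔥` a Lie subalgebra and `[𝔥, 𝔪] ⊆ 𝔪`, together with a
decomposition `t_𝔩 = t_𝔥 + t_𝔪`, where `t_𝔥 ∈ S²(𝔥)^𝔥` and `t_𝔪 ∈ S²(𝔪)^𝔥`. -/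
structure ReductiveDecomposition {Γ : Type*} [AddCommGroup Γ] [Fintype Γ] {𝔤 : Type*}
    [LieRing 𝔤] [LieAlgebra ℂ 𝔤] (E : EquivariantTensor Γ 𝔤) where
  𝔥 : LieSubalgebra ℂ 𝔤
  𝔪 : Submodule ℂ 𝔤
  disjoint : 𝔥.toSubmodule ⊓ 𝔪 = ⊥
  span : 𝔥.toSubmodule ⊔ 𝔪 = E.fixed.toSubmodule
  lie_mem : ∀ a ∈ 𝔥, ∀ b ∈ 𝔪, ⁅a, b⁆ ∈ 𝔪
  th : 𝔥 ⊗[ℂ] 𝔥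
  tm : 𝔪 ⊗[ℂ] 𝔪
  th_symm : TensorProduct.comm ℂ 𝔥 𝔥 th = th
  tm_symm : TensorProduct.comm ℂ 𝔪 𝔪 tm = tm
  th_inv : ∀ a : 𝔥, ⁅a, th⁆ = 0
  tm_inv : ∀ a ∈ 𝔥, ⁅a, TensorProduct.map 𝔪.subtype 𝔪.subtype tm⁆ = 0
  sum_eq : TensorProduct.map (𝔥.incl : 𝔥 →ₗ[ℂ] 𝔤) (𝔥.incl : 𝔥 →ₗ[ℂ] 𝔤) th +
    TensorProduct.map 𝔪.subtype 𝔪.subtype tm = E.tFixed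

namespace ReductiveDecomposition

variable {Γ : Type*} [AddCommGroup Γ] [Fintype Γ] {𝔤 : Type*} [LieRing 𝔤] [LieAlgebra ℂ 𝔤]
variable {E : EquivariantTensor Γ 𝔤} (D : ReductiveDecomposition E)

/-- The adjoint action of `𝔥` on `𝔪`. -/
def adM : D.𝔥 →ₗ[ℂ] Module.End ℂ D.𝔪 where
  toFun a := (LieAlgebra.ad ℂ 𝔤 (a : 𝔤)).restrict (D.lie_mem a a.2)
  map_add' a b := by ext x; exact add_lie (a : 𝔤) (b : 𝔤) (x : 𝔤)
  map_smul' c a := by ext x; exact smul_lie c (a : 𝔤) (x : 𝔤)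

/-- For a commutative algebra `A` and a linear map `u : 𝔥 → A` (an `A`-point `λ` of `𝔥*`), the
`A`-linear endomorphism `ad(λ^∨)` of `A ⊗ 𝔪`, where `λ^∨ = (λ ⊗ id)(t_𝔥)`. -/
def genericAd (A : Type*) [CommRing A] [Algebra ℂ A] (u : D.𝔥 →ₗ[ℂ] A) :
    Module.End A (A ⊗[ℂ] D.𝔪) :=
  TensorProduct.lift
    (LinearMap.mk₂ ℂ (fun a b : D.𝔥 => u a • (D.adM b).baseChange A)
      (fun a a' b => by rw [map_add, add_smul])
      (fun c a b => by rw [map_smul, smul_assoc])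
      (fun a b b' => by rw [map_add, LinearMap.baseChange_add, smul_add])
      (fun c a b => by rw [map_smul, LinearMap.baseChange_smul, smul_comm])) D.th

/-- The polynomial `P(λ) = det(ad(λ^∨)|_𝔪) ∈ S(𝔥)`. -/
def P : SymmetricAlgebra ℂ D.𝔥 :=
  LinearMap.det (D.genericAd (SymmetricAlgebra ℂ D.𝔥) (SymmetricAlgebra.ι ℂ D.𝔥))

/-- The algebra `S(𝔥)[1/P]` of functions on `𝔥*_reg`. -/
abbrev RegFun : Type _ := Localization.Away D.P

/-- The linear function `λ ↦ λ(a)` in `S(𝔥)[1/P]`. -/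
def coord : D.𝔥 →ₗ[ℂ] D.RegFun :=
  (IsScalarTower.toAlgHom ℂ (SymmetricAlgebra ℂ D.𝔥) D.RegFun).toLinearMap.comp
    (SymmetricAlgebra.ι ℂ D.𝔥)

/-- The dynamical `r`-matrix `r(λ) = (id ⊗ (ad λ^∨)|_𝔪⁻¹)(t_𝔪)`, as an element of
`𝔪 ⊗ S(𝔥)[1/P] ⊗ 𝔪`. The endomorphism that is inverted has determinant `P`, a unit. -/
def rMatrix : D.𝔪 ⊗[ℂ] (D.RegFun ⊗[ℂ] D.𝔪) :=
  TensorProduct.map LinearMap.id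
    (((Ring.inverse (D.genericAd D.RegFun D.coord)).restrictScalars ℂ).comp
      (TensorProduct.mk ℂ D.RegFun D.𝔪 1)) D.tm

/-- The relations of `Diff(𝔥*_reg)` on the free algebra with a generator for each function
`f ∈ S(𝔥)[1/P]` and a generator `∂_a` for each `a ∈ 𝔥`: functions multiply as in `S(𝔥)[1/P]`,
`∂` is linear, `[∂_a, ∂_b] = 0` and `[∂_a, x_b] = ⟨a, b⟩`. The rule
`[∂_a, 1/P] = -[∂_a, P] / P²` follows from these. -/
inductive DiffRel : FreeAlgebra ℂ (D.RegFun ⊕ D.𝔥) → FreeAlgebra ℂ (D.RegFun ⊕ D.𝔥) → Prop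
  | fn_algebraMap (c : ℂ) : DiffRel (FreeAlgebra.ι ℂ (Sum.inl (algebraMap ℂ D.RegFun c)))
      (algebraMap ℂ _ c)
  | fn_add (f g : D.RegFun) : DiffRel (FreeAlgebra.ι ℂ (Sum.inl (f + g)))
      (FreeAlgebra.ι ℂ (Sum.inl f) + FreeAlgebra.ι ℂ (Sum.inl g))
  | fn_mul (f g : D.RegFun) : DiffRel (FreeAlgebra.ι ℂ (Sum.inl (f * g)))
      (FreeAlgebra.ι ℂ (Sum.inl f) * FreeAlgebra.ι ℂ (Sum.inl g))
  | der_add (a b : D.𝔥) : DiffRel (FreeAlgebra.ι ℂ (Sum.inr (a + b)))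
      (FreeAlgebra.ι ℂ (Sum.inr a) + FreeAlgebra.ι ℂ (Sum.inr b))
  | der_smul (c : ℂ) (a : D.𝔥) : DiffRel (FreeAlgebra.ι ℂ (Sum.inr (c • a)))
      (c • FreeAlgebra.ι ℂ (Sum.inr a))
  | der_comm (a b : D.𝔥) :
      DiffRel (FreeAlgebra.ι ℂ (Sum.inr a) * FreeAlgebra.ι ℂ (Sum.inr b))
        (FreeAlgebra.ι ℂ (Sum.inr b) * FreeAlgebra.ι ℂ (Sum.inr a))
  | der_coord (a b : D.𝔥) :
      DiffRel
        (FreeAlgebra.ι ℂ (Sum.inr a) * FreeAlgebra.ι ℂ (Sum.inl (D.coord b)) -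
          FreeAlgebra.ι ℂ (Sum.inl (D.coord b)) * FreeAlgebra.ι ℂ (Sum.inr a))
        (algebraMap ℂ _ (tensorPairing D.th a b))

/-- The algebra `Diff(𝔥*_reg) = Diff(𝔥*)[1/P]`. -/
abbrev Diff : Type _ := RingQuot D.DiffRel

/-- Multiplication by a function, as a differential operator. -/
def fn : D.RegFun →ₐ[ℂ] D.Diff where
  toFun f := RingQuot.mkAlgHom ℂ D.DiffRel (FreeAlgebra.ι ℂ (Sum.inl f))
  map_one' := by
    have h := RingQuot.mkAlgHom_rel ℂ (DiffRel.fn_algebraMap (D := D) 1)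
    rwa [map_one, map_one, map_one] at h
  map_mul' f g := by
    rw [RingQuot.mkAlgHom_rel ℂ (DiffRel.fn_mul (D := D) f g), map_mul]
  map_zero' := by
    have h := RingQuot.mkAlgHom_rel ℂ (DiffRel.fn_algebraMap (D := D) 0)
    rwa [map_zero, map_zero, map_zero] at h
  map_add' f g := by
    rw [RingQuot.mkAlgHom_rel ℂ (DiffRel.fn_add (D := D) f g), map_add]
  commutes' c := by
    rw [RingQuot.mkAlgHom_rel ℂ (DiffRel.fn_algebraMap (D := D) c), AlgHom.commutes]

/-- The operators `x̄_a`. -/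
def xOp : D.𝔥 →ₗ[ℂ] D.Diff := D.fn.toLinearMap.comp D.coord

/-- The operators `∂̄_a`. -/
def dOp : D.𝔥 →ₗ[ℂ] D.Diff where
  toFun a := RingQuot.mkAlgHom ℂ D.DiffRel (FreeAlgebra.ι ℂ (Sum.inr a))
  map_add' a b := by
    rw [RingQuot.mkAlgHom_rel ℂ (DiffRel.der_add (D := D) a b), map_add]
  map_smul' c a := by
    rw [RingQuot.mkAlgHom_rel ℂ (DiffRel.der_smul (D := D) c a), map_smul, RingHom.id_apply]

/-- `X̄_a = ∑_ν x̄_{[a, e_ν]} ∂̄_{e_ν}`, where `t_𝔥 = ∑_ν e_ν ⊗ e_ν`. -/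
def XOp (a : D.𝔥) : D.Diff :=
  tensorMul (D.xOp.comp (LieAlgebra.ad ℂ D.𝔥 a : D.𝔥 →ₗ[ℂ] D.𝔥)) D.dOp D.th

variable (n : ℕ)

/-- The algebra `B_n = Diff(𝔥*_reg) ⊗ U(𝔤)^{⊗ n}`. -/
def B : Type _ := D.Diff ⊗[ℂ] (⨂[ℂ] _ : Fin n, UniversalEnvelopingAlgebra ℂ 𝔤)

instance instRingB : Ring (D.B n) :=
  inferInstanceAs (Ring (D.Diff ⊗[ℂ] (⨂[ℂ] _ : Fin n, UniversalEnvelopingAlgebra ℂ 𝔤)))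

instance instAlgebraB : Algebra ℂ (D.B n) :=
  inferInstanceAs (Algebra ℂ (D.Diff ⊗[ℂ] (⨂[ℂ] _ : Fin n, UniversalEnvelopingAlgebra ℂ 𝔤)))

/-- The inclusion `d ↦ d ⊗ 1` of differential operators. -/
def op : D.Diff →ₐ[ℂ] D.B n :=
  (Algebra.TensorProduct.includeLeft :
    D.Diff →ₐ[ℂ] D.Diff ⊗[ℂ] (⨂[ℂ] _ : Fin n, UniversalEnvelopingAlgebra ℂ 𝔤))

/-- The inclusion `u ↦ 1 ⊗ u` of `U(𝔤)^{⊗ n}`. -/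
def en : (⨂[ℂ] _ : Fin n, UniversalEnvelopingAlgebra ℂ 𝔤) →ₐ[ℂ] D.B n :=
  (Algebra.TensorProduct.includeRight :
    _ →ₐ[ℂ] D.Diff ⊗[ℂ] (⨂[ℂ] _ : Fin n, UniversalEnvelopingAlgebra ℂ 𝔤))

attribute [local instance] LieRing.ofAssociativeRing

/-- The map `a ↦ 1 ⊗ a^{(i)}`. -/
def leg (i : Fin n) : 𝔤 →ₗ[ℂ] D.B n :=
  ((D.en n).toLinearMap.comp
    (PiTensorProduct.singleAlgHom (R := ℂ)
      (A := fun _ : Fin n => UniversalEnvelopingAlgebra ℂ 𝔤) i).toLinearMap).comp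
    ((UniversalEnvelopingAlgebra.ι ℂ : 𝔤 →ₗ⁅ℂ⁆ UniversalEnvelopingAlgebra ℂ 𝔤) :
      𝔤 →ₗ[ℂ] UniversalEnvelopingAlgebra ℂ 𝔤)

/-- `a ↦ 1 ⊗ a^{(i)}` on `𝔥`. -/
def legH (i : Fin n) : D.𝔥 →ₗ[ℂ] D.B n := (D.leg n i).comp (D.𝔥.incl : D.𝔥 →ₗ[ℂ] 𝔤)

/-- `a ↦ 1 ⊗ a^{(i)}` on `𝔪`. -/
def legM (i : Fin n) : D.𝔪 →ₗ[ℂ] D.B n := (D.leg n i).comp D.𝔪.subtype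

/-- `Ȳ_a = X̄_a ⊗ 1 + 1 ⊗ ∑_i a^{(i)}`. -/
def Y (a : D.𝔥) : D.B n := D.op n (D.XOp a) + ∑ i, D.legH n i a

/-- The invariants `(B_n)^𝔥`: `a ∈ 𝔥` acts on `B_n` by the commutator with `Ȳ_a`. -/
def invariants : Subalgebra ℂ (D.B n) := Subalgebra.centralizer ℂ (Set.range (D.Y n))

/-- The left ideal `(B_n 𝔥^diag)^𝔥 = B_n 𝔥^diag ∩ (B_n)^𝔥` of `(B_n)^𝔥`. -/
def diagIdeal : Ideal (D.invariants n) :=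
  (Ideal.span (Set.range (D.Y n))).comap (D.invariants n).val.toRingHom

instance diagIdeal_isTwoSided : (D.diagIdeal n).IsTwoSided where
  mul_mem_of_left {a} b ha := by
    change (a : D.B n) * (b : D.B n) ∈ Ideal.span (Set.range (D.Y n))
    have ha' : (a : D.B n) ∈ Ideal.span (Set.range (D.Y n)) := ha
    generalize (a : D.B n) = a' at ha' ⊢
    induction ha' using Submodule.span_induction with
    | mem y hy =>
      have hb := Subalgebra.mem_centralizer_iff (R := ℂ) |>.1 b.2 y hy
      rw [hb]
      exact Ideal.mul_mem_left _ _ (Ideal.subset_span hy)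
    | zero => rw [zero_mul]; exact Ideal.zero_mem _
    | add u v _ _ hu hv => rw [add_mul]; exact Ideal.add_mem _ hu hv
    | smul c u _ hu => rw [smul_eq_mul, mul_assoc]; exact Ideal.mul_mem_left _ _ hu

/-- The Hecke algebra `H_n(𝔤, 𝔥*_reg) = (B_n)^𝔥 / (B_n 𝔥^diag)^𝔥`, a Lie algebra under the
commutator. -/
def Hecke : Type _ := D.invariants n ⧸ D.diagIdeal n

instance instRingHecke : Ring (D.Hecke n) :=
  inferInstanceAs (Ring (D.invariants n ⧸ D.diagIdeal n))

instance instAlgebraHecke : Algebra ℂ (D.Hecke n) :=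
  inferInstanceAs (Algebra ℂ (D.invariants n ⧸ D.diagIdeal n))

instance instLieRingHecke : LieRing (D.Hecke n) := LieRing.ofAssociativeRing

instance instLieAlgebraHecke : LieAlgebra ℂ (D.Hecke n) := LieAlgebra.ofAssociativeAlgebra

/-- The class of an invariant element of `B_n`. -/
def heckeMk : D.invariants n →ₐ[ℂ] D.Hecke n := Ideal.Quotient.mkₐ ℂ (D.diagIdeal n)

/-- `∑_ν x̄_ν ⊗ e_ν^{(i)}`. -/
def xSum (i : Fin n) : D.B n :=
  tensorMul ((D.op n).toLinearMap.comp D.xOp) (D.legH n i) D.th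

/-- `∑_ν ∂̄_ν ⊗ e_ν^{(i)}`. -/
def dSum (i : Fin n) : D.B n :=
  tensorMul ((D.op n).toLinearMap.comp D.dOp) (D.legH n i) D.th

/-- `r(λ)^{(ij)} = ∑_δ ℓ_δ ⊗ a_δ^{(i)} b_δ^{(j)}` for `r = ∑_δ a_δ ⊗ b_δ ⊗ ℓ_δ`; the factor
`ℓ_δ ⊗ 1` commutes with the factors `1 ⊗ a_δ^{(i)}`. The case `i = j` is allowed. -/
def rLeg (i j : Fin n) : D.B n :=
  tensorMul (D.legM n i)
    (tensorMul ((D.op n).toLinearMap.comp D.fn.toLinearMap) (D.legM n j)) D.rMatrix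

/-- `1 ⊗ (α^{(1)} · t_𝔤)^{(ij)}`. -/
def tLeg (α : Γ) (i j : Fin n) : D.B n :=
  tensorMul ((D.leg n i).comp (E.act α : 𝔤 →ₗ[ℂ] 𝔤)) (D.leg n j) E.t

end ReductiveDecomposition

end

/-! Everything is computed in orthonormal bases `e_ν` of `𝔥` and `m_p` of `𝔪`. Averaging over `Γ`
shows that `t_𝔩` is inverse to the restriction to `𝔩` of the form inverse to `t`. Since `𝔩 = 𝔥 ⊕ 𝔪`,
comparing components makes `𝔥` and `𝔪` orthogonal and `t_𝔥`, `t_𝔪` inverse to the restricted forms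
(`exists_orthonormalFrame`). Then `ad λ^∨` on `𝔪` becomes an antisymmetric matrix `L = ∑ x_ν c_ν` of
determinant `P`, and `r = ∑ G_{qp} m_p ⊗ m_q` with `G = L⁻¹` over `S(𝔥)[1/P]`. The sum over all `k`
in the image of `y_i`, with `k = i` included, turns the second leg of `r` into the diagonal element
`tot m_q`.

The relations with `t_{ij}^α` express the invariance of `t` (`commute_tLeg`). For `[x_i, y_j]`, the
derivatives give the `𝔥` part and `L G = 1` gives the `𝔪` part of `t_𝔩^{(ij)}`, which is the average
over `Γ` of the `t_{ij}^α`. The factor `M N = |Γ|` removes the denominator (`xSum_yv`).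

The substantial relation is `[y_i, y_j] = 0` (`yv_comm_mem`). Terms with one `e`, one `m` and one
`tot m` cancel by `∂_ν G = -G c_ν G`. Terms in three elements of `𝔪` cancel by a Yang-Baxter
identity, obtained by contracting the `𝔥`-invariance of the structure constants of `𝔪` with three
copies of `G` (`dynamical_yangBaxter`). Terms containing `tot e_ν` vanish only in the quotient:
modulo `Ȳ` they become differential operators, which cancel the remaining derivative terms by
equivariance of `G` (`rot_G`).

The sums of the `x_i` and of the `y_i` lie in the left ideal of the `Ȳ_a` (`sum_xSum_mem`,
`sum_yv_mem`). This also yields the formula for `[x_i, y_i]` from those for `[x_i, y_j]`, `j ≠ i`,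
without a separate computation. -/

noncomputable section

/-! ### Tensors as maps from the dual, and orthonormal bases -/

section Tensors

variable {V : Type*} [AddCommGroup V] [Module ℂ V]

@[simp]
theorem tensorSharp_tmul (a b : V) (l : Module.Dual ℂ V) :
    tensorSharp (a ⊗ₜ[ℂ] b) l = l a • b := by
  simp [tensorSharp, TensorProduct.mapBilinear]

theorem tensorSharp_add (s t : V ⊗[ℂ] V) : tensorSharp (s + t) = tensorSharp s + tensorSharp t := by
  ext l; simp [tensorSharp]

theorem tensorSharp_map {W : Type*} [AddCommGroup W] [Module ℂ W] (f g : V →ₗ[ℂ] W)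
    (t : V ⊗[ℂ] V) (l : Module.Dual ℂ W) :
    tensorSharp (TensorProduct.map f g t) l = g (tensorSharp t (l ∘ₗ f)) := by
  induction t with
  | zero => simp [tensorSharp]
  | tmul a b => simp
  | add s t hs ht => simp only [map_add, tensorSharp_add, LinearMap.add_apply, hs, ht]

@[simp]
theorem tensorSharp_zero : tensorSharp (0 : V ⊗[ℂ] V) = 0 := by
  ext l; simp [tensorSharp]

theorem apply_tensorSharp_comm (t : V ⊗[ℂ] V) (l l' : Module.Dual ℂ V) :
    l' (tensorSharp (TensorProduct.comm ℂ V V t) l) = l (tensorSharp t l') := by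
  induction t with
  | zero => simp
  | tmul a b => simp [mul_comm]
  | add s t hs ht => simp only [map_add, tensorSharp_add, LinearMap.add_apply, hs, ht]

/-- A tensor is a finite sum of pure tensors, so the second legs span every value. With surjectivity
this makes a space carrying a nondegenerate tensor finite-dimensional, which is why finiteness need
not be assumed. -/
theorem tensorSharp_mem_range (t : V ⊗[ℂ] V) :
    ∃ S : Finset V, ∀ l, tensorSharp t l ∈ Submodule.span ℂ (S : Set V) := by
  classical
  induction t with
  | zero => exact ⟨∅, by simp⟩
  | tmul a b =>
    exact ⟨{b}, fun l => by
      rw [tensorSharp_tmul]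
      exact Submodule.smul_mem _ _ (Submodule.subset_span (by simp))⟩
  | add s t hs ht =>
    obtain ⟨S, hS⟩ := hs
    obtain ⟨T, hT⟩ := ht
    refine ⟨S ∪ T, fun l => ?_⟩
    rw [tensorSharp_add, LinearMap.add_apply]
    exact Submodule.add_mem _
      (Submodule.span_mono (by simp) (hS l)) (Submodule.span_mono (by simp) (hT l))

theorem finite_of_tensorSharp_surjective (t : V ⊗[ℂ] V)
    (ht : Function.Surjective (tensorSharp t)) : Module.Finite ℂ V := by
  obtain ⟨S, hS⟩ := tensorSharp_mem_range t
  refine ⟨⟨S, ?_⟩⟩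
  rw [eq_top_iff]
  rintro v -
  obtain ⟨l, rfl⟩ := ht v
  exact hS l

/-- A nondegenerate symmetric form over `ℂ` has an orthonormal basis. -/
theorem exists_orthonormal_basis_of_symmetric [FiniteDimensional ℂ V]
    (k : V →ₗ[ℂ] V →ₗ[ℂ] ℂ) (hk : ∀ u v, k u v = k v u) (hinj : ∀ u, (∀ v, k u v = 0) → u = 0) :
    ∃ (n : ℕ) (b : Module.Basis (Fin n) ℂ V), ∀ i j, k (b i) (b j) = if i = j then 1 else 0 := by
  obtain ⟨v, hv⟩ := LinearMap.BilinForm.exists_orthogonal_basis (B := k) ⟨fun u v => hk u v⟩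
  have hne : ∀ i, k (v i) (v i) ≠ 0 := by
    intro i h
    have : v i = 0 := by
      refine hinj _ fun w => ?_
      have : k (v i) = 0 := by
        refine v.ext fun j => ?_
        by_cases hij : i = j
        · subst hij; simpa using h
        · simpa using hv hij
      rw [this]; rfl
    exact v.ne_zero i this
  -- Square roots of the inverse norms exist over `ℂ`; rescaling by them normalizes the orthogonal
  -- basis.
  choose s hs using fun i => IsAlgClosed.exists_eq_mul_self ((k (v i) (v i))⁻¹)
  have hs0 : ∀ i, IsUnit (s i) := fun i => by
    rw [isUnit_iff_ne_zero]
    intro h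
    have := hs i
    rw [h, zero_mul, inv_eq_zero] at this
    exact hne i this
  refine ⟨_, v.isUnitSMul hs0, fun i j => ?_⟩
  rw [Module.Basis.isUnitSMul_apply, Module.Basis.isUnitSMul_apply]
  simp only [map_smul, LinearMap.smul_apply, smul_eq_mul]
  by_cases hij : i = j
  · subst hij
    rw [if_pos rfl, ← mul_assoc, ← hs i, inv_mul_cancel₀ (hne i)]
  · rw [if_neg hij]
    have : k (v i) (v j) = 0 := hv hij
    rw [this, mul_zero, mul_zero]

/-- A tensor that is inverse to a symmetric form is `∑ bᵢ ⊗ bᵢ` for an orthonormal basis. -/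
theorem exists_basis_tensor_eq [FiniteDimensional ℂ V] (t : V ⊗[ℂ] V)
    (k : V →ₗ[ℂ] V →ₗ[ℂ] ℂ) (hk : ∀ u v, k u v = k v u) (ht : ∀ u, tensorSharp t (k u) = u) :
    ∃ (n : ℕ) (b : Module.Basis (Fin n) ℂ V), (∀ i j, k (b i) (b j) = if i = j then 1 else 0) ∧
      t = ∑ i, b i ⊗ₜ[ℂ] b i := by
  obtain ⟨n, b, hb⟩ := exists_orthonormal_basis_of_symmetric k hk (fun u hu => by
    rw [← ht u, show k u = 0 from LinearMap.ext hu, map_zero])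
  refine ⟨n, b, hb, ?_⟩
  have hsum := (b.tensorProduct b).sum_repr t
  rw [Fintype.sum_prod_type] at hsum
  set c : Fin n → Fin n → ℂ := fun i j => (b.tensorProduct b).repr t (i, j) with hc
  have hsum' : t = ∑ i, ∑ j, c i j • (b i ⊗ₜ[ℂ] b j) := by
    rw [← hsum]; simp [hc]
  -- Contracting `t` with the form at `b s` picks out row `s` of its coefficient matrix and must
  -- return `b s`, so that matrix is the identity.
  have hsharp : ∀ s, b s = ∑ j, c s j • b j := by
    intro s
    conv_lhs => rw [← ht (b s), hsum']
    have : ∀ (l : Module.Dual ℂ V), tensorSharp (∑ i, ∑ j, c i j • (b i ⊗ₜ[ℂ] b j)) l =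
        ∑ i, ∑ j, c i j • l (b i) • b j := by
      intro l
      have hlin : ∀ u : V ⊗[ℂ] V, tensorSharp u l = (TensorProduct.lid ℂ V)
        (TensorProduct.map l LinearMap.id u) := by intro u; simp [tensorSharp]
      simp [hlin, smul_smul]
    rw [this]
    simp [hb]
  have hcd : ∀ s j, c s j = if s = j then 1 else 0 := by
    intro s j
    have := congrArg (fun v => b.repr v j) (hsharp s)
    simp only [map_sum, map_smul, Module.Basis.repr_self, Finsupp.coe_finsetSum,
      Finset.sum_apply, Finsupp.coe_smul, Pi.smul_apply, smul_eq_mul, Finsupp.single_apply] at this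
    simpa [eq_comm] using this.symm
  rw [hsum']
  simp [hcd]

end Tensors

/-! ### The invariant form on `𝔤` and averaging over `Γ` -/

namespace EquivariantTensor

variable {Γ : Type*} [AddCommGroup Γ] {𝔤 : Type*} [LieRing 𝔤] [LieAlgebra ℂ 𝔤]
variable (E : EquivariantTensor Γ 𝔤)

theorem finite (E : EquivariantTensor Γ 𝔤) : Module.Finite ℂ 𝔤 := finite_of_tensorSharp_surjective E.t E.t_nondeg.2

/-- The pairing on `𝔤` inverse to `t`. -/
def form : 𝔤 →ₗ[ℂ] 𝔤 →ₗ[ℂ] ℂ := (LinearEquiv.ofBijective (tensorSharp E.t) E.t_nondeg).symm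

@[simp]
theorem tensorSharp_form (u : 𝔤) : tensorSharp E.t (E.form u) = u :=
  (LinearEquiv.ofBijective (tensorSharp E.t) E.t_nondeg).apply_symm_apply u

theorem form_symm (u v : 𝔤) : E.form u v = E.form v u := by
  have := apply_tensorSharp_comm E.t (E.form v) (E.form u)
  rw [E.t_symm, E.tensorSharp_form, E.tensorSharp_form] at this
  exact this

theorem lie_tensor (a : 𝔤) (t : 𝔤 ⊗[ℂ] 𝔤) (l : Module.Dual ℂ 𝔤) :
    tensorSharp ⁅a, t⁆ l =
      tensorSharp t (l ∘ₗ (LieAlgebra.ad ℂ 𝔤 a : 𝔤 →ₗ[ℂ] 𝔤)) + ⁅a, tensorSharp t l⁆ := by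
  induction t with
  | zero => simp
  | tmul u v => simp [TensorProduct.LieModule.lie_tmul_right, tensorSharp_add]
  | add s t hs ht =>
    simp only [lie_add, tensorSharp_add, LinearMap.add_apply, hs, ht]; abel

/-- Invariance of `t` passes to the inverse form: by `lie_tensor` the functionals `form u ∘ ad a`
and `-form ⁅a, u⁆` have the same image under `tensorSharp E.t`, which is injective. -/
theorem form_lie (a u v : 𝔤) : E.form ⁅a, u⁆ v = - E.form u ⁅a, v⁆ := by
  have h := lie_tensor a E.t (E.form u)
  rw [E.t_inv, E.tensorSharp_form] at h
  have h2 : E.form u ∘ₗ (LieAlgebra.ad ℂ 𝔤 a : 𝔤 →ₗ[ℂ] 𝔤) = - E.form ⁅a, u⁆ := by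
    apply E.t_nondeg.1
    rw [map_neg, E.tensorSharp_form]
    simp only [tensorSharp_zero, LinearMap.zero_apply] at h
    exact eq_neg_of_add_eq_zero_left h.symm
  have := LinearMap.congr_fun h2 v
  simp only [LinearMap.comp_apply, LinearMap.neg_apply] at this
  rw [eq_neg_iff_add_eq_zero]
  rw [← neg_eq_iff_eq_neg] at this
  rw [← this]
  exact neg_add_cancel _

theorem form_lie_rotate (u v w : 𝔤) : E.form ⁅u, v⁆ w = E.form ⁅v, w⁆ u := by
  rw [E.form_symm ⁅v, w⁆ u, ← lie_skew, map_neg, LinearMap.neg_apply, E.form_lie, neg_neg]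

theorem form_lie_swap (u v w : 𝔤) : E.form ⁅u, v⁆ w = - E.form ⁅v, u⁆ w := by
  rw [← lie_skew, map_neg, LinearMap.neg_apply]

theorem map_act_left (α : Γ) :
    TensorProduct.map (E.act α : 𝔤 →ₗ[ℂ] 𝔤) LinearMap.id E.t =
      TensorProduct.map LinearMap.id (E.act (-α) : 𝔤 →ₗ[ℂ] 𝔤) E.t := by
  conv_rhs => rw [← E.act_t α]
  rw [← LinearMap.comp_apply, ← TensorProduct.map_comp]
  congr 2
  ext a
  change a = E.act (-α) (E.act α a)
  rw [← E.act_add, neg_add_cancel, E.act_zero]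

/-- Factoring out `act β ⊗ act β`, which fixes `t`, leaves a tensor depending only on `α - β`. The
double average defining `t_𝔩` thus reduces to a single one. -/
theorem map_act_act (α β : Γ) :
    TensorProduct.map (E.act α : 𝔤 →ₗ[ℂ] 𝔤) (E.act β : 𝔤 →ₗ[ℂ] 𝔤) E.t =
      TensorProduct.map (E.act (α - β) : 𝔤 →ₗ[ℂ] 𝔤) LinearMap.id E.t := by
  have h : (E.act α : 𝔤 →ₗ[ℂ] 𝔤) =
      (E.act (α - β) : 𝔤 →ₗ[ℂ] 𝔤) ∘ₗ (E.act β : 𝔤 →ₗ[ℂ] 𝔤) := by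
    ext a
    change E.act α a = E.act (α - β) (E.act β a)
    rw [← E.act_add, sub_add_cancel]
  have h2 : (E.act β : 𝔤 →ₗ[ℂ] 𝔤) = LinearMap.id ∘ₗ (E.act β : 𝔤 →ₗ[ℂ] 𝔤) := rfl
  rw [h]
  conv_lhs => rw [h2]
  rw [TensorProduct.map_comp, LinearMap.comp_apply]
  exact congrArg _ (E.act_t β)

variable [Fintype Γ]

theorem proj_apply (a : 𝔤) : E.proj a = (Fintype.card Γ : ℂ)⁻¹ • ∑ α, E.act α a := by
  simp [proj, LinearMap.sum_apply]

theorem proj_of_mem {a : 𝔤} (ha : a ∈ E.fixed) : E.proj a = a := by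
  have h : ∀ α, E.act α a = a := ha
  have hc : (Fintype.card Γ : ℂ) ≠ 0 := by simp
  rw [proj_apply]
  simp only [h, Finset.sum_const, Finset.card_univ, ← Nat.cast_smul_eq_nsmul ℂ]
  rw [smul_smul, inv_mul_cancel₀ hc, one_smul]

/-- `t_𝔩` is the average over `Γ` of `(α ⊗ id)(t)`. -/
theorem tFixed_eq :
    E.tFixed = (Fintype.card Γ : ℂ)⁻¹ •
      ∑ α, TensorProduct.map (E.act α : 𝔤 →ₗ[ℂ] 𝔤) LinearMap.id E.t := by
  have hc : (Fintype.card Γ : ℂ) ≠ 0 := by simp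
  have h1 : E.tFixed = ((Fintype.card Γ : ℂ)⁻¹ * (Fintype.card Γ : ℂ)⁻¹) •
      ∑ β : Γ, ∑ α : Γ, TensorProduct.map (E.act α : 𝔤 →ₗ[ℂ] 𝔤) (E.act β : 𝔤 →ₗ[ℂ] 𝔤) E.t := by
    have : ∀ t : 𝔤 ⊗[ℂ] 𝔤, TensorProduct.map E.proj E.proj t =
        ((Fintype.card Γ : ℂ)⁻¹ * (Fintype.card Γ : ℂ)⁻¹) •
      ∑ β : Γ, ∑ α : Γ, TensorProduct.map (E.act α : 𝔤 →ₗ[ℂ] 𝔤) (E.act β : 𝔤 →ₗ[ℂ] 𝔤) t := by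
      intro t
      induction t with
      | zero => simp
      | tmul a b =>
        simp only [TensorProduct.map_tmul, proj_apply, TensorProduct.smul_tmul_smul,
          TensorProduct.sum_tmul, TensorProduct.tmul_sum]
        rfl
      | add s t hs ht =>
        rw [map_add, hs, ht]
        simp only [map_add, Finset.sum_add_distrib, smul_add]
    exact this E.t
  rw [h1]
  have h2 : ∀ β : Γ, ∑ α : Γ, TensorProduct.map (E.act α : 𝔤 →ₗ[ℂ] 𝔤) (E.act β : 𝔤 →ₗ[ℂ] 𝔤) E.t =
      ∑ α, TensorProduct.map (E.act α : 𝔤 →ₗ[ℂ] 𝔤) LinearMap.id E.t := by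
    intro β
    simp only [map_act_act]
    exact Fintype.sum_equiv (Equiv.subRight β) _ _ (fun α => rfl)
  simp only [h2, Finset.sum_const, Finset.card_univ, ← Nat.cast_smul_eq_nsmul ℂ]
  rw [smul_smul, mul_assoc, inv_mul_cancel₀ hc, mul_one]

theorem tFixed_eq_map_proj : E.tFixed = TensorProduct.map LinearMap.id E.proj E.t := by
  rw [tFixed_eq]
  simp only [map_act_left]
  have : ∀ t : 𝔤 ⊗[ℂ] 𝔤, TensorProduct.map LinearMap.id E.proj t =
        (Fintype.card Γ : ℂ)⁻¹ •
      ∑ α : Γ, TensorProduct.map LinearMap.id (E.act α : 𝔤 →ₗ[ℂ] 𝔤) t := by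
    intro t
    induction t with
    | zero => simp
    | tmul a b =>
      simp only [TensorProduct.map_tmul, proj_apply, TensorProduct.tmul_smul,
        TensorProduct.tmul_sum]
      rfl
    | add s t hs ht =>
      rw [map_add, hs, ht]
      simp only [map_add, Finset.sum_add_distrib, smul_add]
  rw [this]
  congr 1
  exact Fintype.sum_equiv (Equiv.neg Γ) _ _ (fun α => rfl)

/-- Projecting one leg is enough to get `t_𝔩`, and the projection fixes `u`. So `t_𝔩` inverts the
form restricted to `𝔩`. -/
theorem tensorSharp_tFixed {u : 𝔤} (hu : u ∈ E.fixed) : tensorSharp E.tFixed (E.form u) = u := by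
  rw [tFixed_eq_map_proj, tensorSharp_map, LinearMap.comp_id, E.tensorSharp_form,
    E.proj_of_mem hu]

end EquivariantTensor

/-! ### Orthonormal frames adapted to `𝔩 = 𝔥 ⊕ 𝔪` -/

/-- Orthonormal bases of `𝔥` and `𝔪` adapted to the tensors `t_𝔥` and `t_𝔪`. -/
structure OrthonormalFrame {Γ : Type*} [AddCommGroup Γ] [Fintype Γ] {𝔤 : Type*}
    [LieRing 𝔤] [LieAlgebra ℂ 𝔤] {E : EquivariantTensor Γ 𝔤} (D : ReductiveDecomposition E) where
  dimH : ℕ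
  dimM : ℕ
  e : Module.Basis (Fin dimH) ℂ D.𝔥
  m : Module.Basis (Fin dimM) ℂ D.𝔪
  form_ee : ∀ i j, E.form (e i) (e j) = if i = j then 1 else 0
  form_mm : ∀ i j, E.form (m i) (m j) = if i = j then 1 else 0
  form_hm : ∀ (a : D.𝔥) (b : D.𝔪), E.form a b = 0
  th_eq : D.th = ∑ i, e i ⊗ₜ[ℂ] e i
  tm_eq : D.tm = ∑ i, m i ⊗ₜ[ℂ] m i
  pairing : ∀ a b, tensorPairing D.th a b = E.form a b
  expand : ∀ u ∈ E.fixed,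
    u = ∑ i, E.form u (e i) • (e i : 𝔤) + ∑ i, E.form u (m i) • (m i : 𝔤)

namespace ReductiveDecomposition

variable {Γ : Type*} [AddCommGroup Γ] [Fintype Γ] {𝔤 : Type*} [LieRing 𝔤] [LieAlgebra ℂ 𝔤]
variable {E : EquivariantTensor Γ 𝔤} (D : ReductiveDecomposition E)

theorem h_le (a : D.𝔥) : (a : 𝔤) ∈ E.fixed :=
  D.span.le ((le_sup_left : D.𝔥.toSubmodule ≤ D.𝔥.toSubmodule ⊔ D.𝔪) a.2)

theorem m_le (a : D.𝔪) : (a : 𝔤) ∈ E.fixed :=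
  D.span.le ((le_sup_right : D.𝔪 ≤ D.𝔥.toSubmodule ⊔ D.𝔪) a.2)

theorem eq_zero_of_add_eq_zero (a : D.𝔥) (b : D.𝔪) (h : (a : 𝔤) + b = 0) : a = 0 ∧ b = 0 := by
  have ha : (a : 𝔤) ∈ D.𝔥.toSubmodule ⊓ D.𝔪 := by
    refine ⟨a.2, ?_⟩
    rw [eq_neg_of_add_eq_zero_left h]
    exact D.𝔪.neg_mem b.2
  rw [D.disjoint, Submodule.mem_bot] at ha
  rw [ha, zero_add] at h
  exact ⟨Subtype.ext ha, Subtype.ext h⟩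

theorem sharp_split {u : 𝔤} (hu : u ∈ E.fixed) :
    u = (tensorSharp D.th (E.form u ∘ₗ (D.𝔥.incl : D.𝔥 →ₗ[ℂ] 𝔤)) : 𝔤) +
      (tensorSharp D.tm (E.form u ∘ₗ D.𝔪.subtype) : 𝔤) := by
  conv_lhs => rw [← E.tensorSharp_tFixed hu, ← D.sum_eq, tensorSharp_add, LinearMap.add_apply,
    tensorSharp_map, tensorSharp_map]
  rfl

/-- The components of `u` supplied by `sharp_split` are unique because the sum is direct. Taking `u`
in `𝔥` and in `𝔪` shows that `t_𝔥` and `t_𝔪` are separately inverse to the restricted forms, and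
that `𝔥` is orthogonal to `𝔪`. -/
theorem exists_orthonormalFrame : Nonempty (OrthonormalFrame D) := by
  have hfin := E.finite
  have hfm : Module.Finite ℂ D.𝔪 := inferInstance
  have hfh : Module.Finite ℂ D.𝔥 := inferInstanceAs (Module.Finite ℂ D.𝔥.toSubmodule)
  have hh : ∀ a : D.𝔥,
      tensorSharp D.th (E.form a ∘ₗ (D.𝔥.incl : D.𝔥 →ₗ[ℂ] 𝔤)) = a ∧
      tensorSharp D.tm (E.form a ∘ₗ D.𝔪.subtype) = 0 := by
    intro a
    have := D.sharp_split (D.h_le a)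
    have h := D.eq_zero_of_add_eq_zero
      (tensorSharp D.th (E.form a ∘ₗ (D.𝔥.incl : D.𝔥 →ₗ[ℂ] 𝔤)) - a)
      (tensorSharp D.tm (E.form a ∘ₗ D.𝔪.subtype)) (by
        rw [AddSubgroupClass.coe_sub]
        nth_rw 2 [this]
        abel)
    exact ⟨sub_eq_zero.1 h.1, h.2⟩
  have hm : ∀ a : D.𝔪, tensorSharp D.tm (E.form a ∘ₗ D.𝔪.subtype) = a := by
    intro a
    have := D.sharp_split (D.m_le a)
    have h := D.eq_zero_of_add_eq_zero
      (tensorSharp D.th (E.form a ∘ₗ (D.𝔥.incl : D.𝔥 →ₗ[ℂ] 𝔤)))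
      (tensorSharp D.tm (E.form a ∘ₗ D.𝔪.subtype) - a) (by
        rw [AddSubgroupClass.coe_sub]
        nth_rw 3 [this]
        abel)
    exact sub_eq_zero.1 h.2
  obtain ⟨p, e, he, hte⟩ := exists_basis_tensor_eq D.th
    (E.form.compl₁₂ (D.𝔥.incl : D.𝔥 →ₗ[ℂ] 𝔤) (D.𝔥.incl : D.𝔥 →ₗ[ℂ] 𝔤))
    (fun u v => E.form_symm _ _) (fun a => (hh a).1)
  obtain ⟨q, m, hmm, htm⟩ := exists_basis_tensor_eq D.tm
    (E.form.compl₁₂ D.𝔪.subtype D.𝔪.subtype)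
    (fun u v => E.form_symm _ _) (fun a => hm a)
  have hsh : ∀ l, tensorSharp D.th l = ∑ i, l (e i) • e i := by
    intro l
    have hlin : ∀ u : D.𝔥 ⊗[ℂ] D.𝔥, tensorSharp u l = (TensorProduct.lid ℂ _)
        (TensorProduct.map l LinearMap.id u) := by intro u; simp [tensorSharp]
    rw [hlin, hte]; simp
  have hsm : ∀ l, tensorSharp D.tm l = ∑ i, l (m i) • m i := by
    intro l
    have hlin : ∀ u : D.𝔪 ⊗[ℂ] D.𝔪, tensorSharp u l = (TensorProduct.lid ℂ _)
        (TensorProduct.map l LinearMap.id u) := by intro u; simp [tensorSharp]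
    rw [hlin, htm]; simp
  -- This excludes the default value `0` of `tensorPairing`, so the pairing in `Diff` is the form
  -- restricted to `𝔥`.
  have hbij : Function.Bijective (tensorSharp D.th) := by
    have hs : Function.Surjective (tensorSharp D.th) := fun a => ⟨_, (hh a).1⟩
    exact ⟨(LinearMap.injective_iff_surjective_of_finrank_eq_finrank
      (by simp [Subspace.dual_finrank_eq])).2 hs, hs⟩
  refine ⟨⟨p, q, e, m, he, hmm, ?_, hte, htm, ?_, ?_⟩⟩
  · intro a b
    have h0 := (hh a).2
    rw [hsm] at h0
    have h1 : E.form a ∘ₗ D.𝔪.subtype = 0 := by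
      refine m.ext fun i => ?_
      have := congrArg (fun v => m.repr v i) h0
      simpa [Finsupp.single_apply] using this
    exact LinearMap.congr_fun h1 b
  · intro a b
    rw [tensorPairing, dif_pos hbij]
    have : (LinearEquiv.ofBijective (tensorSharp D.th) hbij).symm a =
        E.form a ∘ₗ (D.𝔥.incl : D.𝔥 →ₗ[ℂ] 𝔤) := by
      rw [LinearEquiv.symm_apply_eq]
      exact (hh a).1.symm
    exact LinearMap.congr_fun this b
  · intro u hu
    conv_lhs => rw [D.sharp_split hu, hsh, hsm]
    simp only [AddSubmonoidClass.coe_finsetSum]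
    rfl

end ReductiveDecomposition

/-! ### Structure constants, the matrix of `ad λ^∨` and its inverse -/

namespace OrthonormalFrame

variable {Γ : Type*} [AddCommGroup Γ] [Fintype Γ] {𝔤 : Type*} [LieRing 𝔤] [LieAlgebra ℂ 𝔤]
variable {E : EquivariantTensor Γ 𝔤} {D : ReductiveDecomposition E} (S : OrthonormalFrame D)

/-- The matrix of `ad(e_ν)` on `𝔪`. -/
def c (ν : Fin S.dimH) : Matrix (Fin S.dimM) (Fin S.dimM) ℂ :=
  Matrix.of fun q p => E.form ⁅(S.e ν : 𝔤), (S.m p : 𝔤)⁆ (S.m q)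

/-- The structure constants `([m_p, m_q], m_s)`. -/
def φ (p q s : Fin S.dimM) : ℂ := E.form ⁅(S.m p : 𝔤), (S.m q : 𝔤)⁆ (S.m s)

/-- The structure constants `([e_ν, e_μ], e_κ)`. -/
def f (ν μ κ : Fin S.dimH) : ℂ := E.form ⁅(S.e ν : 𝔤), (S.e μ : 𝔤)⁆ (S.e κ)

theorem c_apply (ν q p) : S.c ν q p = E.form ⁅(S.e ν : 𝔤), (S.m p : 𝔤)⁆ (S.m q) := rfl

theorem c_swap (ν q p) : S.c ν q p = - S.c ν p q := by
  rw [c_apply, c_apply, E.form_lie, E.form_symm]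

theorem φ_swap (p q s) : S.φ p q s = - S.φ q p s := E.form_lie_swap _ _ _

theorem φ_rotate (p q s) : S.φ p q s = S.φ q s p := E.form_lie_rotate _ _ _

theorem f_swap (p q s) : S.f p q s = - S.f q p s := E.form_lie_swap _ _ _

theorem f_rotate (p q s) : S.f p q s = S.f q s p := E.form_lie_rotate _ _ _

theorem lie_e_m (ν p) : ⁅(S.e ν : 𝔤), (S.m p : 𝔤)⁆ = ∑ q, S.c ν q p • (S.m q : 𝔤) := by
  have h := S.expand ⁅(S.e ν : 𝔤), (S.m p : 𝔤)⁆ (D.m_le ⟨_, D.lie_mem _ (S.e ν).2 _ (S.m p).2⟩)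
  have h0 : ∀ i, E.form ⁅(S.e ν : 𝔤), (S.m p : 𝔤)⁆ (S.e i) = 0 := fun i => by
    rw [E.form_symm]
    exact S.form_hm _ ⟨_, D.lie_mem _ (S.e ν).2 _ (S.m p).2⟩
  simp only [h0, zero_smul, Finset.sum_const_zero, zero_add] at h
  exact h

theorem lie_e_e (ν μ) : ⁅(S.e ν : 𝔤), (S.e μ : 𝔤)⁆ = ∑ k, S.f ν μ k • (S.e k : 𝔤) := by
  have h := S.expand ⁅(S.e ν : 𝔤), (S.e μ : 𝔤)⁆ (D.h_le ⁅S.e ν, S.e μ⁆)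
  have h0 : ∀ i, E.form ⁅(S.e ν : 𝔤), (S.e μ : 𝔤)⁆ (S.m i) = 0 := fun i =>
    S.form_hm ⁅S.e ν, S.e μ⁆ _
  simp only [h0, zero_smul, Finset.sum_const_zero, add_zero] at h
  exact h

theorem lie_e_e' (ν μ) : ⁅S.e ν, S.e μ⁆ = ∑ k, S.f ν μ k • S.e k := by
  apply Subtype.ext
  rw [LieSubalgebra.coe_bracket, S.lie_e_e]
  simp only [AddSubmonoidClass.coe_finsetSum]
  rfl

/-- The `𝔥` component is determined by the action of `𝔥` on `𝔪`: cyclicity of the form turns `([m_p,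
m_q], e_ν)` into an entry of `c ν`, and antisymmetry of `c ν` gives the sign. -/
theorem lie_m_m (p q) : ⁅(S.m p : 𝔤), (S.m q : 𝔤)⁆ =
    ∑ s, S.φ p q s • (S.m s : 𝔤) - ∑ ν, S.c ν p q • (S.e ν : 𝔤) := by
  have h := S.expand ⁅(S.m p : 𝔤), (S.m q : 𝔤)⁆
    (E.fixed.lie_mem (D.m_le (S.m p)) (D.m_le (S.m q)))
  have h0 : ∀ i, E.form ⁅(S.m p : 𝔤), (S.m q : 𝔤)⁆ (S.e i) = - S.c i p q := fun i => by
    rw [c_swap, c_apply, E.form_lie_rotate, E.form_lie_rotate, neg_neg]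
  simp only [h0, neg_smul, Finset.sum_neg_distrib] at h
  rw [h, sub_eq_neg_add]
  rfl

/-- The Jacobi identity: `ad` is a representation of `𝔥` on `𝔪`. -/
theorem c_commutator (ν μ) : ∑ k, S.f ν μ k • S.c k = S.c ν * S.c μ - S.c μ * S.c ν := by
  ext q p
  have h : ⁅⁅(S.e ν : 𝔤), (S.e μ : 𝔤)⁆, (S.m p : 𝔤)⁆ =
      ⁅(S.e ν : 𝔤), ⁅(S.e μ : 𝔤), (S.m p : 𝔤)⁆⁆ - ⁅(S.e μ : 𝔤), ⁅(S.e ν : 𝔤), (S.m p : 𝔤)⁆⁆ := by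
    rw [lie_lie]
  have h2 := congrArg (fun u => E.form u (S.m q)) h
  simp only [S.lie_e_e, S.lie_e_m, sum_lie, smul_lie, lie_sum, lie_smul, map_sub, map_sum,
    map_smul, LinearMap.sub_apply, LinearMap.sum_apply, LinearMap.smul_apply, smul_eq_mul,
    S.form_mm, mul_ite, mul_one, mul_zero, Finset.sum_ite_eq', Finset.mem_univ, if_true] at h2
  simp only [Matrix.sum_apply, Matrix.smul_apply, smul_eq_mul, Matrix.sub_apply, Matrix.mul_apply]
  rw [h2]
  simp only [mul_comm]

/-- The trilinear form `([·,·], ·)` on `𝔪` is invariant under `e_ν`, by the Leibniz rule and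
invariance of the form. -/
theorem φ_invariant (ν p q s) :
    ∑ u, (S.c ν u p * S.φ u q s + S.c ν u q * S.φ p u s + S.c ν u s * S.φ p q u) = 0 := by
  have h : E.form ⁅(S.e ν : 𝔤), ⁅(S.m p : 𝔤), (S.m q : 𝔤)⁆⁆ (S.m s) =
      - E.form ⁅(S.m p : 𝔤), (S.m q : 𝔤)⁆ ⁅(S.e ν : 𝔤), (S.m s : 𝔤)⁆ := E.form_lie _ _ _
  rw [leibniz_lie] at h
  simp only [S.lie_e_m, sum_lie, smul_lie, lie_sum, lie_smul, map_add, map_sum,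
    map_smul, LinearMap.add_apply, LinearMap.sum_apply, LinearMap.smul_apply, smul_eq_mul] at h
  simp only [Finset.sum_add_distrib]
  rw [eq_neg_iff_add_eq_zero] at h
  exact h

/-- The matrix of `ad(λ^∨)` on `𝔪` at an `A`-point of `𝔥*`. -/
def adMatrix (A : Type*) [CommRing A] [Algebra ℂ A] (u : D.𝔥 →ₗ[ℂ] A) :
    Matrix (Fin S.dimM) (Fin S.dimM) A :=
  ∑ ν, u (S.e ν) • (S.c ν).map (algebraMap ℂ A)

theorem adM_m (ν p) : D.adM (S.e ν) (S.m p) = ∑ q, S.c ν q p • S.m q := by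
  apply Subtype.ext
  simp only [AddSubmonoidClass.coe_finsetSum]
  exact S.lie_e_m ν p

theorem genericAd_eq (A : Type*) [CommRing A] [Algebra ℂ A] (u : D.𝔥 →ₗ[ℂ] A) :
    D.genericAd A u = Matrix.toLin (Algebra.TensorProduct.basis A S.m)
      (Algebra.TensorProduct.basis A S.m) (S.adMatrix A u) := by
  refine (Algebra.TensorProduct.basis A S.m).ext fun p => ?_
  rw [Matrix.toLin_self]
  simp only [ReductiveDecomposition.genericAd, S.th_eq, map_sum, TensorProduct.lift.tmul,
    LinearMap.mk₂_apply, LinearMap.sum_apply, LinearMap.smul_apply, Algebra.TensorProduct.basis_apply,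
    LinearMap.baseChange_tmul, S.adM_m, TensorProduct.tmul_sum, adMatrix, Matrix.sum_apply,
    Matrix.smul_apply, Matrix.map_apply, Finset.smul_sum, Finset.sum_smul]
  rw [Finset.sum_comm]
  refine Finset.sum_congr rfl fun q _ => Finset.sum_congr rfl fun ν _ => ?_
  rw [smul_eq_mul, mul_smul, algebraMap_smul, TensorProduct.tmul_smul]

/-- The matrix of `ad(λ^∨)` on `𝔪` over `S(𝔥)[1/P]`. -/
def L : Matrix (Fin S.dimM) (Fin S.dimM) D.RegFun := S.adMatrix D.RegFun D.coord

/-- The inverse of `ad(λ^∨)` on `𝔪`. -/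
def G : Matrix (Fin S.dimM) (Fin S.dimM) D.RegFun := S.L⁻¹

theorem L_eq : S.L = ∑ ν, D.coord (S.e ν) • (S.c ν).map (algebraMap ℂ D.RegFun) := rfl

/-- `L` is the image in the localization of the matrix over `S(𝔥)` whose determinant is `P`, and `P`
has been inverted. -/
theorem isUnit_det_L : IsUnit S.L.det := by
  have h : S.L = (algebraMap (SymmetricAlgebra ℂ D.𝔥) D.RegFun).mapMatrix
      (S.adMatrix (SymmetricAlgebra ℂ D.𝔥) (SymmetricAlgebra.ι ℂ D.𝔥)) := by
    rw [L, adMatrix, adMatrix, map_sum]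
    refine Finset.sum_congr rfl fun ν _ => ?_
    ext q p
    simp only [Matrix.smul_apply, Matrix.map_apply, RingHom.mapMatrix_apply, smul_eq_mul, map_mul,
      ← IsScalarTower.algebraMap_apply]
    rfl
  have hP : D.P = (S.adMatrix (SymmetricAlgebra ℂ D.𝔥) (SymmetricAlgebra.ι ℂ D.𝔥)).det := by
    rw [ReductiveDecomposition.P, S.genericAd_eq, LinearMap.det_toLin]
  rw [h, ← RingHom.map_det, ← hP]
  exact IsLocalization.Away.algebraMap_isUnit D.P

theorem L_mul_G : S.L * S.G = 1 := Matrix.mul_nonsing_inv _ S.isUnit_det_L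

theorem G_mul_L : S.G * S.L = 1 := Matrix.nonsing_inv_mul _ S.isUnit_det_L

theorem L_transpose : S.L.transpose = - S.L := by
  rw [L_eq, Matrix.transpose_sum, ← Finset.sum_neg_distrib]
  refine Finset.sum_congr rfl fun ν _ => ?_
  ext q p
  simp only [Matrix.transpose_apply, Matrix.smul_apply, Matrix.map_apply, Matrix.neg_apply]
  rw [S.c_swap, map_neg, smul_neg]

theorem G_transpose : S.G.transpose = - S.G := by
  have h : S.L * (-S.G.transpose) = 1 := by
    have := congrArg Matrix.transpose S.G_mul_L
    rw [Matrix.transpose_mul, S.L_transpose, Matrix.transpose_one] at this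
    rw [Matrix.mul_neg, ← Matrix.neg_mul, this]
  have h2 : -S.G.transpose = S.G := by
    rw [← one_mul (-S.G.transpose), ← S.G_mul_L, mul_assoc, h, mul_one]
  rw [← h2, neg_neg, h2]

theorem G_swap (p q) : S.G p q = - S.G q p := congrFun (congrFun S.G_transpose q) p

/-- `G` is a two-sided inverse, so `Ring.inverse` takes its genuine value here. The order of indices
in `S.G q p` comes from applying the matrix to the `p`-th basis vector. -/
theorem rMatrix_eq :
    D.rMatrix = ∑ p, ∑ q, S.m p ⊗ₜ[ℂ] (S.G q p ⊗ₜ[ℂ] S.m q) := by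
  have h : Ring.inverse (D.genericAd D.RegFun D.coord) =
      Matrix.toLin (Algebra.TensorProduct.basis D.RegFun S.m)
      (Algebra.TensorProduct.basis D.RegFun S.m) S.G := by
    have h1 : D.genericAd D.RegFun D.coord * Matrix.toLin (Algebra.TensorProduct.basis D.RegFun S.m)
      (Algebra.TensorProduct.basis D.RegFun S.m) S.G = 1 := by
      rw [S.genericAd_eq, Module.End.mul_eq_comp, ← Matrix.toLin_mul, ← L, L_mul_G,
        Matrix.toLin_one]
      rfl
    have h2 : Matrix.toLin (Algebra.TensorProduct.basis D.RegFun S.m)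
      (Algebra.TensorProduct.basis D.RegFun S.m) S.G * D.genericAd D.RegFun D.coord = 1 := by
      rw [S.genericAd_eq, Module.End.mul_eq_comp, ← Matrix.toLin_mul, ← L, G_mul_L,
        Matrix.toLin_one]
      rfl
    exact Ring.inverse_unit ⟨_, _, h1, h2⟩
  rw [ReductiveDecomposition.rMatrix, S.tm_eq, h, map_sum]
  refine Finset.sum_congr rfl fun p _ => ?_
  rw [TensorProduct.map_tmul, LinearMap.id_apply, ← TensorProduct.tmul_sum]
  congr 1
  change Matrix.toLin (Algebra.TensorProduct.basis D.RegFun S.m)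
      (Algebra.TensorProduct.basis D.RegFun S.m) S.G ((1 : D.RegFun) ⊗ₜ[ℂ] S.m p) = _
  rw [← Algebra.TensorProduct.basis_apply, Matrix.toLin_self]
  refine Finset.sum_congr rfl fun q _ => ?_
  rw [Algebra.TensorProduct.basis_apply, TensorProduct.smul_tmul', smul_eq_mul, mul_one]

end OrthonormalFrame

/-! ### Commuting derivatives past functions in `Diff(𝔥*_reg)` -/

namespace ReductiveDecomposition

variable {Γ : Type*} [AddCommGroup Γ] [Fintype Γ] {𝔤 : Type*} [LieRing 𝔤] [LieAlgebra ℂ 𝔤]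
variable {E : EquivariantTensor Γ 𝔤} (D : ReductiveDecomposition E)

/-- A linear form on `𝔥` extends to a derivation of `S(𝔥)[1/P]`. -/
theorem exists_derivation (l : D.𝔥 →ₗ[ℂ] ℂ) :
    ∃ d : Derivation ℂ D.RegFun D.RegFun, ∀ a, d (D.coord a) = algebraMap ℂ _ (l a) := by
  -- A derivation is the `ε`-part of an algebra morphism `r ↦ r + ε d(r)` into the dual numbers. On
  -- `S(𝔥)` such a morphism is free to choose on generators.
  let T := TrivSqZeroExt D.RegFun D.RegFun
  let g : D.𝔥 →ₗ[ℂ] T :=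
    (TrivSqZeroExt.inlAlgHom ℂ D.RegFun D.RegFun).toLinearMap ∘ₗ D.coord +
      (TrivSqZeroExt.inrHom D.RegFun D.RegFun).restrictScalars ℂ ∘ₗ
        Algebra.linearMap ℂ D.RegFun ∘ₗ l
  let j : SymmetricAlgebra ℂ D.𝔥 →ₐ[ℂ] T := SymmetricAlgebra.lift g
  have hj : ∀ a, j (SymmetricAlgebra.ι ℂ D.𝔥 a) = g a :=
    fun a => SymmetricAlgebra.lift_ι_apply g a
  have hfst : (TrivSqZeroExt.fstHom ℂ D.RegFun D.RegFun).comp j =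
      IsScalarTower.toAlgHom ℂ (SymmetricAlgebra ℂ D.𝔥) D.RegFun := by
    refine SymmetricAlgebra.algHom_ext (LinearMap.ext fun a => ?_)
    change TrivSqZeroExt.fst (j (SymmetricAlgebra.ι ℂ D.𝔥 a)) = D.coord a
    rw [hj]
    simp [g]
  -- A dual number is a unit as soon as its constant part is, so the morphism extends to the
  -- localization.
  have hu : IsUnit (j D.P) := by
    rw [TrivSqZeroExt.isUnit_iff_isUnit_fst]
    have := DFunLike.congr_fun hfst D.P
    change TrivSqZeroExt.fst (j D.P) = algebraMap _ _ D.P at this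
    rw [this]
    exact IsLocalization.Away.algebraMap_isUnit D.P
  let J : D.RegFun →+* T := IsLocalization.Away.lift (S := D.RegFun) D.P (g := j.toRingHom) hu
  have hJ : ∀ s, J (algebraMap _ _ s) = j s := fun s => IsLocalization.Away.lift_eq D.P hu s
  have hJfst : ∀ r, TrivSqZeroExt.fst (J r) = r := by
    have : ((TrivSqZeroExt.fstHom ℂ D.RegFun D.RegFun).toRingHom.comp J) = RingHom.id _ := by
      refine IsLocalization.ringHom_ext (Submonoid.powers D.P) (RingHom.ext fun s => ?_)
      change TrivSqZeroExt.fst (J (algebraMap _ _ s)) = algebraMap _ _ s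
      rw [hJ]
      exact DFunLike.congr_fun hfst s
    exact fun r => DFunLike.congr_fun this r
  have hJc : ∀ z : ℂ, J (algebraMap ℂ _ z) = algebraMap ℂ T z := fun z => by
    rw [IsScalarTower.algebraMap_apply ℂ (SymmetricAlgebra ℂ D.𝔥) D.RegFun, hJ, AlgHom.commutes]
  let d0 : D.RegFun →ₗ[ℂ] D.RegFun :=
    { toFun := fun r => TrivSqZeroExt.snd (J r)
      map_add' := fun r s => by rw [map_add, TrivSqZeroExt.snd_add]
      map_smul' := fun z r => by
        rw [Algebra.smul_def, map_mul, hJc, ← Algebra.smul_def, TrivSqZeroExt.snd_smul]; rfl }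
  refine ⟨Derivation.mk' d0 fun r s => ?_, fun a => ?_⟩
  · change TrivSqZeroExt.snd (J (r * s)) = r • TrivSqZeroExt.snd (J s) + s • TrivSqZeroExt.snd (J r)
    rw [map_mul, TrivSqZeroExt.snd_mul, hJfst, hJfst]
    simp [mul_comm]
  · change TrivSqZeroExt.snd (J (algebraMap _ _ (SymmetricAlgebra.ι ℂ D.𝔥 a))) = _
    rw [hJ, hj]
    simp [g, Algebra.algebraMap_eq_smul_one]

/-- The derivation of `S(𝔥)[1/P]` defined by `∂̄_b`. -/
def der (b : D.𝔥) : Derivation ℂ D.RegFun D.RegFun :=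
  (D.exists_derivation (tensorPairing D.th b)).choose

theorem der_coord (b a : D.𝔥) :
    D.der b (D.coord a) = algebraMap ℂ _ (tensorPairing D.th b a) :=
  (D.exists_derivation (tensorPairing D.th b)).choose_spec a

theorem dOp_coord (b a : D.𝔥) : D.dOp b * D.fn (D.coord a) - D.fn (D.coord a) * D.dOp b =
    algebraMap ℂ _ (tensorPairing D.th b a) := by
  have h := RingQuot.mkAlgHom_rel ℂ (DiffRel.der_coord (D := D) b a)
  rwa [map_sub, map_mul, map_mul, AlgHom.commutes] at h

theorem dOp_comm (a b : D.𝔥) : D.dOp a * D.dOp b = D.dOp b * D.dOp a := by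
  have h := RingQuot.mkAlgHom_rel ℂ (DiffRel.der_comm (D := D) a b)
  rwa [map_mul, map_mul] at h

/-- The defining relations give this rule on coordinates only. The functions obeying it form a
subalgebra, hence it holds on `S(𝔥)`; denominators are then handled by multiplying by a power of `P`
and cancelling a unit. -/
theorem dOp_fn (b : D.𝔥) (r : D.RegFun) :
    D.dOp b * D.fn r = D.fn r * D.dOp b + D.fn (D.der b r) := by
  let A : Subalgebra ℂ D.RegFun :=
    { carrier := {r | D.dOp b * D.fn r = D.fn r * D.dOp b + D.fn (D.der b r)}
      mul_mem' := by
        intro x y hx hy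
        simp only [Set.mem_ofPred_eq] at hx hy ⊢
        rw [map_mul, ← mul_assoc, hx, add_mul, mul_assoc, hy, Derivation.leibniz, map_add,
          smul_eq_mul, smul_eq_mul, mul_comm y, map_mul, map_mul]
        noncomm_ring
      add_mem' := by
        intro x y hx hy
        simp only [Set.mem_ofPred_eq] at hx hy ⊢
        rw [map_add, mul_add, hx, hy, map_add, map_add]
        noncomm_ring
      algebraMap_mem' := by
        intro z
        simp only [Set.mem_ofPred_eq]
        rw [AlgHom.commutes, Derivation.map_algebraMap, map_zero, add_zero, Algebra.commutes] }
  have hA : ∀ r, r ∈ A ↔ D.dOp b * D.fn r = D.fn r * D.dOp b + D.fn (D.der b r) := fun r => Iff.rfl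
  have hS : ∀ s : SymmetricAlgebra ℂ D.𝔥, algebraMap _ D.RegFun s ∈ A := by
    intro s
    induction s using SymmetricAlgebra.induction with
    | algebraMap z =>
      rw [← IsScalarTower.algebraMap_apply ℂ (SymmetricAlgebra ℂ D.𝔥) D.RegFun]
      exact A.algebraMap_mem z
    | ι a =>
      change D.coord a ∈ A
      rw [hA, D.der_coord, AlgHom.commutes, ← D.dOp_coord]
      abel
    | mul x y hx hy => rw [map_mul]; exact A.mul_mem hx hy
    | add x y hx hy => rw [map_add]; exact A.add_mem hx hy
  obtain ⟨n, s, hs⟩ := IsLocalization.Away.surj D.P r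
  have hPn := hS (D.P ^ n)
  have hu : IsUnit (D.fn (algebraMap _ D.RegFun D.P ^ n)) :=
    ((IsLocalization.Away.algebraMap_isUnit D.P).pow n).map D.fn
  have h1 := hS s
  rw [hA] at h1 hPn
  rw [map_pow] at hPn
  rw [← hs] at h1
  set w := algebraMap _ D.RegFun D.P ^ n with hw
  -- Both `r * w` and `w` satisfy the rule, where `w` is the power of `P` clearing the denominator
  -- of `r`; the Leibniz rule isolates the one for `r` after cancelling `fn w` on the right.
  rw [← hu.mul_left_inj]
  rw [map_mul, Derivation.leibniz, map_add, smul_eq_mul, smul_eq_mul, mul_comm w, map_mul,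
    map_mul, mul_assoc (D.fn r) (D.fn w)] at h1
  have h2 : D.fn w * D.dOp b = D.dOp b * D.fn w - D.fn (D.der b w) := by rw [hPn]; abel
  rw [h2] at h1
  rw [mul_assoc, h1]
  simp only [mul_sub, add_mul, ← mul_assoc]
  abel

end ReductiveDecomposition

/-! ### Derivatives of the inverse matrix -/

namespace OrthonormalFrame

variable {Γ : Type*} [AddCommGroup Γ] [Fintype Γ] {𝔤 : Type*} [LieRing 𝔤] [LieAlgebra ℂ 𝔤]
variable {E : EquivariantTensor Γ 𝔤} {D : ReductiveDecomposition E} (S : OrthonormalFrame D)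

/-- `c ν` with entries in `S(𝔥)[1/P]`. -/
def cR (ν : Fin S.dimH) : Matrix (Fin S.dimM) (Fin S.dimM) D.RegFun :=
  (S.c ν).map (algebraMap ℂ D.RegFun)

theorem L_eq' : S.L = ∑ ν, D.coord (S.e ν) • S.cR ν := rfl

theorem cR_apply (ν p q) : S.cR ν p q = algebraMap ℂ _ (S.c ν p q) := rfl

theorem pairing_e (ν μ) : tensorPairing D.th (S.e ν) (S.e μ) = if ν = μ then 1 else 0 := by
  rw [S.pairing, S.form_ee]

theorem der_e_coord (ν μ) : D.der (S.e ν) (D.coord (S.e μ)) = if ν = μ then 1 else 0 := by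
  rw [D.der_coord, S.pairing_e]; split_ifs <;> simp

/-- Differentiate `G L = 1` and multiply by `G` on the right. -/
theorem derivation_inverse (d : Derivation ℂ D.RegFun D.RegFun) :
    S.G.map d = - (S.G * S.L.map d * S.G) := by
  have hmul : ∀ X Y : Matrix (Fin S.dimM) (Fin S.dimM) D.RegFun,
      (X * Y).map d = X * Y.map d + X.map d * Y := by
    intro X Y
    ext p q
    simp only [Matrix.map_apply, Matrix.mul_apply, map_sum, Derivation.leibniz, smul_eq_mul,
      Matrix.add_apply, Finset.sum_add_distrib]
    congr 1
    exact Finset.sum_congr rfl fun _ _ => mul_comm _ _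
  have h := hmul S.G S.L
  have h1 : (1 : Matrix (Fin S.dimM) (Fin S.dimM) D.RegFun).map d = 0 := by
    ext p q
    simp only [Matrix.map_apply, Matrix.one_apply, Matrix.zero_apply]
    split_ifs <;> simp
  rw [G_mul_L, h1] at h
  have h2 : S.G.map d * S.L * S.G = - (S.G * S.L.map d) * S.G := by
    rw [eq_neg_of_add_eq_zero_right h.symm]
  rw [mul_assoc, L_mul_G, mul_one] at h2
  rw [h2, neg_mul]

theorem der_L (ν) : S.L.map (D.der (S.e ν)) = S.cR ν := by
  ext p q
  simp only [L_eq', Matrix.map_apply, Matrix.sum_apply, Matrix.smul_apply, cR_apply, map_sum,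
    Derivation.leibniz, smul_eq_mul, Derivation.map_algebraMap, der_e_coord]
  simp

theorem der_G (ν) : S.G.map (D.der (S.e ν)) = - (S.G * S.cR ν * S.G) := by
  rw [derivation_inverse, der_L]

theorem der_G_apply (ν p q) : D.der (S.e ν) (S.G p q) = - (S.G * S.cR ν * S.G) p q := by
  rw [← Matrix.neg_apply, ← der_G]; rfl

end OrthonormalFrame

/-! ### Calculus of `tensorMul` -/

theorem tensorMul_tmul {V W B : Type*} [AddCommGroup V] [Module ℂ V] [AddCommGroup W] [Module ℂ W]
    [Ring B] [Algebra ℂ B] (f : V →ₗ[ℂ] B) (g : W →ₗ[ℂ] B) (a : V) (b : W) :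
    tensorMul f g (a ⊗ₜ b) = f a * g b := by
  simp [tensorMul]

theorem tensorMul_map {V W V' W' B : Type*} [AddCommGroup V] [Module ℂ V] [AddCommGroup W]
    [Module ℂ W] [AddCommGroup V'] [Module ℂ V'] [AddCommGroup W'] [Module ℂ W']
    [Ring B] [Algebra ℂ B] (f : V →ₗ[ℂ] B) (g : W →ₗ[ℂ] B) (f' : V' →ₗ[ℂ] V) (g' : W' →ₗ[ℂ] W)
    (t : V' ⊗[ℂ] W') :
    tensorMul f g (TensorProduct.map f' g' t) = tensorMul (f ∘ₗ f') (g ∘ₗ g') t := by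
  induction t with
  | zero => simp
  | tmul a b => simp [tensorMul_tmul]
  | add s t hs ht => simp only [map_add, hs, ht]

theorem tensorMul_add_left {V W B : Type*} [AddCommGroup V] [Module ℂ V] [AddCommGroup W]
    [Module ℂ W] [Ring B] [Algebra ℂ B] (f f' : V →ₗ[ℂ] B) (g : W →ₗ[ℂ] B) (t : V ⊗[ℂ] W) :
    tensorMul (f + f') g t = tensorMul f g t + tensorMul f' g t := by
  induction t with
  | zero => simp
  | tmul a b => simp [tensorMul_tmul, add_mul]
  | add s t hs ht => simp only [map_add, hs, ht]; abel

theorem tensorMul_smul_left {V W B : Type*} [AddCommGroup V] [Module ℂ V] [AddCommGroup W]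
    [Module ℂ W] [Ring B] [Algebra ℂ B] (z : ℂ) (f : V →ₗ[ℂ] B) (g : W →ₗ[ℂ] B) (t : V ⊗[ℂ] W) :
    tensorMul (z • f) g t = z • tensorMul f g t := by
  induction t with
  | zero => simp
  | tmul a b => simp [tensorMul_tmul]
  | add s t hs ht => simp only [map_add, hs, ht, smul_add]

/-- If commuting with `z` acts on the values of `f` and `g` as `ad u`, then commuting with `z`
acts on `tensorMul f g t` as `ad u` acts on `t`. -/
theorem commutator_tensorMul {𝔤 B : Type*} [LieRing 𝔤] [LieAlgebra ℂ 𝔤] [Ring B] [Algebra ℂ B]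
    (f g : 𝔤 →ₗ[ℂ] B) (u : 𝔤) (z : B) (hf : ∀ a, z * f a = f a * z + f ⁅u, a⁆)
    (hg : ∀ a, z * g a = g a * z + g ⁅u, a⁆) (t : 𝔤 ⊗[ℂ] 𝔤) :
    z * tensorMul f g t = tensorMul f g t * z + tensorMul f g ⁅u, t⁆ := by
  induction t with
  | zero => simp
  | tmul a b =>
    rw [TensorProduct.LieModule.lie_tmul_right, map_add, tensorMul_tmul, tensorMul_tmul,
      tensorMul_tmul, ← mul_assoc, hf, add_mul, mul_assoc, hg]
    noncomm_ring
  | add s t hs ht =>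
    rw [map_add, mul_add, hs, ht, lie_add, map_add]
    noncomm_ring

/-! ### Commutation rules in `B_n` -/

namespace ReductiveDecomposition

variable {Γ : Type*} [AddCommGroup Γ] [Fintype Γ] {𝔤 : Type*} [LieRing 𝔤] [LieAlgebra ℂ 𝔤]
variable {E : EquivariantTensor Γ 𝔤} (D : ReductiveDecomposition E) (n : ℕ)

theorem op_comm_en (a : D.Diff) (u) : D.op n a * D.en n u = D.en n u * D.op n a := by
  change (a ⊗ₜ[ℂ] (1 : ⨂[ℂ] _ : Fin n, UniversalEnvelopingAlgebra ℂ 𝔤)) * ((1 : D.Diff) ⊗ₜ[ℂ] u) =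
    ((1 : D.Diff) ⊗ₜ[ℂ] u) * (a ⊗ₜ[ℂ] (1 : ⨂[ℂ] _ : Fin n, UniversalEnvelopingAlgebra ℂ 𝔤))
  simp [Algebra.TensorProduct.tmul_mul_tmul]

theorem op_comm_leg (a : D.Diff) (i : Fin n) (u : 𝔤) :
    Commute (D.op n a) (D.leg n i u) := D.op_comm_en n a _

attribute [local instance] LieRing.ofAssociativeRing in
theorem leg_apply (i : Fin n) (u : 𝔤) : D.leg n i u =
    D.en n (PiTensorProduct.singleAlgHom (R := ℂ)
      (A := fun _ : Fin n => UniversalEnvelopingAlgebra ℂ 𝔤) i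
      (UniversalEnvelopingAlgebra.ι ℂ u)) := rfl

theorem leg_comm {i j : Fin n} (hij : i ≠ j) (u v : 𝔤) :
    Commute (D.leg n i u) (D.leg n j v) := by
  rw [leg_apply, leg_apply]
  refine Commute.map ?_ (D.en n)
  rw [PiTensorProduct.singleAlgHom_apply, PiTensorProduct.singleAlgHom_apply]
  apply Commute.tprod
  exact Pi.mulSingle_commute hij _ _

attribute [local instance] LieRing.ofAssociativeRing in
theorem leg_lie (i : Fin n) (u v : 𝔤) :
    D.leg n i u * D.leg n i v = D.leg n i v * D.leg n i u + D.leg n i ⁅u, v⁆ := by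
  rw [leg_apply, leg_apply, leg_apply, LieHom.map_lie, LieRing.of_associative_ring_bracket]
  simp only [map_sub, map_mul]
  abel

/-- Functions as elements of `B_n`. -/
def F : D.RegFun →ₐ[ℂ] D.B n := (D.op n).comp D.fn

/-- The operators `∂̄_a` as elements of `B_n`. -/
def d : D.𝔥 →ₗ[ℂ] D.B n := (D.op n).toLinearMap ∘ₗ D.dOp

/-- The map `a ↦ 1 ⊗ ∑_i a^{(i)}`. -/
def tot : 𝔤 →ₗ[ℂ] D.B n := ∑ i, D.leg n i

theorem tot_apply (u : 𝔤) : D.tot n u = ∑ i, D.leg n i u := by simp [tot]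

theorem F_leg (r : D.RegFun) (i : Fin n) (u : 𝔤) : Commute (D.F n r) (D.leg n i u) :=
  D.op_comm_leg n _ i u

theorem d_leg (a : D.𝔥) (i : Fin n) (u : 𝔤) : Commute (D.d n a) (D.leg n i u) :=
  D.op_comm_leg n _ i u

theorem op_tot (a : D.Diff) (u : 𝔤) : Commute (D.op n a) (D.tot n u) := by
  rw [tot_apply]
  exact Commute.sum_right _ _ _ fun i _ => D.op_comm_leg n a i u

theorem F_tot (r : D.RegFun) (u : 𝔤) : Commute (D.F n r) (D.tot n u) := D.op_tot n _ u

theorem d_tot (a : D.𝔥) (u : 𝔤) : Commute (D.d n a) (D.tot n u) := D.op_tot n _ u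

theorem d_d (a b : D.𝔥) : Commute (D.d n a) (D.d n b) := by
  have : Commute (D.dOp a) (D.dOp b) := D.dOp_comm a b
  exact this.map (D.op n)

theorem F_F (r s : D.RegFun) : Commute (D.F n r) (D.F n s) :=
  (Commute.all r s).map (D.F n)

theorem d_F (b : D.𝔥) (r : D.RegFun) :
    D.d n b * D.F n r = D.F n r * D.d n b + D.F n (D.der b r) := by
  have := congrArg (D.op n) (D.dOp_fn b r)
  rwa [map_mul, map_add, map_mul] at this

/-- Only the `i`-th summand of the diagonal element fails to commute with the `i`-th leg. -/
theorem tot_leg (i : Fin n) (u v : 𝔤) :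
    D.tot n u * D.leg n i v = D.leg n i v * D.tot n u + D.leg n i ⁅u, v⁆ := by
  rw [tot_apply, Finset.sum_mul, Finset.mul_sum, ← Finset.add_sum_erase _ _ (Finset.mem_univ i),
    ← Finset.add_sum_erase (a := i) Finset.univ (fun j => D.leg n i v * D.leg n j u)
      (Finset.mem_univ i), D.leg_lie n i u v,
    Finset.sum_congr rfl fun j hj => (D.leg_comm n (Finset.ne_of_mem_erase hj) u v).eq]
  abel

theorem leg_tot (i : Fin n) (u v : 𝔤) :
    D.leg n i u * D.tot n v = D.tot n v * D.leg n i u + D.leg n i ⁅u, v⁆ := by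
  rw [D.tot_leg n i v u, ← lie_skew u v, map_neg]
  abel

theorem tot_lie (u v : 𝔤) :
    D.tot n u * D.tot n v = D.tot n v * D.tot n u + D.tot n ⁅u, v⁆ := by
  conv_lhs => rw [D.tot_apply n v]
  rw [Finset.mul_sum, D.tot_apply n v, Finset.sum_mul, D.tot_apply n ⁅u, v⁆,
    ← Finset.sum_add_distrib]
  exact Finset.sum_congr rfl fun i _ => D.tot_leg n i u v

theorem XOp_add (a b : D.𝔥) : D.XOp (a + b) = D.XOp a + D.XOp b := by
  rw [XOp, XOp, XOp, ← tensorMul_add_left, map_add, ← LinearMap.comp_add]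

theorem XOp_smul (z : ℂ) (a : D.𝔥) : D.XOp (z • a) = z • D.XOp a := by
  rw [XOp, XOp, ← tensorMul_smul_left, ← LinearMap.comp_smul, map_smul]

/-- `a ↦ Ȳ_a` as a linear map. -/
def YL : D.𝔥 →ₗ[ℂ] D.B n where
  toFun a := D.Y n a
  map_add' a b := by
    simp only [Y, XOp_add, map_add, Finset.sum_add_distrib]; abel
  map_smul' z a := by
    simp only [Y, XOp_smul, map_smul, smul_add, Finset.smul_sum, RingHom.id_apply]

theorem mem_invariants_iff {ι : Type*} (e : Module.Basis ι ℂ D.𝔥) (b : D.B n) :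
    b ∈ D.invariants n ↔ ∀ ν, D.Y n (e ν) * b = b * D.Y n (e ν) := by
  rw [invariants, Subalgebra.mem_centralizer_iff]
  constructor
  · intro h ν
    exact h _ ⟨_, rfl⟩
  · rintro h _ ⟨a, rfl⟩
    have : (LinearMap.mulRight ℂ b) ∘ₗ D.YL n = (LinearMap.mulLeft ℂ b) ∘ₗ D.YL n :=
      e.ext fun ν => h ν
    exact LinearMap.congr_fun this a

theorem Y_eq (a : D.𝔥) : D.Y n a = D.op n (D.XOp a) + D.tot n a := by
  rw [Y, tot_apply]; rfl

theorem Y_leg (a : D.𝔥) (i : Fin n) (u : 𝔤) :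
    D.Y n a * D.leg n i u = D.leg n i u * D.Y n a + D.leg n i ⁅(a : 𝔤), u⁆ := by
  rw [Y_eq, add_mul, mul_add, D.tot_leg, (D.op_comm_leg n _ i u).eq]
  abel

theorem Y_tot (a : D.𝔥) (u : 𝔤) :
    D.Y n a * D.tot n u = D.tot n u * D.Y n a + D.tot n ⁅(a : 𝔤), u⁆ := by
  rw [Y_eq, add_mul, mul_add, D.tot_lie, (D.op_tot n _ u).eq]
  abel

end ReductiveDecomposition

/-! ### The images of the generators in coordinates -/

namespace OrthonormalFrame

variable {Γ : Type*} [AddCommGroup Γ] [Fintype Γ] {𝔤 : Type*} [LieRing 𝔤] [LieAlgebra ℂ 𝔤]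
variable {E : EquivariantTensor Γ 𝔤} {D : ReductiveDecomposition E} (S : OrthonormalFrame D)
variable (n : ℕ)

theorem xSum_eq (i : Fin n) :
    D.xSum n i = ∑ ν, D.F n (D.coord (S.e ν)) * D.leg n i (S.e ν) := by
  rw [ReductiveDecomposition.xSum, S.th_eq, map_sum]
  simp only [tensorMul_tmul]
  rfl

theorem dSum_eq (i : Fin n) :
    D.dSum n i = ∑ ν, D.d n (S.e ν) * D.leg n i (S.e ν) := by
  rw [ReductiveDecomposition.dSum, S.th_eq, map_sum]
  simp only [tensorMul_tmul]
  rfl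

theorem rLeg_eq (i j : Fin n) :
    D.rLeg n i j = ∑ p, ∑ q, D.F n (S.G q p) * (D.leg n i (S.m p) * D.leg n j (S.m q)) := by
  rw [ReductiveDecomposition.rLeg, S.rMatrix_eq]
  simp only [map_sum, tensorMul_tmul]
  refine Finset.sum_congr rfl fun p _ => Finset.sum_congr rfl fun q _ => ?_
  change D.leg n i (S.m p) * (D.F n (S.G q p) * D.leg n j (S.m q)) = _
  rw [← mul_assoc, ← mul_assoc, (D.F_leg n _ i _).eq]

/-- Including `k = i` is what makes the second legs add up to the full diagonal element `tot (m q)`,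
whose commutators are again diagonal. -/
theorem sum_rLeg_eq (i : Fin n) :
    ∑ j, D.rLeg n i j = ∑ p, ∑ q, D.F n (S.G q p) * (D.leg n i (S.m p) * D.tot n (S.m q)) := by
  simp only [S.rLeg_eq, D.tot_apply, Finset.mul_sum]
  rw [Finset.sum_comm]
  refine Finset.sum_congr rfl fun p _ => ?_
  rw [Finset.sum_comm]

theorem op_XOp_e (ν : Fin S.dimH) : D.op n (D.XOp (S.e ν)) =
    ∑ μ, D.F n (D.coord ⁅S.e ν, S.e μ⁆) * D.d n (S.e μ) := by
  rw [ReductiveDecomposition.XOp, S.th_eq, map_sum, map_sum]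
  refine Finset.sum_congr rfl fun μ _ => ?_
  rw [tensorMul_tmul, map_mul]
  rfl

end OrthonormalFrame

theorem commutator_mul {B : Type*} [Ring B] {z a b a' b' : B} (ha : z * a = a * z + a')
    (hb : z * b = b * z + b') : z * (a * b) = a * b * z + (a' * b + a * b') := by
  rw [← mul_assoc, ha, add_mul, mul_assoc, hb]
  noncomm_ring

theorem commutator_sum {B ι : Type*} [Ring B] {s : Finset ι} {z : B} {a a' : ι → B}
    (h : ∀ i ∈ s, z * a i = a i * z + a' i) :
    z * ∑ i ∈ s, a i = (∑ i ∈ s, a i) * z + ∑ i ∈ s, a' i := by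
  rw [Finset.mul_sum, Finset.sum_mul, ← Finset.sum_add_distrib]
  exact Finset.sum_congr rfl h

theorem tensorMul_comm {V W B : Type*} [AddCommGroup V] [Module ℂ V] [AddCommGroup W]
    [Module ℂ W] [Ring B] [Algebra ℂ B] (f : V →ₗ[ℂ] B) (g : W →ₗ[ℂ] B)
    (h : ∀ a b, f a * g b = g b * f a) (t : V ⊗[ℂ] W) :
    tensorMul f g t = tensorMul g f (TensorProduct.comm ℂ V W t) := by
  induction t with
  | zero => simp
  | tmul a b => simp [tensorMul_tmul, h]
  | add s t hs ht => simp only [map_add, hs, ht]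

/-! ### Relations among the elements `t_{ij}^α` -/

namespace ReductiveDecomposition

variable {Γ : Type*} [AddCommGroup Γ] [Fintype Γ] {𝔤 : Type*} [LieRing 𝔤] [LieAlgebra ℂ 𝔤]
variable {E : EquivariantTensor Γ 𝔤} (D : ReductiveDecomposition E) (n : ℕ)

/-- The first leg is twisted by the Lie automorphism `act α`, so acting there by `ad (act α u)`
amounts to acting by `ad u` before the twist. The commutator is therefore the image of `⁅u, t⁆ = 0`.
-/
theorem commute_tLeg (α : Γ) (i j : Fin n) (z : D.B n) (u : 𝔤)
    (hi : ∀ a, z * D.leg n i a = D.leg n i a * z + D.leg n i ⁅E.act α u, a⁆)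
    (hj : ∀ a, z * D.leg n j a = D.leg n j a * z + D.leg n j ⁅u, a⁆) :
    Commute z (D.tLeg n α i j) := by
  have h := commutator_tensorMul ((D.leg n i).comp (E.act α : 𝔤 →ₗ[ℂ] 𝔤)) (D.leg n j) u z
    (fun a => by
      change z * D.leg n i (E.act α a) = D.leg n i (E.act α a) * z + D.leg n i (E.act α ⁅u, a⁆)
      rw [hi, LieEquiv.map_lie]) hj E.t
  rw [E.t_inv, map_zero, add_zero] at h
  exact h

theorem commute_tLeg_of_commute (α : Γ) (i j : Fin n) (z : D.B n)
    (hi : ∀ a, Commute z (D.leg n i a)) (hj : ∀ a, Commute z (D.leg n j a)) :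
    Commute z (D.tLeg n α i j) :=
  D.commute_tLeg n α i j z 0 (fun a => by simp [(hi a).eq]) (fun a => by simp [(hj a).eq])

theorem op_tLeg (a : D.Diff) (α : Γ) (i j : Fin n) : Commute (D.op n a) (D.tLeg n α i j) :=
  D.commute_tLeg_of_commute n α i j _ (D.op_comm_leg n a i) (D.op_comm_leg n a j)

theorem leg_tLeg (α : Γ) {i j k : Fin n} (hij : i ≠ j) (hik : i ≠ k) (u : 𝔤) :
    Commute (D.leg n i u) (D.tLeg n α j k) :=
  D.commute_tLeg_of_commute n α j k _ (D.leg_comm n hij u) (D.leg_comm n hik u)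

/-- For `u` fixed by `Γ` the twist is invisible and the diagonal action is `ad u` on both legs. -/
theorem tot_tLeg (α : Γ) (i j : Fin n) {u : 𝔤} (hu : u ∈ E.fixed) :
    Commute (D.tot n u) (D.tLeg n α i j) :=
  D.commute_tLeg n α i j _ u (fun a => by rw [hu α, D.tot_leg]) (fun a => D.tot_leg n j u a)

theorem leg_add_leg_tLeg (α : Γ) {i j : Fin n} (hij : i ≠ j) (u : 𝔤) :
    Commute (D.leg n i (E.act α u) + D.leg n j u) (D.tLeg n α i j) :=
  D.commute_tLeg n α i j _ u
    (fun a => by rw [add_mul, mul_add, D.leg_lie, (D.leg_comm n hij.symm u a).eq]; abel)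
    (fun a => by rw [add_mul, mul_add, D.leg_lie, (D.leg_comm n hij _ a).eq]; abel)

theorem Y_tLeg (a : D.𝔥) (α : Γ) (i j : Fin n) : Commute (D.Y n a) (D.tLeg n α i j) := by
  rw [Y_eq]
  exact (D.op_tLeg n _ α i j).add_left (D.tot_tLeg n α i j (D.h_le a))

theorem tLeg_mem_invariants (α : Γ) (i j : Fin n) : D.tLeg n α i j ∈ D.invariants n := by
  rw [invariants, Subalgebra.mem_centralizer_iff]
  rintro _ ⟨a, rfl⟩
  exact D.Y_tLeg n a α i j

theorem tLeg_symm (α : Γ) {i j : Fin n} (hij : i ≠ j) : D.tLeg n α i j = D.tLeg n (-α) j i := by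
  have h1 : D.tLeg n α i j =
      tensorMul (D.leg n i) (D.leg n j ∘ₗ (E.act (-α) : 𝔤 →ₗ[ℂ] 𝔤)) E.t := by
    have := congrArg (tensorMul (D.leg n i) (D.leg n j)) (E.map_act_left α)
    rwa [tensorMul_map, tensorMul_map] at this
  rw [h1]
  refine (tensorMul_comm (D.leg n i) (D.leg n j ∘ₗ (E.act (-α) : 𝔤 →ₗ[ℂ] 𝔤))
    (fun a b => D.leg_comm n hij _ _) E.t).trans ?_
  rw [E.t_symm]
  rfl

theorem tLeg_comm (α β : Γ) {i j k l : Fin n} (hik : i ≠ k) (hil : i ≠ l) (hjk : j ≠ k)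
    (hjl : j ≠ l) : Commute (D.tLeg n α i j) (D.tLeg n β k l) :=
  D.commute_tLeg_of_commute n β k l _
    (fun a => (D.leg_tLeg n α hik.symm hjk.symm a).symm)
    (fun a => (D.leg_tLeg n α hil.symm hjl.symm a).symm)

/-- For a pure tensor `a ⊗ b` the two summands share the factor `b` in leg `k`, and their other
factors add up to `(act α v)^{(i)} + v^{(j)}` with `v = act β a`, to which `leg_add_leg_tLeg`
applies. -/
theorem tLeg_fourT (α β : Γ) {i j k : Fin n} (hij : i ≠ j) (hik : i ≠ k) (hjk : j ≠ k) :
    Commute (D.tLeg n α i j) (D.tLeg n (α + β) i k + D.tLeg n β j k) := by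
  have h : ∀ t : 𝔤 ⊗[ℂ] 𝔤, Commute (D.tLeg n α i j)
      (tensorMul (D.leg n i ∘ₗ (E.act (α + β) : 𝔤 →ₗ[ℂ] 𝔤)) (D.leg n k) t +
        tensorMul (D.leg n j ∘ₗ (E.act β : 𝔤 →ₗ[ℂ] 𝔤)) (D.leg n k) t) := by
    intro t
    induction t with
    | zero => simp
    | tmul a b =>
      rw [tensorMul_tmul, tensorMul_tmul, ← add_mul]
      refine Commute.mul_right ?_ (D.leg_tLeg n α hik.symm hjk.symm b).symm
      change Commute _ (D.leg n i (E.act (α + β) a) + D.leg n j (E.act β a))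
      rw [E.act_add]
      exact (D.leg_add_leg_tLeg n α hij _).symm
    | add s t hs ht =>
      rw [map_add, map_add, add_add_add_comm]
      exact hs.add_right ht
  exact h E.t

theorem tensorMul_tFixed (i j : Fin n) : tensorMul (D.leg n i) (D.leg n j) E.tFixed =
    (Fintype.card Γ : ℂ)⁻¹ • ∑ α, D.tLeg n α i j := by
  rw [E.tFixed_eq, map_smul, map_sum]
  simp only [tensorMul_map]
  rfl

end ReductiveDecomposition

/-! ### The action of `𝔥` on functions, derivatives and legs -/

namespace OrthonormalFrame

variable {Γ : Type*} [AddCommGroup Γ] [Fintype Γ] {𝔤 : Type*} [LieRing 𝔤] [LieAlgebra ℂ 𝔤]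
variable {E : EquivariantTensor Γ 𝔤} {D : ReductiveDecomposition E} (S : OrthonormalFrame D)
variable (n : ℕ)

theorem tensorMul_tFixed (i j : Fin n) : tensorMul (D.leg n i) (D.leg n j) E.tFixed =
    ∑ ν, D.leg n i (S.e ν) * D.leg n j (S.e ν) +
      ∑ p, D.leg n i (S.m p) * D.leg n j (S.m p) := by
  rw [← D.sum_eq, map_add, tensorMul_map, tensorMul_map, S.th_eq, S.tm_eq, map_sum, map_sum]
  simp only [tensorMul_tmul]
  rfl

theorem f_swap_right (ν μ κ) : S.f ν μ κ = - S.f ν κ μ := by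
  rw [S.f_rotate, S.f_swap, ← S.f_rotate ν]

/-- `f` is antisymmetric in its last two indices because the form is invariant. This is the
invariance of `∑ e_ν ⊗ e_ν` in the shape needed for `xSum` and `dSum`. -/
theorem sum_f_symm {W : Type*} [AddCommGroup W] [Module ℂ W] (ν : Fin S.dimH)
    (T : Fin S.dimH → Fin S.dimH → W) :
    ∑ μ, ∑ κ, S.f ν μ κ • (T μ κ + T κ μ) = 0 := by
  simp only [smul_add, Finset.sum_add_distrib]
  rw [Finset.sum_comm (f := fun μ κ => S.f ν μ κ • T κ μ), ← Finset.sum_add_distrib]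
  refine Finset.sum_eq_zero fun μ _ => ?_
  rw [← Finset.sum_add_distrib]
  refine Finset.sum_eq_zero fun κ _ => ?_
  rw [← add_smul, S.f_swap_right, neg_add_cancel, zero_smul]

theorem coord_lie (ν μ) : D.coord ⁅S.e ν, S.e μ⁆ = ∑ κ, S.f ν μ κ • D.coord (S.e κ) := by
  rw [S.lie_e_e', map_sum]; simp only [map_smul]

/-- The derivation of `S(𝔥)[1/P]` given by the coadjoint action of `e_ν`. -/
def rot (ν : Fin S.dimH) : D.RegFun →ₗ[ℂ] D.RegFun :=
  ∑ μ, D.coord ⁅S.e ν, S.e μ⁆ • (D.der (S.e μ) : D.RegFun →ₗ[ℂ] D.RegFun)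

theorem rot_apply (ν : Fin S.dimH) (r : D.RegFun) :
    S.rot ν r = ∑ μ, D.coord ⁅S.e ν, S.e μ⁆ * D.der (S.e μ) r := by
  simp [rot, LinearMap.sum_apply]

theorem rot_coord (ν μ : Fin S.dimH) : S.rot ν (D.coord (S.e μ)) = D.coord ⁅S.e ν, S.e μ⁆ := by
  simp [rot_apply, S.der_e_coord]

/-- Equivariance of `L` under `𝔥`: expand `L` and apply `c_commutator`, moving indices with the
cyclic symmetry of `f`. -/
theorem sum_coord_cR (ν : Fin S.dimH) :
    ∑ μ, D.coord ⁅S.e ν, S.e μ⁆ • S.cR μ = S.L * S.cR ν - S.cR ν * S.L := by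
  have hc : ∀ κ, S.cR κ * S.cR ν - S.cR ν * S.cR κ = ∑ μ, S.f ν μ κ • S.cR μ := by
    intro κ
    have h := congrArg (fun X => Matrix.map X (algebraMap ℂ D.RegFun)) (S.c_commutator κ ν)
    rw [Matrix.map_sub _ (by simp), Matrix.map_mul, Matrix.map_mul] at h
    rw [cR, cR, ← h]
    ext p q
    simp only [Matrix.map_apply, Matrix.sum_apply, Matrix.smul_apply, map_sum, cR]
    refine Finset.sum_congr rfl fun μ _ => ?_
    rw [S.f_rotate κ, smul_eq_mul, map_mul, ← Algebra.smul_def]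
  simp only [L_eq', Finset.sum_mul, Finset.mul_sum, ← Finset.sum_sub_distrib, Matrix.smul_mul,
    Matrix.mul_smul, ← smul_sub, hc, Finset.smul_sum, S.coord_lie, Finset.sum_smul]
  rw [Finset.sum_comm]
  refine Finset.sum_congr rfl fun κ _ => Finset.sum_congr rfl fun μ _ => ?_
  rw [smul_assoc, smul_comm]

/-- Since `∂_μ G = -G c_μ G`, this is the equivariance of `L` multiplied by `G` on both sides. -/
theorem rot_G (ν : Fin S.dimH) (p q) :
    S.rot ν (S.G p q) = (S.G * S.cR ν - S.cR ν * S.G) p q := by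
  have h : S.G * S.cR ν - S.cR ν * S.G =
      ∑ μ, D.coord ⁅S.e ν, S.e μ⁆ • -(S.G * S.cR μ * S.G) := by
    have h1 : ∑ μ, D.coord ⁅S.e ν, S.e μ⁆ • -(S.G * S.cR μ * S.G) =
        -(S.G * (∑ μ, D.coord ⁅S.e ν, S.e μ⁆ • S.cR μ) * S.G) := by
      simp only [Finset.mul_sum, Finset.sum_mul, smul_neg, Finset.sum_neg_distrib, Matrix.smul_mul,
        Matrix.mul_smul]
    rw [h1, S.sum_coord_cR, mul_sub, sub_mul, ← mul_assoc S.G S.L, S.G_mul_L, one_mul,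
      mul_assoc, mul_assoc (S.cR ν), S.L_mul_G, mul_one, neg_sub]
  rw [h, rot_apply, Matrix.sum_apply]
  refine Finset.sum_congr rfl fun μ _ => ?_
  rw [S.der_G_apply]
  rfl

theorem Y_F (ν : Fin S.dimH) (r : D.RegFun) :
    D.Y n (S.e ν) * D.F n r = D.F n r * D.Y n (S.e ν) + D.F n (S.rot ν r) := by
  rw [D.Y_eq, S.op_XOp_e, add_mul, mul_add, (D.F_tot n r _).eq, rot_apply, map_sum, Finset.sum_mul,
    Finset.mul_sum]
  have h : ∀ μ, D.F n (D.coord ⁅S.e ν, S.e μ⁆) * D.d n (S.e μ) * D.F n r =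
      D.F n r * (D.F n (D.coord ⁅S.e ν, S.e μ⁆) * D.d n (S.e μ)) +
        D.F n (D.coord ⁅S.e ν, S.e μ⁆ * D.der (S.e μ) r) := by
    intro μ
    rw [mul_assoc, D.d_F, mul_add, ← mul_assoc, ← mul_assoc, (D.F_F n _ r).eq, map_mul]
  simp only [h, Finset.sum_add_distrib]
  abel

/-- The term `∂_μ` of the coefficient in `X̄` is `f ν κ μ`; the antisymmetry of `f` converts it into
the coefficients of `⁅e_ν, e_μ⁆`. -/
theorem Y_d (ν μ : Fin S.dimH) :
    D.Y n (S.e ν) * D.d n (S.e μ) = D.d n (S.e μ) * D.Y n (S.e ν) + D.d n ⁅S.e ν, S.e μ⁆ := by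
  rw [D.Y_eq, S.op_XOp_e, add_mul, mul_add, (D.d_tot n _ _).eq, Finset.sum_mul, Finset.mul_sum]
  have h : ∀ κ, D.F n (D.coord ⁅S.e ν, S.e κ⁆) * D.d n (S.e κ) * D.d n (S.e μ) =
      D.d n (S.e μ) * (D.F n (D.coord ⁅S.e ν, S.e κ⁆) * D.d n (S.e κ)) +
        S.f ν μ κ • D.d n (S.e κ) := by
    intro κ
    have h2 : D.der (S.e μ) (D.coord ⁅S.e ν, S.e κ⁆) = algebraMap ℂ _ (S.f ν κ μ) := by
      rw [S.coord_lie, map_sum]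
      simp [S.der_e_coord, Algebra.algebraMap_eq_smul_one]
    rw [mul_assoc, (D.d_d n (S.e κ) (S.e μ)).eq, ← mul_assoc, ← mul_assoc, D.d_F, h2,
      AlgHom.commutes, add_mul, ← Algebra.smul_def, S.f_swap_right ν μ, neg_smul]
    abel
  simp only [h, Finset.sum_add_distrib]
  rw [S.lie_e_e' ν μ, map_sum]
  simp only [map_smul]
  abel

/-- `(1/N) ȳ_i` -/
def yv (i : Fin n) : D.B n :=
  - ∑ ν, D.d n (S.e ν) * D.leg n i (S.e ν) +
    ∑ p, ∑ q, D.F n (S.G q p) * (D.leg n i (S.m p) * D.tot n (S.m q))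

theorem yv_eq (i : Fin n) : S.yv n i = - D.dSum n i + ∑ j, D.rLeg n i j := by
  rw [yv, S.dSum_eq, S.sum_rLeg_eq]

theorem leg_lie_e_e (i : Fin n) (ν μ) : D.leg n i ⁅(S.e ν : 𝔤), (S.e μ : 𝔤)⁆ =
    ∑ κ, S.f ν μ κ • D.leg n i (S.e κ) := by
  rw [S.lie_e_e, map_sum]; simp only [map_smul]

theorem leg_lie_e_m (i : Fin n) (ν p) : D.leg n i ⁅(S.e ν : 𝔤), (S.m p : 𝔤)⁆ =
    ∑ q, D.F n (S.cR ν q p) * D.leg n i (S.m q) := by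
  rw [S.lie_e_m, map_sum]; simp only [map_smul, cR_apply, AlgHom.commutes, Algebra.smul_def]

theorem tot_lie_e_m (ν p) : D.tot n ⁅(S.e ν : 𝔤), (S.m p : 𝔤)⁆ =
    ∑ q, D.F n (S.cR ν q p) * D.tot n (S.m q) := by
  rw [S.lie_e_m, map_sum]; simp only [map_smul, cR_apply, AlgHom.commutes, Algebra.smul_def]

theorem leg_lie_m_m (i : Fin n) (p q) : D.leg n i ⁅(S.m p : 𝔤), (S.m q : 𝔤)⁆ =
    ∑ s, D.F n (algebraMap ℂ _ (S.φ p q s)) * D.leg n i (S.m s) -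
      ∑ ν, D.F n (S.cR ν p q) * D.leg n i (S.e ν) := by
  rw [S.lie_m_m, map_sub, map_sum, map_sum]
  simp only [map_smul, cR_apply, AlgHom.commutes, Algebra.smul_def]

theorem tot_lie_m_m (p q) : D.tot n ⁅(S.m p : 𝔤), (S.m q : 𝔤)⁆ =
    ∑ s, D.F n (algebraMap ℂ _ (S.φ p q s)) * D.tot n (S.m s) -
      ∑ ν, D.F n (S.cR ν p q) * D.tot n (S.e ν) := by
  rw [S.lie_m_m, map_sub, map_sum, map_sum]
  simp only [map_smul, cR_apply, AlgHom.commutes, Algebra.smul_def]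

theorem xSum_mem_invariants (S : OrthonormalFrame D) (i : Fin n) :
    D.xSum n i ∈ D.invariants n := by
  rw [D.mem_invariants_iff n S.e]
  intro ν
  rw [S.xSum_eq]
  rw [commutator_sum (a' := fun μ => ∑ κ, S.f ν μ κ • (D.F n (D.coord (S.e κ)) * D.leg n i (S.e μ) +
    D.F n (D.coord (S.e μ)) * D.leg n i (S.e κ))), S.sum_f_symm ν (fun μ κ =>
      D.F n (D.coord (S.e κ)) * D.leg n i (S.e μ)), add_zero]
  intro μ _
  rw [commutator_mul (S.Y_F n ν _) (D.Y_leg n _ i _), rot_coord, coord_lie, leg_lie_e_e, map_sum,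
    Finset.sum_mul, Finset.mul_sum, ← Finset.sum_add_distrib]
  simp only [map_smul, smul_mul_assoc, mul_smul_comm, smul_add]

theorem d_leg_mem_invariants (i : Fin n) :
    ∑ ν, D.d n (S.e ν) * D.leg n i (S.e ν) ∈ D.invariants n := by
  rw [D.mem_invariants_iff n S.e]
  intro ν
  rw [commutator_sum (a' := fun μ => ∑ κ, S.f ν μ κ • (D.d n (S.e κ) * D.leg n i (S.e μ) +
    D.d n (S.e μ) * D.leg n i (S.e κ))), S.sum_f_symm ν (fun μ κ =>
      D.d n (S.e κ) * D.leg n i (S.e μ)), add_zero]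
  intro μ _
  rw [commutator_mul (S.Y_d n ν _) (D.Y_leg n _ i _), S.lie_e_e', leg_lie_e_e, map_sum,
    Finset.sum_mul, Finset.mul_sum, ← Finset.sum_add_distrib]
  simp only [map_smul, smul_mul_assoc, mul_smul_comm, smul_add]

end OrthonormalFrame

/-! ### Bilinear and trilinear expressions with function coefficients -/

section Multilinear

variable {R B : Type*} [CommRing R] [Ring B] [Algebra ℂ R] [Algebra ℂ B]
variable {ι κ τ σ : Type*} [Fintype ι] [Fintype κ] [Fintype τ] [Fintype σ]

/-- `∑ K p q · a p · b q`. -/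
def bil (F : R →ₐ[ℂ] B) (K : Matrix ι κ R) (a : ι → B) (b : κ → B) : B :=
  ∑ p, ∑ q, F (K p q) * (a p * b q)

/-- `∑ K p q s · a p · b q · c s`. -/
def tri (F : R →ₐ[ℂ] B) (K : ι → κ → τ → R) (a : ι → B) (b : κ → B) (c : τ → B) : B :=
  ∑ p, ∑ q, ∑ s, F (K p q s) * (a p * (b q * c s))

variable (F : R →ₐ[ℂ] B)

theorem bil_add (K K' : Matrix ι κ R) (a : ι → B) (b : κ → B) :
    bil F (K + K') a b = bil F K a b + bil F K' a b := by
  simp only [bil, Matrix.add_apply, map_add, add_mul, Finset.sum_add_distrib]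

theorem bil_zero (a : ι → B) (b : κ → B) : bil F (0 : Matrix ι κ R) a b = 0 := by
  simp [bil]

theorem bil_mul_left (C : Matrix ι ι R) (a : ι → B) (b : κ → B) (K : Matrix ι κ R) :
    ∑ p, ∑ q, F (K p q) * ((∑ s, F (C s p) * a s) * b q) = bil F (C * K) a b := by
  simp only [bil, Matrix.mul_apply, map_sum, map_mul, Finset.sum_mul, Finset.mul_sum]
  calc _ = ∑ p, ∑ s, ∑ q, F (K p q) * (F (C s p) * a s * b q) :=
        Finset.sum_congr rfl fun p _ => Finset.sum_comm
    _ = ∑ s, ∑ p, ∑ q, F (K p q) * (F (C s p) * a s * b q) := Finset.sum_comm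
    _ = ∑ s, ∑ q, ∑ p, F (K p q) * (F (C s p) * a s * b q) :=
        Finset.sum_congr rfl fun p _ => Finset.sum_comm
    _ = _ := by
      refine Finset.sum_congr rfl fun s _ => Finset.sum_congr rfl fun q _ =>
        Finset.sum_congr rfl fun p _ => ?_
      rw [← map_mul, mul_comm (C s p), map_mul]
      simp only [mul_assoc]

theorem bil_mul_right (K : Matrix ι κ R) (C : Matrix κ κ R) (a : ι → B) (b : κ → B)
    (ha : ∀ r p, Commute (F r) (a p)) :
    ∑ p, ∑ q, F (K p q) * (a p * ∑ s, F (C s q) * b s) = bil F (K * C.transpose) a b := by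
  simp only [bil, Matrix.mul_apply, map_sum, map_mul, Finset.sum_mul, Finset.mul_sum,
    Matrix.transpose_apply]
  refine Finset.sum_congr rfl fun p _ => ?_
  rw [Finset.sum_comm]
  refine Finset.sum_congr rfl fun s _ => Finset.sum_congr rfl fun q _ => ?_
  rw [← mul_assoc (a p), ← (ha _ p).eq]
  simp only [mul_assoc]

theorem tri_add (K K' : ι → κ → τ → R) (a : ι → B) (b : κ → B) (c : τ → B) :
    tri F K a b c + tri F K' a b c = tri F (fun p q s => K p q s + K' p q s) a b c := by
  simp only [tri, map_add, add_mul, Finset.sum_add_distrib]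

theorem tri_neg (K : ι → κ → τ → R) (a : ι → B) (b : κ → B) (c : τ → B) :
    -tri F K a b c = tri F (fun p q s => -K p q s) a b c := by
  simp only [tri, map_neg, neg_mul, Finset.sum_neg_distrib]

theorem tri_eq_zero {K : ι → κ → τ → R} (h : ∀ p q s, K p q s = 0)
    (a : ι → B) (b : κ → B) (c : τ → B) : tri F K a b c = 0 := by
  simp [tri, h]

theorem sum_comm_four {α β γ δ : Type*} [Fintype α] [Fintype β] [Fintype γ] [Fintype δ]
    {W : Type*} [AddCommMonoid W] (f : α → β → γ → δ → W) :
    ∑ a, ∑ b, ∑ c, ∑ d, f a b c d = ∑ d, ∑ c, ∑ a, ∑ b, f a b c d := by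
  calc _ = ∑ a, ∑ b, ∑ d, ∑ c, f a b c d :=
        Finset.sum_congr rfl fun a _ => Finset.sum_congr rfl fun b _ => Finset.sum_comm
    _ = ∑ a, ∑ d, ∑ b, ∑ c, f a b c d := Finset.sum_congr rfl fun a _ => Finset.sum_comm
    _ = ∑ d, ∑ a, ∑ b, ∑ c, f a b c d := Finset.sum_comm
    _ = ∑ d, ∑ a, ∑ c, ∑ b, f a b c d :=
        Finset.sum_congr rfl fun a _ => Finset.sum_congr rfl fun b _ => Finset.sum_comm
    _ = _ := Finset.sum_congr rfl fun a _ => Finset.sum_comm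

variable (a : ι → B) (b : κ → B) (c : τ → B)

/-- The three contraction lemmas, one for each position of a bracket, collect a fourfold sum with an
expanded bracket into a single `tri`. Coefficients can then be compared entry by entry. -/
theorem tri_contract_mid (g : Matrix σ ι R) (g' : Matrix τ σ R) (h : σ → σ → κ → R)
    (ha : ∀ r p, Commute (F r) (a p)) :
    ∑ p, ∑ q, ∑ p', ∑ q', F (g q p) * (F (g' q' p') *
      (a p * ((∑ s, F (h q p' s) * b s) * c q'))) =
    tri F (fun p s q' => ∑ q, ∑ p', g q p * (g' q' p' * h q p' s)) a b c := by
  simp only [tri, map_sum, map_mul, Finset.sum_mul, Finset.mul_sum]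
  refine Finset.sum_congr rfl fun p _ => ?_
  rw [sum_comm_four]
  refine Finset.sum_congr rfl fun s _ => Finset.sum_congr rfl fun q' _ =>
    Finset.sum_congr rfl fun q _ => Finset.sum_congr rfl fun p' _ => ?_
  rw [mul_assoc (F (h q p' s)), ← mul_assoc (a p), ← (ha _ p).eq]
  simp only [mul_assoc]

theorem tri_contract_right (g : Matrix σ ι R) (g' : Matrix σ κ R) (h : σ → σ → τ → R)
    (ha : ∀ r p, Commute (F r) (a p)) (hb : ∀ r p, Commute (F r) (b p)) :
    ∑ p, ∑ q, ∑ p', ∑ q', F (g q p) * (F (g' q' p') *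
      (a p * (b p' * ∑ s, F (h q q' s) * c s))) =
    tri F (fun p p' s => ∑ q, ∑ q', g q p * (g' q' p' * h q q' s)) a b c := by
  simp only [tri, map_sum, map_mul, Finset.sum_mul, Finset.mul_sum]
  refine Finset.sum_congr rfl fun p _ => ?_
  rw [Finset.sum_comm]
  refine Finset.sum_congr rfl fun p' _ => ?_
  calc _ = ∑ q, ∑ s, ∑ q', F (g q p) * (F (g' q' p') * (a p * (b p' * (F (h q q' s) * c s)))) :=
        Finset.sum_congr rfl fun q _ => Finset.sum_comm
    _ = ∑ s, ∑ q, ∑ q', F (g q p) * (F (g' q' p') * (a p * (b p' * (F (h q q' s) * c s)))) :=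
        Finset.sum_comm
    _ = _ := by
      refine Finset.sum_congr rfl fun s _ => Finset.sum_congr rfl fun q _ =>
        Finset.sum_congr rfl fun q' _ => ?_
      rw [← mul_assoc (b p'), ← (hb _ p').eq, ← mul_assoc (a p), ← mul_assoc (a p), ← (ha _ p).eq]
      simp only [mul_assoc]

theorem tri_contract_left (g : Matrix τ σ R) (g' : Matrix σ κ R) (h : σ → σ → ι → R) :
    ∑ p, ∑ q, ∑ p', ∑ q', F (g q p) * (F (g' q' p') *
      ((∑ s, F (h p q' s) * a s) * (b p' * c q))) =
    tri F (fun s p' q => ∑ p, ∑ q', g q p * (g' q' p' * h p q' s)) a b c := by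
  simp only [tri, map_sum, map_mul, Finset.sum_mul, Finset.mul_sum]
  calc _ = ∑ p, ∑ q, ∑ p', ∑ s, ∑ q', F (g q p) * (F (g' q' p') *
        (F (h p q' s) * a s * (b p' * c q))) :=
        Finset.sum_congr rfl fun p _ => Finset.sum_congr rfl fun q _ =>
          Finset.sum_congr rfl fun p' _ => Finset.sum_comm
    _ = ∑ s, ∑ p', ∑ p, ∑ q, ∑ q', F (g q p) * (F (g' q' p') *
        (F (h p q' s) * a s * (b p' * c q))) := sum_comm_four _
    _ = ∑ s, ∑ p', ∑ q, ∑ p, ∑ q', F (g q p) * (F (g' q' p') *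
        (F (h p q' s) * a s * (b p' * c q))) :=
        Finset.sum_congr rfl fun p _ => Finset.sum_congr rfl fun q _ => Finset.sum_comm
    _ = _ := by
      refine Finset.sum_congr rfl fun s _ => Finset.sum_congr rfl fun p' _ =>
        Finset.sum_congr rfl fun q _ => Finset.sum_congr rfl fun p _ =>
        Finset.sum_congr rfl fun q' _ => ?_
      simp only [mul_assoc]

theorem sum_sum_antisymm {W : Type*} [AddCommGroup W] [Module ℂ W] (T : ι → ι → W)
    (h : ∀ p q, T p q = -T q p) : ∑ p, ∑ q, T p q = 0 := by
  have h1 : ∑ p, ∑ q, T p q = - ∑ p, ∑ q, T p q := by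
    conv_lhs => rw [Finset.sum_comm]
    rw [← Finset.sum_neg_distrib]
    refine Finset.sum_congr rfl fun p _ => ?_
    rw [← Finset.sum_neg_distrib]
    exact Finset.sum_congr rfl fun q _ => h q p
  have h2 : (2 : ℂ) • ∑ p, ∑ q, T p q = 0 := by
    rw [two_smul]
    nth_rw 1 [h1]
    exact neg_add_cancel _
  exact (smul_eq_zero_iff_right two_ne_zero).1 h2

end Multilinear

/-! ### Invariance of the image of `y_i` -/

namespace OrthonormalFrame

variable {Γ : Type*} [AddCommGroup Γ] [Fintype Γ] {𝔤 : Type*} [LieRing 𝔤] [LieAlgebra ℂ 𝔤]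
variable {E : EquivariantTensor Γ 𝔤} {D : ReductiveDecomposition E} (S : OrthonormalFrame D)
variable (n : ℕ)

theorem cR_transpose (ν) : (S.cR ν).transpose = - S.cR ν := by
  ext p q
  rw [Matrix.transpose_apply, cR_apply, S.c_swap, map_neg]
  rfl

theorem yv_eq_bil (i : Fin n) : S.yv n i = - ∑ ν, D.d n (S.e ν) * D.leg n i (S.e ν) +
    bil (D.F n) S.G.transpose (fun p => D.leg n i (S.m p)) (fun q => D.tot n (S.m q)) := rfl

theorem bil_mem_invariants (i : Fin n) :
    bil (D.F n) S.G.transpose (fun p => D.leg n i (S.m p)) (fun q => D.tot n (S.m q)) ∈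
      D.invariants n := by
  rw [D.mem_invariants_iff n S.e]
  intro ν
  have h : ∀ p q, D.Y n (S.e ν) *
      (D.F n (S.G.transpose p q) * (D.leg n i (S.m p) * D.tot n (S.m q))) =
      (D.F n (S.G.transpose p q) * (D.leg n i (S.m p) * D.tot n (S.m q))) * D.Y n (S.e ν) +
      (D.F n (((S.G * S.cR ν - S.cR ν * S.G).transpose) p q) *
        (D.leg n i (S.m p) * D.tot n (S.m q)) +
      D.F n (S.G.transpose p q) * ((∑ s, D.F n (S.cR ν s p) * D.leg n i (S.m s)) * D.tot n (S.m q) +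
        D.leg n i (S.m p) * ∑ s, D.F n (S.cR ν s q) * D.tot n (S.m s))) := by
    intro p q
    rw [commutator_mul (S.Y_F n ν _) (commutator_mul (D.Y_leg n _ i _) (D.Y_tot n _ _)),
      Matrix.transpose_apply, S.rot_G, leg_lie_e_m, tot_lie_e_m]
    rfl
  rw [bil, commutator_sum fun p _ => commutator_sum fun q _ => h p q]
  simp only [Finset.sum_add_distrib, mul_add]
  rw [bil_mul_left (D.F n) (S.cR ν) (fun s => D.leg n i (S.m s)) (fun q => D.tot n (S.m q)),
    bil_mul_right (D.F n) _ (S.cR ν) (fun s => D.leg n i (S.m s)) (fun q => D.tot n (S.m q))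
      (fun r p => D.F_leg n r i _)]
  change _ + (bil (D.F n) ((S.G * S.cR ν - S.cR ν * S.G).transpose) (fun s => D.leg n i (S.m s))
    (fun q => D.tot n (S.m q)) + (_ + _)) = _
  rw [← bil_add, ← bil_add]
  -- The rotation of the coefficients `G` cancels the rotations of the two legs, because `c ν` is
  -- antisymmetric.
  have h0 : (S.G * S.cR ν - S.cR ν * S.G).transpose + (S.cR ν * S.G.transpose +
      S.G.transpose * (S.cR ν).transpose) = 0 := by
    rw [Matrix.transpose_sub, Matrix.transpose_mul, Matrix.transpose_mul, S.cR_transpose]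
    noncomm_ring
  rw [h0, bil_zero, add_zero]

theorem yv_mem_invariants (i : Fin n) : S.yv n i ∈ D.invariants n := by
  rw [yv_eq_bil]
  exact add_mem (neg_mem (S.d_leg_mem_invariants n i)) (S.bil_mem_invariants n i)

end OrthonormalFrame

/-! ### Commutators of products in a ring -/

section

variable {B : Type*} [Ring B]

theorem sum_commutator {ι : Type*} {s : Finset ι} {z : B} {a a' : ι → B}
    (h : ∀ i ∈ s, a i * z = z * a i + a' i) :
    (∑ i ∈ s, a i) * z = z * (∑ i ∈ s, a i) + ∑ i ∈ s, a' i := by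
  rw [Finset.mul_sum, Finset.sum_mul, ← Finset.sum_add_distrib]
  exact Finset.sum_congr rfl h

/-- Used with `d = ∂_ν`, `e = e_ν^{(i)}`, `f` an entry of `G`, `m = m_p^{(j)}` and `t = tot m_q`:
only the pairs `d, f` and `e, t` fail to commute. -/
theorem commutator_der_term {d f f' e m t w : B} (hdf : d * f = f * d + f') (hef : Commute e f)
    (hem : Commute e m) (hdm : Commute d m) (hdt : Commute d t) (het : e * t = t * e + w) :
    d * e * (f * (m * t)) = f * (m * t) * (d * e) + (f' * (e * (m * t)) + f * (d * (m * w))) := by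
  have h1 := hef.eq
  have h2 := hem.eq
  have h3 := hdm.eq
  have h4 := hdt.eq
  calc d * e * (f * (m * t)) = d * (e * f) * m * t := by noncomm_ring
    _ = d * f * (e * m) * t := by rw [h1]; noncomm_ring
    _ = f * d * (e * m) * t + f' * (e * m) * t := by rw [hdf]; noncomm_ring
    _ = f * (d * m) * (e * t) + f' * (e * m) * t := by rw [h2]; noncomm_ring
    _ = f * m * (d * t) * e + f * m * d * w + f' * (e * m) * t := by rw [het, h3]; noncomm_ring
    _ = f * m * t * d * e + f * (m * d) * w + f' * (e * m) * t := by rw [h4]; noncomm_ring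
    _ = _ := by rw [← h3]; noncomm_ring

/-- Used with `a`, `c` elements of `𝔪` in distinct legs and `b`, `d` diagonal elements; `x`, `y`,
`z` are the three nonzero brackets. -/
theorem commutator_mul_mul {a b c d x y z : B} (hac : Commute a c) (hbc : b * c = c * b + x)
    (hbd : b * d = d * b + y) (had : a * d = d * a + z) (hcz : Commute c z) :
    a * b * (c * d) = c * d * (a * b) + (a * (x * d) + (a * (c * y) + z * (c * b))) := by
  have h1 := hac.eq
  have h2 := hcz.eq
  calc a * b * (c * d) = a * (b * c) * d := by noncomm_ring
    _ = a * c * (b * d) + a * x * d := by rw [hbc]; noncomm_ring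
    _ = c * (a * d) * b + a * c * y + a * x * d := by
      rw [hbd, mul_add, ← mul_assoc (a * c) d, h1]; noncomm_ring
    _ = c * d * a * b + (c * z) * b + a * c * y + a * x * d := by rw [had]; noncomm_ring
    _ = _ := by rw [h2]; noncomm_ring

theorem commutator_fn_mul {f g u v w : B} (hfg : Commute f g) (hfv : Commute f v)
    (hgu : Commute g u) (h : u * v = v * u + w) :
    f * u * (g * v) = g * v * (f * u) + f * (g * w) := by
  calc f * u * (g * v) = f * (u * g) * v := by noncomm_ring
    _ = f * g * (u * v) := by rw [← hgu.eq]; noncomm_ring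
    _ = f * g * v * u + f * (g * w) := by rw [h]; noncomm_ring
    _ = g * (f * v) * u + f * (g * w) := by rw [hfg.eq]; noncomm_ring
    _ = _ := by rw [hfv.eq]; noncomm_ring

end

/-! ### Identities between `G` and the structure constants of `𝔪` -/

namespace OrthonormalFrame

variable {Γ : Type*} [AddCommGroup Γ] [Fintype Γ] {𝔤 : Type*} [LieRing 𝔤] [LieAlgebra ℂ 𝔤]
variable {E : EquivariantTensor Γ 𝔤} {D : ReductiveDecomposition E} (S : OrthonormalFrame D)
variable (n : ℕ)

/-- Structure constants of `𝔪` as functions. -/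
def φR (p q s : Fin S.dimM) : D.RegFun := algebraMap ℂ _ (S.φ p q s)

theorem φR_swap (p q s) : S.φR p q s = - S.φR q p s := by rw [φR, S.φ_swap, map_neg]; rfl

theorem φR_rotate (p q s) : S.φR p q s = S.φR q s p := by rw [φR, S.φ_rotate]; rfl

theorem φR_swap_right (p q s) : S.φR p q s = - S.φR p s q := by
  rw [S.φR_rotate, S.φR_swap, ← S.φR_rotate p]

theorem φR_self (p s) : S.φR p p s = 0 := by
  have h : S.φ p p s = 0 := by simp [φ]
  rw [φR, h, map_zero]

theorem L_apply (p q) : S.L p q = ∑ ν, D.coord (S.e ν) * S.cR ν p q := by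
  rw [L_eq', Matrix.sum_apply]; rfl

/-- Multiply `φ_invariant` by the coordinate of `e_ν` and sum: this is invariance under the generic
element `λ^∨`. -/
theorem φR_invariant (p q s) :
    ∑ u, S.L u p * S.φR u q s + ∑ u, S.L u q * S.φR p u s + ∑ u, S.L u s * S.φR p q u = 0 := by
  have h := fun ν => congrArg (algebraMap ℂ D.RegFun) (S.φ_invariant ν p q s)
  simp only [map_sum, map_add, map_mul, map_zero] at h
  rw [← Finset.sum_add_distrib, ← Finset.sum_add_distrib]
  simp only [L_apply, Finset.sum_mul, ← Finset.sum_add_distrib, mul_assoc, ← mul_add]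
  rw [Finset.sum_comm]
  simp only [← Finset.mul_sum]
  exact Finset.sum_eq_zero fun ν _ => by
    rw [show ∑ u, (S.cR ν u p * S.φR u q s + S.cR ν u q * S.φR p u s + S.cR ν u s * S.φR p q u) = 0
      from h ν, mul_zero]

theorem sum_L_G (u b : Fin S.dimM) : ∑ q, S.L u q * S.G q b = if u = b then 1 else 0 := by
  rw [← Matrix.mul_apply, L_mul_G, Matrix.one_apply]

/-- The trilinear form `φ` vanishes on `(G, G, id)` after cyclic summation. -/
theorem dynamical_yangBaxter (a b d : Fin S.dimM) :
    ∑ q, ∑ s, S.G q b * (S.G s d * S.φR a q s) + ∑ p, ∑ s, S.G p a * (S.G s d * S.φR p b s) +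
      ∑ p, ∑ q, S.G p a * (S.G q b * S.φR p q d) = 0 := by
  -- Contract invariance under `L` with three copies of `G`. In each of the three terms `L` cancels
  -- one `G`, leaving the other two.
  have h : ∑ p, ∑ q, ∑ s, S.G p a * (S.G q b * (S.G s d * (∑ u, S.L u p * S.φR u q s +
      ∑ u, S.L u q * S.φR p u s + ∑ u, S.L u s * S.φR p q u))) = 0 := by
    simp [S.φR_invariant]
  simp only [mul_add, Finset.sum_add_distrib] at h
  have h1 : ∑ p, ∑ q, ∑ s, S.G p a * (S.G q b * (S.G s d * ∑ u, S.L u p * S.φR u q s)) =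
      ∑ q, ∑ s, S.G q b * (S.G s d * S.φR a q s) := by
    rw [Finset.sum_comm]
    refine Finset.sum_congr rfl fun q _ => ?_
    rw [Finset.sum_comm]
    refine Finset.sum_congr rfl fun s _ => ?_
    have : S.φR a q s = ∑ p, ∑ u, S.G p a * (S.L u p * S.φR u q s) := by
      rw [Finset.sum_comm]
      have h2 : ∀ u, ∑ p, S.G p a * (S.L u p * S.φR u q s) =
          (∑ p, S.L u p * S.G p a) * S.φR u q s := fun u => by
        rw [Finset.sum_mul]; exact Finset.sum_congr rfl fun p _ => by ring
      simp [h2, S.sum_L_G]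
    rw [this]
    simp only [Finset.mul_sum]
    exact Finset.sum_congr rfl fun p _ => Finset.sum_congr rfl fun u _ => by ring
  have h2 : ∑ p, ∑ q, ∑ s, S.G p a * (S.G q b * (S.G s d * ∑ u, S.L u q * S.φR p u s)) =
      ∑ p, ∑ s, S.G p a * (S.G s d * S.φR p b s) := by
    refine Finset.sum_congr rfl fun p _ => ?_
    rw [Finset.sum_comm]
    refine Finset.sum_congr rfl fun s _ => ?_
    have : S.φR p b s = ∑ q, ∑ u, S.G q b * (S.L u q * S.φR p u s) := by
      rw [Finset.sum_comm]
      have h2 : ∀ u, ∑ q, S.G q b * (S.L u q * S.φR p u s) =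
          (∑ q, S.L u q * S.G q b) * S.φR p u s := fun u => by
        rw [Finset.sum_mul]; exact Finset.sum_congr rfl fun p _ => by ring
      simp [h2, S.sum_L_G]
    rw [this]
    simp only [Finset.mul_sum]
    exact Finset.sum_congr rfl fun p _ => Finset.sum_congr rfl fun u _ => by ring
  have h3 : ∑ p, ∑ q, ∑ s, S.G p a * (S.G q b * (S.G s d * ∑ u, S.L u s * S.φR p q u)) =
      ∑ p, ∑ q, S.G p a * (S.G q b * S.φR p q d) := by
    refine Finset.sum_congr rfl fun p _ => Finset.sum_congr rfl fun q _ => ?_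
    have : S.φR p q d = ∑ s, ∑ u, S.G s d * (S.L u s * S.φR p q u) := by
      rw [Finset.sum_comm]
      have h2 : ∀ u, ∑ s, S.G s d * (S.L u s * S.φR p q u) =
          (∑ s, S.L u s * S.G s d) * S.φR p q u := fun u => by
        rw [Finset.sum_mul]; exact Finset.sum_congr rfl fun p _ => by ring
      simp [h2, S.sum_L_G]
    rw [this]
    simp only [Finset.mul_sum]
  rw [h1, h2, h3] at h
  exact h

/-- Contracting `φR_invariant` with one `G` leaves only `L` applied to this vector: in the first two
terms `L G = 1` produces `φ` with repeated arguments, which vanishes. Since `L` is invertible, the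
vector is zero. -/
theorem sum_G_φR (s : Fin S.dimM) : ∑ p, ∑ q, S.G q p * S.φR p q s = 0 := by
  set U : Fin S.dimM → D.RegFun := fun s => ∑ p, ∑ q, S.G q p * S.φR p q s with hU
  have hLU : ∀ s, ∑ u, S.L u s * U u = 0 := by
    intro s
    have h : ∑ p, ∑ q, S.G q p * (∑ u, S.L u p * S.φR u q s +
      ∑ u, S.L u q * S.φR p u s + ∑ u, S.L u s * S.φR p q u) = 0 := by
      simp [S.φR_invariant]
    simp only [mul_add, Finset.sum_add_distrib] at h
    have h1 : ∑ p, ∑ q, S.G q p * ∑ u, S.L u p * S.φR u q s = 0 := by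
      rw [Finset.sum_comm]
      refine Finset.sum_eq_zero fun q _ => ?_
      simp only [Finset.mul_sum]
      rw [Finset.sum_comm]
      have h2 : ∀ u, ∑ p, S.G q p * (S.L u p * S.φR u q s) =
          -((∑ p, S.L u p * S.G p q) * S.φR u q s) := fun u => by
        rw [Finset.sum_mul, ← Finset.sum_neg_distrib]
        exact Finset.sum_congr rfl fun p _ => by rw [S.G_swap q p]; ring
      simp [h2, S.sum_L_G, S.φR_self]
    have h2 : ∑ p, ∑ q, S.G q p * ∑ u, S.L u q * S.φR p u s = 0 := by
      refine Finset.sum_eq_zero fun p _ => ?_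
      simp only [Finset.mul_sum]
      rw [Finset.sum_comm]
      have h2 : ∀ u, ∑ q, S.G q p * (S.L u q * S.φR p u s) =
          (∑ q, S.L u q * S.G q p) * S.φR p u s := fun u => by
        rw [Finset.sum_mul]
        exact Finset.sum_congr rfl fun p _ => by ring
      simp [h2, S.sum_L_G, S.φR_self]
    rw [h1, h2, zero_add, zero_add] at h
    rw [← h]
    simp only [hU, Finset.mul_sum]
    calc _ = ∑ p, ∑ u, ∑ q, S.L u s * (S.G q p * S.φR p q u) := Finset.sum_comm
      _ = ∑ p, ∑ q, ∑ u, S.L u s * (S.G q p * S.φR p q u) :=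
        Finset.sum_congr rfl fun p _ => Finset.sum_comm
      _ = _ := Finset.sum_congr rfl fun p _ => Finset.sum_congr rfl fun q _ =>
        Finset.sum_congr rfl fun u _ => by ring
  change U s = 0
  have : U s = ∑ t, S.G t s * ∑ u, S.L u t * U u := by
    simp only [Finset.mul_sum]
    rw [Finset.sum_comm]
    have h2 : ∀ u, ∑ t, S.G t s * (S.L u t * U u) = (∑ t, S.L u t * S.G t s) * U u := fun u => by
      rw [Finset.sum_mul]
      exact Finset.sum_congr rfl fun p _ => by ring
    simp [h2, S.sum_L_G]
  rw [this]
  simp [hLU]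

end OrthonormalFrame

/-! ### Reordering and contracting trilinear expressions -/

section

variable {R B : Type*} [CommRing R] [Ring B] [Algebra ℂ R] [Algebra ℂ B]
variable {ι κ τ σ : Type*} [Fintype ι] [Fintype κ] [Fintype τ] [Fintype σ]
variable (F : R →ₐ[ℂ] B) (a : ι → B) (b : κ → B) (c : τ → B)

theorem tri_swap_left (K : ι → κ → τ → R) (h : ∀ p q, Commute (a p) (b q)) :
    tri F K a b c = tri F (fun q p s => K p q s) b a c := by
  rw [tri, tri, Finset.sum_comm]
  refine Finset.sum_congr rfl fun q _ => Finset.sum_congr rfl fun p _ =>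
    Finset.sum_congr rfl fun s _ => ?_
  rw [← mul_assoc (a p), (h p q).eq, mul_assoc]

theorem tri_swap_right (K : ι → κ → τ → R) (h : ∀ q s, Commute (b q) (c s)) :
    tri F K a b c = tri F (fun p s q => K p q s) a c b := by
  refine Finset.sum_congr rfl fun p _ => ?_
  rw [Finset.sum_comm]
  refine Finset.sum_congr rfl fun s _ => Finset.sum_congr rfl fun q _ => ?_
  rw [(h q s).eq]

theorem tri_contract_der (g : Matrix σ κ R) (h : ι → τ → σ → R)
    (ha : ∀ ν s q, Commute (F (h ν s q)) (a ν)) (hb : ∀ r p, Commute (F r) (b p)) :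
    ∑ ν, ∑ p, ∑ q, F (g q p) * (a ν * (b p * ∑ s, F (h ν s q) * c s)) =
      tri F (fun ν p s => ∑ q, g q p * h ν s q) a b c := by
  simp only [tri, map_sum, map_mul, Finset.sum_mul, Finset.mul_sum]
  refine Finset.sum_congr rfl fun ν _ => Finset.sum_congr rfl fun p _ => ?_
  rw [Finset.sum_comm]
  refine Finset.sum_congr rfl fun s _ => Finset.sum_congr rfl fun q _ => ?_
  rw [← mul_assoc (b p), ← (hb _ p).eq, ← mul_assoc (a ν), ← mul_assoc (a ν), ← (ha ν s q).eq]
  simp only [mul_assoc]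

end

/-! ### Commutators of the two parts of `y_i` and `y_j` -/

namespace OrthonormalFrame

variable {Γ : Type*} [AddCommGroup Γ] [Fintype Γ] {𝔤 : Type*} [LieRing 𝔤] [LieAlgebra ℂ 𝔤]
variable {E : EquivariantTensor Γ 𝔤} {D : ReductiveDecomposition E} (S : OrthonormalFrame D)
variable (n : ℕ)

theorem F_cR_d (ν p q μ) : Commute (D.F n (S.cR ν p q)) (D.d n (S.e μ)) := by
  rw [cR_apply, AlgHom.commutes]
  exact Algebra.commutes _ _

/-- `∑_ν ∂̄_ν e_ν^{(i)}` -/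
def dl (i : Fin n) : D.B n := ∑ ν, D.d n (S.e ν) * D.leg n i (S.e ν)

/-- `∑_k r^{(ik)}` -/
def rl (i : Fin n) : D.B n :=
  bil (D.F n) S.G.transpose (fun p => D.leg n i (S.m p)) (fun q => D.tot n (S.m q))

theorem rl_eq (i : Fin n) : S.rl n i =
    ∑ p, ∑ q, D.F n (S.G q p) * (D.leg n i (S.m p) * D.tot n (S.m q)) := rfl

theorem yv_eq_sub (i : Fin n) : S.yv n i = S.rl n i - S.dl n i := neg_add_eq_sub _ _

theorem dl_comm {i j : Fin n} (hij : i ≠ j) : Commute (S.dl n i) (S.dl n j) := by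
  refine Commute.sum_left _ _ _ fun ν _ => Commute.sum_right _ _ _ fun μ _ => ?_
  exact ((D.d_d n _ _).mul_left (D.d_leg n _ i _).symm).mul_right
    ((D.d_leg n _ j _).mul_left (D.leg_comm n hij _ _))

/-- The two corrections come from `∂_ν` differentiating `G` and from `e_ν^{(i)}` acting on the
`i`-th summand of `tot m_q`. -/
theorem dl_rl {i j : Fin n} (hij : i ≠ j) : S.dl n i * S.rl n j = S.rl n j * S.dl n i +
    (tri (D.F n) (fun ν p q => D.der (S.e ν) (S.G q p)) (fun ν => D.leg n i (S.e ν))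
        (fun p => D.leg n j (S.m p)) (fun q => D.tot n (S.m q)) +
      tri (D.F n) (fun ν p s => ∑ q, S.G q p * S.cR ν s q) (fun ν => D.d n (S.e ν))
        (fun p => D.leg n j (S.m p)) (fun s => D.leg n i (S.m s))) := by
  have h : ∀ ν p q, D.d n (S.e ν) * D.leg n i (S.e ν) *
      (D.F n (S.G q p) * (D.leg n j (S.m p) * D.tot n (S.m q))) =
      D.F n (S.G q p) * (D.leg n j (S.m p) * D.tot n (S.m q)) *
        (D.d n (S.e ν) * D.leg n i (S.e ν)) +
      (D.F n (D.der (S.e ν) (S.G q p)) *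
        (D.leg n i (S.e ν) * (D.leg n j (S.m p) * D.tot n (S.m q))) +
      D.F n (S.G q p) * (D.d n (S.e ν) * (D.leg n j (S.m p) *
        ∑ s, D.F n (S.cR ν s q) * D.leg n i (S.m s)))) := by
    intro ν p q
    rw [← leg_lie_e_m]
    exact commutator_der_term (D.d_F n _ _) (D.F_leg n _ i _).symm (D.leg_comm n hij _ _)
      (D.d_leg n _ j _) (D.d_tot n _ _) (D.leg_tot n i _ _)
  rw [← tri_contract_der (D.F n) (fun ν => D.d n (S.e ν)) (fun p => D.leg n j (S.m p))
    (fun s => D.leg n i (S.m s)) S.G (fun ν s q => S.cR ν s q)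
    (fun ν s q => S.F_cR_d n ν s q ν) (fun r p => D.F_leg n r j _), dl, tri, rl_eq,
    ← Finset.sum_add_distrib]
  refine sum_commutator fun ν _ => ?_
  rw [← Finset.sum_add_distrib]
  refine commutator_sum fun p _ => ?_
  rw [← Finset.sum_add_distrib]
  exact commutator_sum fun q _ => h ν p q

/-- Three pairs fail to commute: `tot` with leg `j`, `tot` with `tot`, and leg `i` with `tot`. Each
bracket in `⁅𝔪, 𝔪⁆` splits into an `𝔪` part with coefficients `φ` and an `𝔥` part with coefficients
`c`, hence six terms. -/
theorem rl_rl {i j : Fin n} (hij : i ≠ j) : S.rl n i * S.rl n j = S.rl n j * S.rl n i +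
    (tri (D.F n) (fun p s q' => ∑ q, ∑ p', S.G q p * (S.G q' p' * S.φR q p' s))
        (fun p => D.leg n i (S.m p)) (fun p => D.leg n j (S.m p)) (fun q => D.tot n (S.m q)) -
      tri (D.F n) (fun p ν q' => ∑ q, ∑ p', S.G q p * (S.G q' p' * S.cR ν q p'))
        (fun p => D.leg n i (S.m p)) (fun ν => D.leg n j (S.e ν)) (fun q => D.tot n (S.m q)) +
    (tri (D.F n) (fun p p' s => ∑ q, ∑ q', S.G q p * (S.G q' p' * S.φR q q' s))
        (fun p => D.leg n i (S.m p)) (fun p => D.leg n j (S.m p)) (fun q => D.tot n (S.m q)) -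
      tri (D.F n) (fun p p' ν => ∑ q, ∑ q', S.G q p * (S.G q' p' * S.cR ν q q'))
        (fun p => D.leg n i (S.m p)) (fun p => D.leg n j (S.m p)) (fun ν => D.tot n (S.e ν)) +
    (tri (D.F n) (fun s p' q => ∑ p, ∑ q', S.G q p * (S.G q' p' * S.φR p q' s))
        (fun p => D.leg n i (S.m p)) (fun p => D.leg n j (S.m p)) (fun q => D.tot n (S.m q)) -
      tri (D.F n) (fun ν p' q => ∑ p, ∑ q', S.G q p * (S.G q' p' * S.cR ν p q'))
        (fun ν => D.leg n i (S.e ν)) (fun p => D.leg n j (S.m p)) (fun q => D.tot n (S.m q))))) := by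
  have h : ∀ p q p' q', D.F n (S.G q p) * (D.leg n i (S.m p) * D.tot n (S.m q)) *
      (D.F n (S.G q' p') * (D.leg n j (S.m p') * D.tot n (S.m q'))) =
      D.F n (S.G q' p') * (D.leg n j (S.m p') * D.tot n (S.m q')) *
        (D.F n (S.G q p) * (D.leg n i (S.m p) * D.tot n (S.m q))) +
      D.F n (S.G q p) * (D.F n (S.G q' p') *
        (D.leg n i (S.m p) * (D.leg n j ⁅(S.m q : 𝔤), (S.m p' : 𝔤)⁆ * D.tot n (S.m q')) +
        (D.leg n i (S.m p) * (D.leg n j (S.m p') * D.tot n ⁅(S.m q : 𝔤), (S.m q' : 𝔤)⁆) +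
          D.leg n i ⁅(S.m p : 𝔤), (S.m q' : 𝔤)⁆ * (D.leg n j (S.m p') * D.tot n (S.m q))))) := by
    intro p q p' q'
    exact commutator_fn_mul (D.F_F n _ _) ((D.F_leg n _ j _).mul_right (D.F_tot n _ _))
      ((D.F_leg n _ i _).mul_right (D.F_tot n _ _))
      (commutator_mul_mul (D.leg_comm n hij _ _) (D.tot_leg n j _ _) (D.tot_lie n _ _)
        (D.leg_tot n i _ _) (D.leg_comm n hij.symm _ _))
  have hF : ∀ k r p, Commute (D.F n r) (D.leg n k (S.m p)) := fun k r p => D.F_leg n r k _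
  have e : S.rl n i * S.rl n j = S.rl n j * S.rl n i + ∑ p, ∑ q, ∑ p', ∑ q',
      D.F n (S.G q p) * (D.F n (S.G q' p') *
        (D.leg n i (S.m p) * (D.leg n j ⁅(S.m q : 𝔤), (S.m p' : 𝔤)⁆ * D.tot n (S.m q')) +
        (D.leg n i (S.m p) * (D.leg n j (S.m p') * D.tot n ⁅(S.m q : 𝔤), (S.m q' : 𝔤)⁆) +
          D.leg n i ⁅(S.m p : 𝔤), (S.m q' : 𝔤)⁆ * (D.leg n j (S.m p') * D.tot n (S.m q))))) := by
    rw [rl_eq, rl_eq]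
    exact sum_commutator fun p _ => sum_commutator fun q _ => commutator_sum fun p' _ =>
      commutator_sum fun q' _ => h p q p' q'
  rw [e]
  simp only [leg_lie_m_m, tot_lie_m_m, mul_add, mul_sub, sub_mul, Finset.sum_add_distrib,
    Finset.sum_sub_distrib]
  rw [← tri_contract_mid (D.F n) _ _ _ S.G S.G S.φR (hF i),
    ← tri_contract_mid (D.F n) _ _ _ S.G S.G (fun q p' ν => S.cR ν q p') (hF i),
    ← tri_contract_right (D.F n) _ _ _ S.G S.G S.φR (hF i) (hF j),
    ← tri_contract_right (D.F n) _ _ _ S.G S.G (fun q q' ν => S.cR ν q q') (hF i) (hF j),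
    ← tri_contract_left (D.F n) _ _ _ S.G S.G S.φR,
    ← tri_contract_left (D.F n) _ _ _ S.G S.G (fun q q' ν => S.cR ν q q')]
  rfl

end OrthonormalFrame

/-! ### The relations modulo the left ideal of the `Ȳ_a` -/

namespace OrthonormalFrame

variable {Γ : Type*} [AddCommGroup Γ] [Fintype Γ] {𝔤 : Type*} [LieRing 𝔤] [LieAlgebra ℂ 𝔤]
variable {E : EquivariantTensor Γ 𝔤} {D : ReductiveDecomposition E} (S : OrthonormalFrame D)
variable (n : ℕ)

theorem G_cR_G_apply (ν a b) :
    (S.G * S.cR ν * S.G) a b = ∑ p, ∑ q, S.G a p * (S.cR ν p q * S.G q b) := by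
  simp only [Matrix.mul_apply, Finset.sum_mul]
  rw [Finset.sum_comm]
  exact Finset.sum_congr rfl fun p _ => Finset.sum_congr rfl fun q _ => by ring

theorem G_cR_G_swap (ν a b) : (S.G * S.cR ν * S.G) a b = - (S.G * S.cR ν * S.G) b a := by
  have h : (S.G * S.cR ν * S.G).transpose = - (S.G * S.cR ν * S.G) := by
    rw [Matrix.transpose_mul, Matrix.transpose_mul, S.cR_transpose, S.G_transpose]
    noncomm_ring
  exact congrFun (congrFun h b) a

theorem coord_lie_swap (ν μ) : D.coord ⁅S.e ν, S.e μ⁆ = - D.coord ⁅S.e μ, S.e ν⁆ := by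
  rw [← lie_skew, map_neg]

/-- This is `rot_G` with the derivatives of `G` written out; the sign from `der_G_apply` cancels the
one from swapping the bracket. -/
theorem sum_coord_G_cR_G (μ : Fin S.dimH) (p q) :
    ∑ ν, (S.G * S.cR ν * S.G) p q * D.coord ⁅S.e ν, S.e μ⁆ =
      (S.G * S.cR μ - S.cR μ * S.G) p q := by
  rw [← S.rot_G, rot_apply]
  refine Finset.sum_congr rfl fun ν _ => ?_
  rw [S.der_G_apply, S.coord_lie_swap ν μ]
  ring

theorem tot_e_eq (ν) : D.tot n (S.e ν) = D.Y n (S.e ν) -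
    ∑ μ, D.F n (D.coord ⁅S.e ν, S.e μ⁆) * D.d n (S.e μ) := by
  rw [D.Y_eq, S.op_XOp_e, add_sub_cancel_left]

/-- Replacing `tot e_ν` by `-X̄_ν` modulo the left ideal generated by the `Ȳ_a`. -/
theorem tri_tot_mem (i j : Fin n) (K : Fin S.dimM → Fin S.dimM → Fin S.dimH → D.RegFun) :
    tri (D.F n) K (fun p => D.leg n i (S.m p)) (fun p => D.leg n j (S.m p))
        (fun ν => D.tot n (S.e ν)) +
      tri (D.F n) (fun μ p q => ∑ ν, K p q ν * D.coord ⁅S.e ν, S.e μ⁆)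
        (fun μ => D.d n (S.e μ)) (fun p => D.leg n i (S.m p)) (fun p => D.leg n j (S.m p)) ∈
      Ideal.span (Set.range (D.Y n)) := by
  -- Functions and derivatives commute with the legs, so `X̄_ν` can be moved to the far right; there
  -- `tot e_ν + X̄_ν = Ȳ_ν` puts the sum in the left ideal.
  have h : tri (D.F n) (fun μ p q => ∑ ν, K p q ν * D.coord ⁅S.e ν, S.e μ⁆)
        (fun μ => D.d n (S.e μ)) (fun p => D.leg n i (S.m p)) (fun p => D.leg n j (S.m p)) =
      ∑ p, ∑ q, ∑ ν, D.F n (K p q ν) * (D.leg n i (S.m p) * (D.leg n j (S.m q) *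
        ∑ μ, D.F n (D.coord ⁅S.e ν, S.e μ⁆) * D.d n (S.e μ))) := by
    simp only [tri, map_sum, Finset.sum_mul, Finset.mul_sum]
    rw [Finset.sum_comm]
    refine Finset.sum_congr rfl fun p _ => ?_
    rw [Finset.sum_comm]
    refine Finset.sum_congr rfl fun q _ => ?_
    rw [Finset.sum_comm]
    refine Finset.sum_congr rfl fun ν _ => Finset.sum_congr rfl fun μ _ => ?_
    rw [map_mul, mul_assoc]
    congr 1
    rw [← mul_assoc (D.leg n j _), ← (D.F_leg n _ j _).eq, mul_assoc (D.F n _),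
      ← (D.d_leg n _ j _).eq, ← mul_assoc (D.leg n i _), ← (D.F_leg n _ i _).eq,
      mul_assoc (D.F n _), ← mul_assoc (D.leg n i _), ← (D.d_leg n _ i _).eq, mul_assoc (D.d n _)]
  rw [h, tri]
  simp only [← Finset.sum_add_distrib, ← mul_add, S.tot_e_eq, sub_add_cancel]
  refine Ideal.sum_mem _ fun p _ => Ideal.sum_mem _ fun q _ => Ideal.sum_mem _ fun ν _ => ?_
  simp only [← mul_assoc]
  exact Ideal.mul_mem_left _ _ (Ideal.subset_span ⟨_, rfl⟩)

/-- After expansion the terms are sorted by the factors they contain. Three types cancel identically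
in `B_n`; what is left is exactly an element supplied by `tri_tot_mem`. -/
theorem yv_comm_mem {i j : Fin n} (hij : i ≠ j) :
    S.yv n i * S.yv n j - S.yv n j * S.yv n i ∈ Ideal.span (Set.range (D.Y n)) := by
  have hMM : ∀ p q, Commute (D.leg n j (S.m p)) (D.leg n i (S.m q)) :=
    fun p q => D.leg_comm n hij.symm _ _
  have h1 := S.dl_rl n hij
  have h2 := S.dl_rl n hij.symm
  have h3 := S.rl_rl n hij
  have h4 := (S.dl_comm n hij).eq
  rw [tri_swap_right (D.F n) (fun ν => D.d n (S.e ν)) (fun p => D.leg n j (S.m p))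
    (fun s => D.leg n i (S.m s)) _ hMM] at h1
  rw [tri_swap_left (D.F n) (fun ν => D.leg n j (S.e ν)) (fun p => D.leg n i (S.m p))
    (fun q => D.tot n (S.m q)) _ (fun ν p => D.leg_comm n hij.symm _ _)] at h2
  -- Coefficient of `e^{(i)} m^{(j)} tot m`; it vanishes by `∂_ν G = -G c_ν G`, and so does that of
  -- `m^{(i)} e^{(j)} tot m` below.
  have hEMT : ∀ ν p q, -D.der (S.e ν) (S.G q p) +
      -(∑ u, ∑ v, S.G q u * (S.G v p * S.cR ν u v)) = 0 := by
    intro ν p q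
    rw [S.der_G_apply, G_cR_G_apply, neg_neg, add_neg_eq_zero]
    exact Finset.sum_congr rfl fun u _ => Finset.sum_congr rfl fun v _ => by ring
  have hMET : ∀ p ν q, D.der (S.e ν) (S.G q p) +
      -(∑ u, ∑ v, S.G u p * (S.G q v * S.cR ν u v)) = 0 := by
    intro p ν q
    rw [S.der_G_apply, G_cR_G_swap, G_cR_G_apply, neg_neg, add_neg_eq_zero]
    refine Finset.sum_congr rfl fun u _ => Finset.sum_congr rfl fun v _ => ?_
    rw [S.G_swap p u, S.G_swap v q]; ring
  -- Coefficient of `m^{(i)} m^{(j)} tot m`: up to the antisymmetries of `G` and `φ`, this is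
  -- `dynamical_yangBaxter`.
  have hMMM : ∀ p q s, (∑ u, ∑ v, S.G u p * (S.G s v * S.φR u v q)) +
      (∑ u, ∑ v, S.G u p * (S.G v q * S.φR u v s)) +
      (∑ u, ∑ v, S.G s u * (S.G v q * S.φR u v p)) = 0 := by
    intro p q s
    rw [← S.dynamical_yangBaxter p q s]
    have e1 : (∑ u, ∑ v, S.G u p * (S.G s v * S.φR u v q)) =
        ∑ u, ∑ v, S.G u p * (S.G v s * S.φR u q v) :=
      Finset.sum_congr rfl fun u _ => Finset.sum_congr rfl fun v _ => by
        rw [S.G_swap s v, S.φR_swap_right u v q]; ring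
    have e2 : (∑ u, ∑ v, S.G s u * (S.G v q * S.φR u v p)) =
        ∑ v, ∑ u, S.G v q * (S.G u s * S.φR p v u) := by
      rw [Finset.sum_comm]
      refine Finset.sum_congr rfl fun v _ => Finset.sum_congr rfl fun u _ => ?_
      rw [S.G_swap s u, ← S.φR_rotate, S.φR_swap_right p u v]; ring
    rw [e1, e2]; ring
  -- The coefficients of `∂_ν m^{(i)} m^{(j)}` coming from `dl_rl` agree with those produced when
  -- `tot e` is traded for `-X̄`; this is the equivariance of `G`.
  have hd : ∀ ν p q, -(∑ v, S.G v q * S.cR ν p v) + (∑ v, S.G v p * S.cR ν q v) =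
      ∑ μ, -(∑ u, ∑ v, S.G u p * (S.G v q * S.cR μ u v)) * D.coord ⁅S.e μ, S.e ν⁆ := by
    intro ν p q
    have e1 : ∀ μ, -(∑ u, ∑ v, S.G u p * (S.G v q * S.cR μ u v)) =
        (S.G * S.cR μ * S.G) p q := by
      intro μ
      rw [G_cR_G_apply, ← Finset.sum_neg_distrib]
      refine Finset.sum_congr rfl fun u _ => ?_
      rw [← Finset.sum_neg_distrib]
      exact Finset.sum_congr rfl fun v _ => by rw [S.G_swap u p]; ring
    simp only [e1, S.sum_coord_G_cR_G]
    rw [Matrix.sub_apply, Matrix.mul_apply, Matrix.mul_apply, sub_eq_neg_add]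
    congr 1
    · exact congrArg _ (Finset.sum_congr rfl fun v _ => mul_comm _ _)
    · refine Finset.sum_congr rfl fun v _ => ?_
      have : S.cR ν q v = - S.cR ν v q := congrFun (congrFun (S.cR_transpose ν) v) q
      rw [S.G_swap v p, this]; ring
  have hmem := S.tri_tot_mem n i j (fun p q ν => -(∑ u, ∑ v, S.G u p * (S.G v q * S.cR ν u v)))
  simp only [← hd] at hmem
  rw [← tri_add, ← tri_neg, ← tri_neg] at hmem
  convert hmem using 1
  have z1 := tri_eq_zero (D.F n) hEMT (fun ν => D.leg n i (S.e ν)) (fun p => D.leg n j (S.m p))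
    (fun q => D.tot n (S.m q))
  have z2 := tri_eq_zero (D.F n) hMET (fun p => D.leg n i (S.m p)) (fun ν => D.leg n j (S.e ν))
    (fun q => D.tot n (S.m q))
  have z3 := tri_eq_zero (D.F n) hMMM (fun p => D.leg n i (S.m p)) (fun p => D.leg n j (S.m p))
    (fun q => D.tot n (S.m q))
  rw [← tri_add, ← tri_neg, ← tri_neg] at z1
  rw [← tri_add, ← tri_neg] at z2
  rw [← tri_add, ← tri_add] at z3
  rw [yv_eq_sub, yv_eq_sub]
  have e : (S.rl n i - S.dl n i) * (S.rl n j - S.dl n j) -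
      (S.rl n j - S.dl n j) * (S.rl n i - S.dl n i) =
      (S.rl n i * S.rl n j - S.rl n j * S.rl n i) - (S.dl n i * S.rl n j - S.rl n j * S.dl n i) +
      (S.dl n j * S.rl n i - S.rl n i * S.dl n j) +
        (S.dl n i * S.dl n j - S.dl n j * S.dl n i) := by
    noncomm_ring
  rw [e, h4, h1, h2, h3]
  simp only [add_sub_cancel_left, sub_self, add_zero]
  linear_combination (norm := abel) z1 + z2 + z3

/-- Replacing `tot e_ν` by `Ȳ_ν` costs `∑ K ν · X̄_ν`, and the hypothesis says that each coefficient
of `∂_μ` in it is zero. -/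
theorem sum_tot_mem (K : Fin S.dimH → D.RegFun)
    (hK : ∀ μ, ∑ ν, K ν * D.coord ⁅S.e ν, S.e μ⁆ = 0) :
    ∑ ν, D.F n (K ν) * D.tot n (S.e ν) ∈ Ideal.span (Set.range (D.Y n)) := by
  have h : ∑ ν, D.F n (K ν) * ∑ μ, D.F n (D.coord ⁅S.e ν, S.e μ⁆) * D.d n (S.e μ) = 0 := by
    simp only [Finset.mul_sum, ← mul_assoc, ← map_mul]
    rw [Finset.sum_comm]
    simp only [← Finset.sum_mul, ← map_sum, hK, map_zero, zero_mul, Finset.sum_const_zero]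
  have h2 : ∑ ν, D.F n (K ν) * D.tot n (S.e ν) = ∑ ν, D.F n (K ν) * D.Y n (S.e ν) := by
    rw [← sub_eq_zero, ← neg_eq_zero, neg_sub, ← Finset.sum_sub_distrib, ← h]
    refine Finset.sum_congr rfl fun ν _ => ?_
    rw [S.tot_e_eq]
    noncomm_ring
  rw [h2]
  exact Ideal.sum_mem _ fun ν _ => Ideal.mul_mem_left _ _ (Ideal.subset_span ⟨_, rfl⟩)

theorem sum_xSum_mem (S : OrthonormalFrame D) :
    ∑ i, D.xSum n i ∈ Ideal.span (Set.range (D.Y n)) := by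
  have h : ∑ i, D.xSum n i = ∑ ν, D.F n (D.coord (S.e ν)) * D.tot n (S.e ν) := by
    simp only [S.xSum_eq, D.tot_apply, Finset.mul_sum]
    exact Finset.sum_comm
  rw [h]
  refine S.sum_tot_mem n _ fun μ => ?_
  simp only [S.coord_lie, Finset.mul_sum]
  -- The coefficient is the coordinate of `⁅λ^∨, e_μ⁆` at `λ`: an antisymmetric `f` against a
  -- symmetric product of coordinates.
  refine sum_sum_antisymm _ fun ν κ => ?_
  rw [S.f_rotate ν μ κ, S.f_swap μ κ ν, neg_smul, mul_neg]
  simp only [mul_smul_comm, mul_comm]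

theorem sum_d_tot_mem :
    ∑ ν, D.d n (S.e ν) * D.tot n (S.e ν) ∈ Ideal.span (Set.range (D.Y n)) := by
  have h : ∑ ν, D.d n (S.e ν) * ∑ μ, D.F n (D.coord ⁅S.e ν, S.e μ⁆) * D.d n (S.e μ) = 0 := by
    -- Here `∂_ν` stands to the left of the coefficients of `X̄_ν`. Moving it past them costs
    -- nothing, because `f ν μ ν = 0`.
    have h0 : ∀ ν μ, D.der (S.e ν) (D.coord ⁅S.e ν, S.e μ⁆) = 0 := by
      intro ν μ
      have hf : S.f ν μ ν = 0 := by rw [← S.f_rotate]; simp [f]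
      rw [S.coord_lie, map_sum]
      simp [S.der_e_coord, hf]
    simp only [Finset.mul_sum, ← mul_assoc, D.d_F, h0, map_zero, add_zero]
    refine sum_sum_antisymm _ fun ν μ => ?_
    rw [S.coord_lie_swap ν μ, map_neg, neg_mul, neg_mul, mul_assoc, mul_assoc, (D.d_d n _ _).eq]
  have h2 : ∑ ν, D.d n (S.e ν) * D.tot n (S.e ν) = ∑ ν, D.d n (S.e ν) * D.Y n (S.e ν) := by
    rw [← sub_eq_zero, ← neg_eq_zero, neg_sub, ← Finset.sum_sub_distrib, ← h]
    refine Finset.sum_congr rfl fun ν _ => ?_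
    rw [S.tot_e_eq]
    noncomm_ring
  rw [h2]
  exact Ideal.sum_mem _ fun ν _ => Ideal.mul_mem_left _ _ (Ideal.subset_span ⟨_, rfl⟩)

theorem trace_G_commutator (ν : Fin S.dimH) :
    (S.G * (S.L * S.cR ν - S.cR ν * S.L)).trace = 0 := by
  rw [mul_sub, Matrix.trace_sub, ← mul_assoc, S.G_mul_L, one_mul, ← mul_assoc,
    Matrix.trace_mul_comm, ← mul_assoc, S.L_mul_G, one_mul, sub_self]

/-- Antisymmetry of `G` turns twice the sum into a sum of brackets. Its `𝔪` part is zero by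
`sum_G_φR`; its `𝔥` part has coefficients `tr(G c_ν)`, whose invariance makes `sum_tot_mem`
applicable. -/
theorem sum_G_tot_tot_mem : ∑ p, ∑ q, D.F n (S.G q p) * (D.tot n (S.m p) * D.tot n (S.m q)) ∈
    Ideal.span (Set.range (D.Y n)) := by
  set W := ∑ p, ∑ q, D.F n (S.G q p) * (D.tot n (S.m p) * D.tot n (S.m q)) with hW
  have h1 : W + W = ∑ p, ∑ q, D.F n (S.G q p) * D.tot n ⁅(S.m p : 𝔤), (S.m q : 𝔤)⁆ := by
    have : W = ∑ p, ∑ q, -(D.F n (S.G q p) * (D.tot n (S.m q) * D.tot n (S.m p))) := by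
      rw [hW, Finset.sum_comm]
      refine Finset.sum_congr rfl fun p _ => Finset.sum_congr rfl fun q _ => ?_
      rw [S.G_swap p q, map_neg, neg_mul]
    nth_rw 2 [this]
    rw [hW, ← Finset.sum_add_distrib]
    refine Finset.sum_congr rfl fun p _ => ?_
    rw [← Finset.sum_add_distrib]
    refine Finset.sum_congr rfl fun q _ => ?_
    rw [D.tot_lie]
    noncomm_ring
  have h2 : W + W = -∑ ν, D.F n ((S.G * S.cR ν).trace) * D.tot n (S.e ν) := by
    rw [h1]
    simp only [tot_lie_m_m, mul_sub, Finset.mul_sum, ← mul_assoc, ← map_mul,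
      Finset.sum_sub_distrib]
    have e1 : ∑ p, ∑ q, ∑ s, D.F n (S.G q p * algebraMap ℂ _ (S.φ p q s)) * D.tot n (S.m s) = 0 := by
      calc _ = ∑ p, ∑ s, ∑ q, D.F n (S.G q p * S.φR p q s) * D.tot n (S.m s) :=
            Finset.sum_congr rfl fun p _ => Finset.sum_comm
        _ = ∑ s, ∑ p, ∑ q, D.F n (S.G q p * S.φR p q s) * D.tot n (S.m s) := Finset.sum_comm
        _ = 0 := by simp only [← Finset.sum_mul, ← map_sum, S.sum_G_φR, map_zero, zero_mul,
                      Finset.sum_const_zero]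
    have e2 : ∑ p, ∑ q, ∑ ν, D.F n (S.G q p * S.cR ν p q) * D.tot n (S.e ν) =
        ∑ ν, D.F n ((S.G * S.cR ν).trace) * D.tot n (S.e ν) := by
      calc _ = ∑ p, ∑ ν, ∑ q, D.F n (S.G q p * S.cR ν p q) * D.tot n (S.e ν) :=
            Finset.sum_congr rfl fun p _ => Finset.sum_comm
        _ = ∑ ν, ∑ p, ∑ q, D.F n (S.G q p * S.cR ν p q) * D.tot n (S.e ν) := Finset.sum_comm
        _ = _ := by
          refine Finset.sum_congr rfl fun ν _ => ?_
          simp only [← Finset.sum_mul, ← map_sum]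
          congr 2
          rw [Finset.sum_comm]
          simp [Matrix.trace, Matrix.mul_apply]
    rw [e1, e2, zero_sub]
  have h3 : W + W ∈ Ideal.span (Set.range (D.Y n)) := by
    rw [h2]
    refine neg_mem (S.sum_tot_mem n _ fun μ => ?_)
    -- The required condition is the trace of `G` times a commutator with `L`, which vanishes by
    -- cyclicity.
    have : ∑ ν, (S.G * S.cR ν).trace * D.coord ⁅S.e ν, S.e μ⁆ =
        -(S.G * ∑ ν, D.coord ⁅S.e μ, S.e ν⁆ • S.cR ν).trace := by
      rw [Finset.mul_sum, Matrix.trace_sum, ← Finset.sum_neg_distrib]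
      refine Finset.sum_congr rfl fun ν _ => ?_
      rw [Matrix.mul_smul, Matrix.trace_smul, S.coord_lie_swap ν μ, smul_eq_mul]
      ring
    rw [this, S.sum_coord_cR, S.trace_G_commutator, neg_zero]
  have h4 : W = algebraMap ℂ (D.B n) (1 / 2) * (W + W) := by
    rw [← Algebra.smul_def, ← two_smul ℂ, smul_smul]
    norm_num
  rw [h4]
  exact Ideal.mul_mem_left _ _ h3

theorem sum_yv_mem : ∑ i, S.yv n i ∈ Ideal.span (Set.range (D.Y n)) := by
  have h : ∑ i, S.yv n i = -∑ ν, D.d n (S.e ν) * D.tot n (S.e ν) +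
      ∑ p, ∑ q, D.F n (S.G q p) * (D.tot n (S.m p) * D.tot n (S.m q)) := by
    simp only [yv, Finset.sum_add_distrib, Finset.sum_neg_distrib]
    congr 1
    · rw [Finset.sum_comm]
      simp only [← Finset.mul_sum, ← D.tot_apply]
    · rw [Finset.sum_comm]
      refine Finset.sum_congr rfl fun p _ => ?_
      rw [Finset.sum_comm]
      refine Finset.sum_congr rfl fun q _ => ?_
      rw [← Finset.mul_sum, ← Finset.sum_mul, ← D.tot_apply]
  rw [h]
  exact add_mem (neg_mem (S.sum_d_tot_mem n)) (S.sum_G_tot_tot_mem n)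

theorem xSum_comm (S : OrthonormalFrame D) {i j : Fin n} (hij : i ≠ j) : Commute (D.xSum n i) (D.xSum n j) := by
  rw [S.xSum_eq, S.xSum_eq]
  refine Commute.sum_left _ _ _ fun ν _ => Commute.sum_right _ _ _ fun μ _ => ?_
  exact ((D.F_F n _ _).mul_left (D.F_leg n _ i _).symm).mul_right
    ((D.F_leg n _ j _).mul_left (D.leg_comm n hij _ _))

theorem xSum_tLeg (S : OrthonormalFrame D) (α : Γ) {i j k : Fin n} (hij : i ≠ j) (hik : i ≠ k) :
    Commute (D.xSum n i) (D.tLeg n α j k) := by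
  rw [S.xSum_eq]
  exact Commute.sum_left _ _ _ fun ν _ =>
    (D.op_tLeg n _ α j k).mul_left (D.leg_tLeg n α hij hik _)

/-- The diagonal factors `tot m_q` act on legs `j` and `k` too, but they come from elements fixed by
`Γ` and so commute with `t_{jk}^α`. -/
theorem yv_tLeg (α : Γ) {i j k : Fin n} (hij : i ≠ j) (hik : i ≠ k) :
    Commute (S.yv n i) (D.tLeg n α j k) := by
  rw [yv]
  refine Commute.add_left (Commute.neg_left ?_) ?_
  · exact Commute.sum_left _ _ _ fun ν _ =>
      (D.op_tLeg n _ α j k).mul_left (D.leg_tLeg n α hij hik _)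
  · exact Commute.sum_left _ _ _ fun p _ => Commute.sum_left _ _ _ fun q _ =>
      (D.op_tLeg n _ α j k).mul_left ((D.leg_tLeg n α hij hik _).mul_left
        (D.tot_tLeg n α j k (D.m_le _)))

theorem leg_add_leg_tLeg (α : Γ) {i j : Fin n} (hij : i ≠ j) {u : 𝔤} (hu : u ∈ E.fixed) :
    Commute (D.leg n i u + D.leg n j u) (D.tLeg n α i j) := by
  have := D.leg_add_leg_tLeg n α hij u
  rwa [hu α] at this

theorem xSum_add_xSum_tLeg (S : OrthonormalFrame D) (α : Γ) {i j : Fin n} (hij : i ≠ j) :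
    Commute (D.xSum n i + D.xSum n j) (D.tLeg n α i j) := by
  rw [S.xSum_eq, S.xSum_eq, ← Finset.sum_add_distrib]
  refine Commute.sum_left _ _ _ fun ν _ => ?_
  rw [← mul_add]
  exact (D.op_tLeg n _ α i j).mul_left (leg_add_leg_tLeg n α hij (D.h_le _))

theorem yv_add_yv_tLeg (α : Γ) {i j : Fin n} (hij : i ≠ j) :
    Commute (S.yv n i + S.yv n j) (D.tLeg n α i j) := by
  rw [yv, yv, add_add_add_comm, ← neg_add, ← Finset.sum_add_distrib, ← Finset.sum_add_distrib]
  refine Commute.add_left (Commute.neg_left ?_) ?_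
  · refine Commute.sum_left _ _ _ fun ν _ => ?_
    rw [← mul_add]
    exact (D.op_tLeg n _ α i j).mul_left (leg_add_leg_tLeg n α hij (D.h_le _))
  · refine Commute.sum_left _ _ _ fun p _ => ?_
    rw [← Finset.sum_add_distrib]
    refine Commute.sum_left _ _ _ fun q _ => ?_
    rw [← mul_add, ← add_mul]
    exact (D.op_tLeg n _ α i j).mul_left ((leg_add_leg_tLeg n α hij (D.m_le _)).mul_left
      (D.tot_tLeg n α i j (D.m_le _)))

/-- The derivative part contributes `∑ e_ν^{(i)} e_ν^{(j)}` and the `r`-matrix part `∑ m_p^{(i)}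
m_p^{(j)}`; together they form `t_𝔩^{(ij)}`, the average of the `t_{ij}^α`. -/
theorem xSum_yv {i j : Fin n} (hij : i ≠ j) :
    D.xSum n i * S.yv n j = S.yv n j * D.xSum n i +
      (Fintype.card Γ : ℂ)⁻¹ • ∑ α, D.tLeg n α i j := by
  rw [← D.tensorMul_tFixed, S.tensorMul_tFixed, yv_eq_sub, S.xSum_eq]
  have h1 : S.dl n j * (∑ ν, D.F n (D.coord (S.e ν)) * D.leg n i (S.e ν)) =
      (∑ ν, D.F n (D.coord (S.e ν)) * D.leg n i (S.e ν)) * S.dl n j +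
      ∑ ν, D.leg n i (S.e ν) * D.leg n j (S.e ν) := by
    have h : ∀ μ ν, D.d n (S.e μ) * D.leg n j (S.e μ) *
        (D.F n (D.coord (S.e ν)) * D.leg n i (S.e ν)) =
        (D.F n (D.coord (S.e ν)) * D.leg n i (S.e ν)) * (D.d n (S.e μ) * D.leg n j (S.e μ)) +
          if μ = ν then D.leg n i (S.e μ) * D.leg n j (S.e μ) else 0 := by
      intro μ ν
      have hc := D.d_F n (S.e μ) (D.coord (S.e ν))
      rw [S.der_e_coord] at hc
      have e1 := (D.F_leg n (D.coord (S.e ν)) j (S.e μ)).eq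
      have e2 := (D.leg_comm n hij (S.e ν) (S.e μ)).eq
      have e3 := (D.d_leg n (S.e μ) i (S.e ν)).eq
      rw [mul_assoc (D.d n _), ← mul_assoc (D.leg n j _), ← e1, mul_assoc (D.F n _), ← e2,
        ← mul_assoc (D.d n _), hc, add_mul, mul_assoc (D.F n _), ← mul_assoc (D.d n _), e3]
      congr 1
      · simp only [mul_assoc]
      · split_ifs with hμ
        · rw [hμ, map_one, one_mul]
        · rw [map_zero, zero_mul]
    rw [dl, sum_commutator fun μ _ => commutator_sum fun ν _ => h μ ν]
    simp
  have h2 : (∑ ν, D.F n (D.coord (S.e ν)) * D.leg n i (S.e ν)) * S.rl n j =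
      S.rl n j * (∑ ν, D.F n (D.coord (S.e ν)) * D.leg n i (S.e ν)) +
      ∑ p, D.leg n i (S.m p) * D.leg n j (S.m p) := by
    have h : ∀ ν p q, D.F n (D.coord (S.e ν)) * D.leg n i (S.e ν) *
        (D.F n (S.G q p) * (D.leg n j (S.m p) * D.tot n (S.m q))) =
        D.F n (S.G q p) * (D.leg n j (S.m p) * D.tot n (S.m q)) *
          (D.F n (D.coord (S.e ν)) * D.leg n i (S.e ν)) +
        D.F n (D.coord (S.e ν)) * (D.F n (S.G q p) * (D.leg n j (S.m p) *
          ∑ s, D.F n (S.cR ν s q) * D.leg n i (S.m s))) := by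
      intro ν p q
      rw [← leg_lie_e_m]
      refine commutator_fn_mul (D.F_F n _ _) ((D.F_leg n _ j _).mul_right (D.F_tot n _ _))
        (D.F_leg n _ i _) ?_
      have := commutator_mul (z := D.leg n i (S.e ν)) (a := D.leg n j (S.m p)) (a' := 0)
        ((D.leg_comm n hij (S.e ν) (S.m p)).eq.trans (add_zero _).symm)
        (D.leg_tot n i (S.e ν) (S.m q))
      rwa [zero_mul, zero_add] at this
    rw [rl_eq, sum_commutator fun ν _ => commutator_sum fun p _ => commutator_sum fun q _ =>
      h ν p q]
    congr 1
    have e1 : ∀ ν, ∑ p, ∑ q, D.F n (D.coord (S.e ν)) * (D.F n (S.G q p) * (D.leg n j (S.m p) *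
          ∑ s, D.F n (S.cR ν s q) * D.leg n i (S.m s))) =
        ∑ p, ∑ s, D.F n (D.coord (S.e ν) * (S.cR ν * S.G) s p) *
          (D.leg n j (S.m p) * D.leg n i (S.m s)) := by
      intro ν
      have := bil_mul_right (D.F n) S.G.transpose (S.cR ν) (fun p => D.leg n j (S.m p))
        (fun s => D.leg n i (S.m s)) (fun r p => D.F_leg n r j _)
      rw [← Matrix.transpose_mul] at this
      simp only [← Finset.mul_sum]
      refine (congrArg _ this).trans ?_
      simp only [bil, Finset.mul_sum, map_mul, mul_assoc, Matrix.transpose_apply]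
    simp only [e1]
    calc _ = ∑ p, ∑ s, ∑ ν, D.F n (D.coord (S.e ν) * (S.cR ν * S.G) s p) *
          (D.leg n j (S.m p) * D.leg n i (S.m s)) := by
          rw [Finset.sum_comm]
          exact Finset.sum_congr rfl fun p _ => Finset.sum_comm
      -- Summing coordinates against the `c ν` reassembles `L`, and `L G = 1` collapses the double
      -- sum to its diagonal.
      _ = ∑ p, ∑ s, D.F n ((S.L * S.G) s p) * (D.leg n j (S.m p) * D.leg n i (S.m s)) := by
          refine Finset.sum_congr rfl fun p _ => Finset.sum_congr rfl fun s _ => ?_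
          rw [← Finset.sum_mul, ← map_sum, L_eq', Finset.sum_mul, Matrix.sum_apply]
          simp only [Matrix.smul_mul, Matrix.smul_apply, smul_eq_mul]
      _ = _ := by
          refine Finset.sum_congr rfl fun p _ => ?_
          simp only [L_mul_G, Matrix.one_apply, apply_ite (D.F n), map_one, map_zero, ite_mul,
            one_mul, zero_mul, Finset.sum_ite_eq', Finset.mem_univ, if_true]
          exact (D.leg_comm n hij.symm _ _).eq
  rw [mul_sub, sub_mul, h1, h2]
  abel

end OrthonormalFrame

/-! ### Morphisms out of the presented Lie algebra -/

theorem LieIdeal.exists_quotient_lift {L L' : Type*} [LieRing L] [LieAlgebra ℂ L] [LieRing L']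
    [LieAlgebra ℂ L'] (I : LieIdeal ℂ L) (f : L →ₗ⁅ℂ⁆ L') (h : I ≤ f.ker) :
    ∃ g : L ⧸ I →ₗ⁅ℂ⁆ L', ∀ x, g (LieSubmodule.Quotient.mk x) = f x := by
  let g0 : L ⧸ I →ₗ[ℂ] L' := I.toSubmodule.liftQ (f : L →ₗ[ℂ] L') (fun x hx => h hx)
  have hg0 : ∀ x, g0 (LieSubmodule.Quotient.mk x) = f x := fun x => rfl
  refine ⟨{ g0 with map_lie' := ?_ }, hg0⟩
  intro a b
  obtain ⟨a, rfl⟩ := LieSubmodule.Quotient.surjective_mk' I a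
  obtain ⟨b, rfl⟩ := LieSubmodule.Quotient.surjective_mk' I b
  exact f.map_lie a b

/-- The projection onto the quotient by an ideal, as a morphism of Lie algebras. -/
def LieIdeal.quotientMk {L : Type*} [LieRing L] [LieAlgebra ℂ L] (I : LieIdeal ℂ L) :
    L →ₗ⁅ℂ⁆ L ⧸ I :=
  { I.toSubmodule.mkQ with map_lie' := rfl }

theorem EllBraidBar.lieHom_ext {Γ : Type*} [AddCommGroup Γ] [Fintype Γ] {n : ℕ} {L : Type*}
    [LieRing L] [LieAlgebra ℂ L] {f g : EllBraidBar Γ n →ₗ⁅ℂ⁆ L}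
    (h : ∀ a, f (EllBraidBar.gen Γ n a) = g (EllBraidBar.gen Γ n a)) : f = g := by
  have h0 : f.comp ((LieIdeal.quotientMk _).comp (LieIdeal.quotientMk _)) =
      g.comp ((LieIdeal.quotientMk _).comp (LieIdeal.quotientMk _)) :=
    FreeLieAlgebra.hom_ext fun a => h a
  ext x
  obtain ⟨x, rfl⟩ := LieSubmodule.Quotient.surjective_mk' _ x
  obtain ⟨x, rfl⟩ := LieSubmodule.Quotient.surjective_mk' _ x
  exact LieHom.congr_fun h0 x

/-! ### Classes in the Hecke algebra and construction of the morphism -/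

namespace ReductiveDecomposition

variable {Γ : Type*} [AddCommGroup Γ] [Fintype Γ] {𝔤 : Type*} [LieRing 𝔤] [LieAlgebra ℂ 𝔤]
variable {E : EquivariantTensor Γ 𝔤} (D : ReductiveDecomposition E) (n : ℕ)

theorem heckeMk_eq_zero (u : D.invariants n) :
    D.heckeMk n u = 0 ↔ (u : D.B n) ∈ Ideal.span (Set.range (D.Y n)) :=
  Ideal.Quotient.eq_zero_iff_mem

theorem lie_heckeMk (u v : D.invariants n) :
    ⁅D.heckeMk n u, D.heckeMk n v⁆ = D.heckeMk n (u * v - v * u) := by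
  rw [map_sub, map_mul, map_mul]
  rfl

theorem lie_heckeMk_eq_zero {u v : D.invariants n} (h : Commute (u : D.B n) v) :
    ⁅D.heckeMk n u, D.heckeMk n v⁆ = 0 := by
  have : u * v - v * u = 0 := Subtype.ext (sub_eq_zero.2 h.eq)
  rw [lie_heckeMk, this, map_zero]

/-- The class of `(α ⊗ id)(t)^{(ij)}`. -/
def tH (α : Γ) (i j : Fin n) : D.Hecke n := D.heckeMk n ⟨_, D.tLeg_mem_invariants n α i j⟩

end ReductiveDecomposition

namespace OrthonormalFrame

variable {Γ : Type*} [AddCommGroup Γ] [Fintype Γ] {𝔤 : Type*} [LieRing 𝔤] [LieAlgebra ℂ 𝔤]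
variable {E : EquivariantTensor Γ 𝔤} {D : ReductiveDecomposition E} (S : OrthonormalFrame D)
variable (n : ℕ)

/-- The class of `∑_ν x̄_ν e_ν^{(i)}`. -/
def xH (i : Fin n) : D.Hecke n := D.heckeMk n ⟨_, S.xSum_mem_invariants n i⟩

/-- The class of `ȳ_i / N`. -/
def yH (i : Fin n) : D.Hecke n := D.heckeMk n ⟨_, S.yv_mem_invariants n i⟩

theorem sum_xH : ∑ i, S.xH n i = 0 := by
  simp only [xH, ← map_sum]
  rw [D.heckeMk_eq_zero]
  simp only [AddSubmonoidClass.coe_finsetSum]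
  exact S.sum_xSum_mem n

theorem sum_yH : ∑ i, S.yH n i = 0 := by
  simp only [yH, ← map_sum]
  rw [D.heckeMk_eq_zero]
  simp only [AddSubmonoidClass.coe_finsetSum]
  exact S.sum_yv_mem n

theorem lie_xH_xH {i j : Fin n} (hij : i ≠ j) : ⁅S.xH n i, S.xH n j⁆ = 0 :=
  D.lie_heckeMk_eq_zero n (S.xSum_comm n hij)

theorem lie_yH_yH {i j : Fin n} (hij : i ≠ j) : ⁅S.yH n i, S.yH n j⁆ = 0 := by
  rw [yH, yH, D.lie_heckeMk, D.heckeMk_eq_zero]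
  exact S.yv_comm_mem n hij

theorem lie_xH_yH {i j : Fin n} (hij : i ≠ j) :
    ⁅S.xH n i, S.yH n j⁆ = (Fintype.card Γ : ℂ)⁻¹ • ∑ α, D.tH n α i j := by
  simp only [xH, yH, ReductiveDecomposition.tH, D.lie_heckeMk, ← map_sum, ← map_smul]
  congr 1
  apply Subtype.ext
  simp only [AddSubgroupClass.coe_sub, MulMemClass.coe_mul, Subalgebra.coe_smul,
    AddSubmonoidClass.coe_finsetSum]
  rw [S.xSum_yv n hij, add_sub_cancel_left]

/-- The images of the generators under the morphism `ρ`, with parameters `M` and `N`. -/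
def genImage (M N : ℂ) : EllGen Γ n → D.Hecke n
  | EllGen.x i => M • S.xH n i
  | EllGen.y i => N • S.yH n i
  | EllGen.t α i j _ => D.tH n α i j

/-- Only the product `M N` is constrained: it must cancel the `1/|Γ|` in `lie_xH_yH`. All other
relations are homogeneous in the two scalars. -/
theorem exists_morphism (M N : ℂ) (hMN : M * N = Fintype.card Γ) :
    ∃ ρ : EllBraidBar Γ n →ₗ⁅ℂ⁆ D.Hecke n,
      ∀ a, ρ (EllBraidBar.gen Γ n a) = S.genImage n M N a := by
  have hcard : (Fintype.card Γ : ℂ) ≠ 0 := by simp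
  have hxy : ∀ i j : Fin n, i ≠ j → ⁅M • S.xH n i, N • S.yH n j⁆ = ∑ α, D.tH n α i j := by
    intro i j hij
    rw [smul_lie, lie_smul, S.lie_xH_yH n hij, smul_smul, smul_smul, hMN, mul_inv_cancel₀ hcard,
      one_smul]
  have hsymm : ∀ (α : Γ) (i j : Fin n), i ≠ j → D.tH n α i j = D.tH n (-α) j i := by
    intro α i j hij
    rw [ReductiveDecomposition.tH, ReductiveDecomposition.tH]
    congr 2
    exact D.tLeg_symm n α hij
  let f := FreeLieAlgebra.lift ℂ (S.genImage n M N)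
  have hf : ∀ a, f (FreeLieAlgebra.of ℂ a) = S.genImage n M N a :=
    FreeLieAlgebra.lift_of_apply (R := ℂ) _
  have h1 : (LieSubmodule.lieSpan ℂ (FreeLieAlgebra ℂ (EllGen Γ n)) {u | EllRel Γ n u} :
      LieIdeal ℂ (FreeLieAlgebra ℂ (EllGen Γ n))) ≤ f.ker := by
    rw [LieSubmodule.lieSpan_le]
    intro u hu
    change f u = 0
    have hu : EllRel Γ n u := hu
    cases hu with
    | symm α i j hij =>
      simp only [map_sub, EllGen.ft, hf, genImage]
      rw [hsymm α i j hij, sub_self]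
    | xy i j hij =>
      simp only [map_sub, map_sum, LieHom.map_lie, EllGen.ft, EllGen.fx, EllGen.fy, hf, genImage]
      rw [hxy i j hij, sub_self]
    | xy_comm i j hij =>
      simp only [map_sub, LieHom.map_lie, EllGen.fx, EllGen.fy, hf, genImage]
      rw [hxy i j hij, hxy j i hij.symm, sub_eq_zero]
      -- Exchanging `i` and `j` replaces `α` by `-α`, which only permutes the sum over `Γ`.
      simp only [hsymm _ i j hij]
      exact Fintype.sum_equiv (Equiv.neg Γ) _ _ (fun α => rfl)
    | xx i j hij =>
      simp only [LieHom.map_lie, EllGen.fx, hf, genImage, smul_lie, lie_smul]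
      rw [S.lie_xH_xH n hij, smul_zero, smul_zero]
    | yy i j hij =>
      simp only [LieHom.map_lie, EllGen.fy, hf, genImage, smul_lie, lie_smul]
      rw [S.lie_yH_yH n hij, smul_zero, smul_zero]
    | xy_self i =>
      simp only [map_add, map_sum, LieHom.map_lie, EllGen.ft, EllGen.fx, EllGen.fy, hf, genImage]
      -- The images of the `y_j` sum to zero, so `[x_i, y_i]` is minus the sum of the off-diagonal
      -- brackets.
      have h : ∑ j, ⁅M • S.xH n i, N • S.yH n j⁆ = 0 := by
        rw [← lie_sum, ← Finset.smul_sum, S.sum_yH, smul_zero, lie_zero]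
      rw [← Finset.add_sum_erase _ _ (Finset.mem_univ i),
        Finset.sum_subtype (p := fun j => i ≠ j) (Finset.univ.erase i) (fun j => by
          simp [eq_comm])] at h
      rw [← h]
      congr 1
      exact Finset.sum_congr rfl fun j _ => (hxy i j.1 j.2).symm
    | tt α β i j k l hij hkl hik hil hjk hjl =>
      simp only [LieHom.map_lie, EllGen.ft, hf, genImage]
      exact D.lie_heckeMk_eq_zero n (D.tLeg_comm n α β hik hil hjk hjl)
    | xt α i j k hij hik hjk =>
      simp only [LieHom.map_lie, EllGen.ft, EllGen.fx, hf, genImage, smul_lie]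
      exact smul_eq_zero_of_right _ (D.lie_heckeMk_eq_zero n (S.xSum_tLeg n α hij hik))
    | yt α i j k hij hik hjk =>
      simp only [LieHom.map_lie, EllGen.ft, EllGen.fy, hf, genImage, smul_lie]
      exact smul_eq_zero_of_right _ (D.lie_heckeMk_eq_zero n (S.yv_tLeg n α hij hik))
    | fourT α β i j k hij hik hjk =>
      simp only [LieHom.map_lie, map_add, EllGen.ft, hf, genImage]
      rw [ReductiveDecomposition.tH, ReductiveDecomposition.tH, ReductiveDecomposition.tH, ← map_add]
      exact D.lie_heckeMk_eq_zero n (D.tLeg_fourT n α β hij hik hjk)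
    | xxt α i j hij =>
      simp only [LieHom.map_lie, map_add, EllGen.ft, EllGen.fx, hf, genImage]
      rw [← smul_add, smul_lie, xH, xH, ← map_add]
      exact smul_eq_zero_of_right _ (D.lie_heckeMk_eq_zero n (S.xSum_add_xSum_tLeg n α hij))
    | yyt α i j hij =>
      simp only [LieHom.map_lie, map_add, EllGen.ft, EllGen.fy, hf, genImage]
      rw [← smul_add, smul_lie, yH, yH, ← map_add]
      exact smul_eq_zero_of_right _ (D.lie_heckeMk_eq_zero n (S.yv_add_yv_tLeg n α hij))
  obtain ⟨g, hg⟩ := LieIdeal.exists_quotient_lift _ f h1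
  have hgen : ∀ a, g (EllBraid.gen Γ n a) = S.genImage n M N a := fun a => (hg _).trans (hf a)
  have h2 : EllBraid.sumIdeal Γ n ≤ g.ker := by
    rw [EllBraid.sumIdeal, LieSubmodule.lieSpan_le]
    rintro u (rfl | rfl)
    · change g _ = 0
      simp only [map_sum, hgen, genImage]
      rw [← Finset.smul_sum, S.sum_xH, smul_zero]
    · change g _ = 0
      simp only [map_sum, hgen, genImage]
      rw [← Finset.smul_sum, S.sum_yH, smul_zero]
  obtain ⟨r, hr⟩ := LieIdeal.exists_quotient_lift _ g h2
  exact ⟨r, fun a => (hr _).trans (hgen a)⟩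

end OrthonormalFrame
end

/-! ### The proposition -/

theorem mainTheorem7 (M N : ℕ) [NeZero M] [NeZero N] (n : ℕ)
    {𝔤 : Type*} [LieRing 𝔤] [LieAlgebra ℂ 𝔤]
    (E : EquivariantTensor (ZMod M × ZMod N) 𝔤)
    (D : ReductiveDecomposition E) (hP : D.P ≠ 0) :
    ∃ (hx : ∀ i : Fin n, (M : ℂ) • D.xSum n i ∈ D.invariants n)
      (hy : ∀ i : Fin n,
        -(N : ℂ) • D.dSum n i + (N : ℂ) • ∑ j, D.rLeg n i j ∈ D.invariants n)
      (ht : ∀ (α : ZMod M × ZMod N) (i j : Fin n), i ≠ j → D.tLeg n α i j ∈ D.invariants n),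
      ∃! ρ : EllBraidBar (ZMod M × ZMod N) n →ₗ⁅ℂ⁆ D.Hecke n,
        (∀ i, ρ (EllBraidBar.gen _ n (EllGen.x i)) = D.heckeMk n ⟨_, hx i⟩) ∧
        (∀ i, ρ (EllBraidBar.gen _ n (EllGen.y i)) = D.heckeMk n ⟨_, hy i⟩) ∧
        (∀ α i j, ∀ hij : i ≠ j,
          ρ (EllBraidBar.gen _ n (EllGen.t α i j hij)) = D.heckeMk n ⟨_, ht α i j hij⟩) := by
  obtain ⟨S⟩ := D.exists_orthonormalFrame
  have hyv : ∀ i : Fin n, -(N : ℂ) • D.dSum n i + (N : ℂ) • ∑ j, D.rLeg n i j =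
      (N : ℂ) • S.yv n i := by
    intro i
    rw [S.yv_eq, smul_add, smul_neg, neg_smul]
  have hx : ∀ i : Fin n, (M : ℂ) • D.xSum n i ∈ D.invariants n := fun i =>
    Subalgebra.smul_mem _ (S.xSum_mem_invariants n i) _
  have hy : ∀ i : Fin n,
      -(N : ℂ) • D.dSum n i + (N : ℂ) • ∑ j, D.rLeg n i j ∈ D.invariants n := fun i =>
    (hyv i).symm ▸ Subalgebra.smul_mem _ (S.yv_mem_invariants n i) _
  refine ⟨hx, hy, fun α i j _ => D.tLeg_mem_invariants n α i j, ?_⟩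
  have hx' : ∀ i, D.heckeMk n ⟨_, hx i⟩ = (M : ℂ) • S.xH n i := fun i => by
    rw [OrthonormalFrame.xH, ← map_smul]
    rfl
  have hy' : ∀ i, D.heckeMk n ⟨_, hy i⟩ = (N : ℂ) • S.yH n i := fun i => by
    rw [OrthonormalFrame.yH, ← map_smul]
    exact congrArg _ (Subtype.ext (hyv i))
  -- The scalars `M` and `N` are admissible because `Γ` has `M N` elements.
  obtain ⟨ρ, hρ⟩ := S.exists_morphism n (M : ℂ) (N : ℂ) (by
    rw [Fintype.card_prod, ZMod.card, ZMod.card, Nat.cast_mul])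
  refine ⟨ρ, ⟨fun i => (hρ _).trans (hx' i).symm, fun i => (hρ _).trans (hy' i).symm,
    fun α i j hij => hρ _⟩, ?_⟩
  rintro σ ⟨h1, h2, h3⟩
  refine EllBraidBar.lieHom_ext fun a => ?_
  rw [hρ]
  cases a with
  | x i => exact (h1 i).trans (hx' i)
  | y i => exact (h2 i).trans (hy' i)
  | t α i j hij => exact h3 α i j hij
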